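/- Let $\Omega\subset\mathbb R^2$ be compact and convex, and let $\phi:\mathbb R^2\to[0,\infty)$ be continuous on $\Omega$. There are $n$ agents with reported positions $q=(q_1,\dots,q_n)$, localization uncertainty disks $C_i^u=\{p:\|p-q_i\|\le r_i^u\}$ with $r_i^u\ge 0$, and a common sensing range $r^s$. For $i\ne j$ let $$H_{ij}=\{p\in\Omega:\ \max_{x\in C_i^u}\|p-x\|\le\min_{y\in C_j^u}\|p-y\|\},\qquad \partial H_{ij}=\{p\in\Omega:\ \|p-q_j\|-\|p-q_i\|=r_i^u+r_j^u\}$$ (the latter is an arc of a hyperbola branch). The Guaranteed Voronoi cells are $V_i^g=\{p\in\Omega:\ p\in H_{ij}\ \forall j\neq i\}$. The guaranteed sensed regions are $C_i^{gs}=\{p\in\Omega:\|p-q_i\|\le r^s-r_i^u\}$, where $\partial C_i^{gs}$ denotes the circle $\|p-q_i\|=r^s-r_i^u$. Put $V_i^{gs}=V_i^g\cap C_i^{gs}$ and $$\mathcal H(q)=\int_{\bigcup_i V_i^{gs}}\phi(p)\,dp .$$ Agents $i\ne j$ are called guaranteed Delaunay neighbours, $j\in N_i^g$, if $\partial H_{ij}\cap\partial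 V_i^g\ne\emptyset$ or $\partial H_{ji}\cap\partial V_j^g\neq\emptyset$. Let $n_i$ be the outward unit normal on $\partial V_i^{gs}$. Parametrize $\partial H_{ij}$ by $$\gamma_{ij}(t)=\tfrac{q_i+q_j}{2}-a\cosh(t)\,e+b\sinh(t)\,e^{\perp},\qquad a=\tfrac{r_i^u+r_j^u}{2},\quad b=\sqrt{\tfrac14\|q_j-q_i\|^2-a^2},\quad e=\tfrac{q_j-q_i}{\|q_j-q_i\|},$$ where $e^{\perp}$ is $e$ rotated by a right angle. Let $\upsilon_i^k$ be the transposed Jacobian matrix, with respect to $q_k$ and at fixed $t$, of the points $\gamma_{ij}(t)$ of $\partial H_{ij}$. For constants $\alpha_i>0$ consider the dynamics $\dot q_i=u_i$ with the control law $$u_i(q)=\alpha_i\int_{\partial V_i^{gs}\cap\partial C_i^{gs}} n_i\,\phi\,ds+\alpha_i\sum_{j\in N_i^g}\Big[\int_{\partial V_i^{gs}\cap\partial H_{ij}}\upsilon_i^i\,n_i\,\phi\,ds+\int_{\partial V_j^{gs}\cap\partial H_{ji}}\upsilon_j^i\,n_j\,\phi\,ds\Big],$$ where $ds$ is arc length.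 Call a configuration $q$ admissible if $q_i\in\Omega$ for all $i$, if the uncertainty disks are pairwise disjoint ($\|q_i-q_j\|>r_i^u+r_j^u$ for $i\ne j$), and if, for every $i$, the set $V_i^{gs}\cap\partial C_i^{gs}\cap\partial\Omega$ has length zero. Then: 1. At every admissible configuration $\mathcal H$ is differentiable with respect to each $q_i$, and $u_i=\alpha_i\,\partial\mathcal H/\partial q_i$. 2. Along every solution $q(t)$ of $\dot q_i=u_i(q)$ that runs through admissible configurations over an interval of times, $\mathcal H(q(t))$ is differentiable, with $$\frac{d}{dt}\mathcal H(q(t))=\sum_i\frac{1}{\alpha_i}\|u_i\|^2\ge 0$$ (which is $\sum_i\|u_i\|^2$ if all $\alpha_i=1$), so $\mathcal H$ is nondecreasing along it. 3. If such a solution exists for all $t\ge 0$, then every admissible limit point $q'$ of $q(t)$ as $t\to\infty$ is locally optimal to first order: $\partial\mathcal H/\partial q_i(q')=0$ and $u_i(q')=0$ for all $i$. Moreover $\mathcal H(q(t))\to\mathcal H(q')$, and $\mathcal H(q(t))\le\mathcal H(q')$ for all $t\ge 0$. -/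

import Mathlib

open Set Filter Topology MeasureTheory
open scoped RealInnerProductSpace

noncomputable section

namespace GuaranteedVoronoi

/-- The Euclidean plane. -/
abbrev Plane : Type := EuclideanSpace ℝ (Fin 2)

/-- The data of the coverage problem for `n` agents: the surveyed region, the radii of the
localization uncertainty disks, the common sensing range and the importance density. -/
structure Network (n : ℕ) where
  Ω : Set Plane
  ru : Fin n → ℝ
  rs : ℝ
  φ : Plane → ℝ

/-- A configuration: the reported positions of the `n` agents. -/
abbrev Config (n : ℕ) : Type := Fin n → Plane

variable {n : ℕ}

/-! ### Regions attached to a configuration -/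

/-- The disk in which agent `i` is known to lie. -/
def uncertaintyDisk (P : Network n) (q : Config n) (i : Fin n) : Set Plane :=
  Metric.closedBall (q i) (P.ru i)

/-- The radius of the guaranteed sensed disk of agent `i`. -/
def sensingRadius (P : Network n) (i : Fin n) : ℝ := P.rs - P.ru i

/-- The guaranteed sensed region of agent `i` (empty if the radius is negative). -/
def guaranteedSensed (P : Network n) (q : Config n) (i : Fin n) : Set Plane :=
  {p ∈ P.Ω | ‖p - q i‖ ≤ sensingRadius P i}

/-- The points of `Ω` closer to agent `i` than to agent `j`, for all possible positions of the
two agents: `max ‖p - x‖ ≤ min ‖p - y‖` over `x` and `y` in the two uncertainty disks. -/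
def dominance (P : Network n) (q : Config n) (i j : Fin n) : Set Plane :=
  {p ∈ P.Ω | ∀ x ∈ uncertaintyDisk P q i, ∀ y ∈ uncertaintyDisk P q j, ‖p - x‖ ≤ ‖p - y‖}

/-- The guaranteed Voronoi cell of agent `i`. -/
def gvCell (P : Network n) (q : Config n) (i : Fin n) : Set Plane :=
  {p ∈ P.Ω | ∀ j, j ≠ i → p ∈ dominance P q i j}

/-- The guaranteed-sensing Voronoi cell of agent `i`. -/
def gsvCell (P : Network n) (q : Config n) (i : Fin n) : Set Plane :=
  gvCell P q i ∩ guaranteedSensed P q i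

/-- The coverage criterion `H`: the `φ`-weighted area of the union of the cells. -/
def coverage (P : Network n) (q : Config n) : ℝ :=
  ∫ p in ⋃ i, gsvCell P q i, P.φ p

/-! ### Boundary arcs and neighbours -/

/-- The circle bounding the guaranteed sensed disk of agent `i`. -/
def sensingCircle (P : Network n) (q : Config n) (i : Fin n) : Set Plane :=
  {p | ‖p - q i‖ = sensingRadius P i}

/-- The part in `Ω` of the hyperbola branch that bounds `dominance P q i j`; its foci are `q i`
and `q j`. -/
def hyperbolicArc (P : Network n) (q : Config n) (i j : Fin n) : Set Plane :=
  {p ∈ P.Ω | ‖p - q j‖ - ‖p - q i‖ = P.ru i + P.ru j}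

/-- The guaranteed Delaunay neighbours of `i`: the agents `j ≠ i` whose branch towards `i`
contributes to the boundary of the cell of `i`. -/
def gdNeighbors (P : Network n) (q : Config n) (i : Fin n) : Set (Fin n) :=
  {j | j ≠ i ∧ (hyperbolicArc P q i j ∩ frontier (gvCell P q i)).Nonempty}

/-! ### Parametrizations, normals and line integrals -/

/-- The circle of centre `c` and radius `R`. -/
def circleCurve (c : Plane) (R θ : ℝ) : Plane :=
  c + R • !₂[Real.cos θ, Real.sin θ]

/-- Rotation of the plane by a right angle. -/
def rot (v : Plane) : Plane := !₂[-(v 1), v 0]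

/-- The branch around the focus `x` of the hyperbola with foci `x`, `y` and semi-major axis `a`:
with `c = ‖y - x‖ / 2`, `b = √(c² - a²)` and the orthonormal frame `e = (y - x) / ‖y - x‖`, `rot e`
at the midpoint of the foci, it is the curve `t ↦ (- a cosh t, b sinh t)`. -/
def hyperbolaCurve (a : ℝ) (x y : Plane) (t : ℝ) : Plane :=
  midpoint ℝ x y - (a * Real.cosh t) • (‖y - x‖⁻¹ • (y - x))
    + (Real.sqrt ((‖y - x‖ / 2) ^ 2 - a ^ 2) * Real.sinh t) • rot (‖y - x‖⁻¹ • (y - x))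

/-- The semi-major axis of the hyperbola between the agents `i` and `j`. -/
def semiMajor (P : Network n) (i j : Fin n) : ℝ := (P.ru i + P.ru j) / 2

/-- The parametrized branch carrying `hyperbolicArc P q i j`. -/
def branch (P : Network n) (q : Config n) (i j : Fin n) (t : ℝ) : Plane :=
  hyperbolaCurve (semiMajor P i j) (q i) (q j) t

/-- The transposed Jacobian matrix, with respect to the position of agent `k`, of the point with
parameter `t` on the branch carrying `hyperbolicArc P q i j`. -/
def transposedJacobian (P : Network n) (q : Config n) (k i j : Fin n) (t : ℝ) :
    Plane →L[ℝ] Plane :=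
  ContinuousLinearMap.adjoint
    (fderiv ℝ (fun x : Plane => branch P (Function.update q k x) i j t) (q k))

/-- `v` is an outward unit normal of the convex set `S` at `p` (all cells are convex). -/
def IsOutwardUnitNormal (S : Set Plane) (p v : Plane) : Prop :=
  ‖v‖ = 1 ∧ ∀ x ∈ S, ⟪x - p, v⟫ ≤ 0

open Classical in
/-- The outward unit normal of a convex set; an arbitrary one at the corners of the boundary,
where there are several. -/
def outwardNormal (S : Set Plane) (p : Plane) : Plane :=
  if h : ∃ v, IsOutwardUnitNormal S p v then h.choose else 0

/-- The line integral, with respect to arc length, of `F` over the part lying in `S` of the curve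
`γ` with parameter interval `T` (`F` is given as a function of the parameter). -/
def lineIntegral (γ : ℝ → Plane) (T : Set ℝ) (S : Set Plane) (F : ℝ → Plane) : Plane :=
  ∫ t in {t ∈ T | γ t ∈ S}, ‖deriv γ t‖ • F t

/-- `∫ n_i φ` over the part of the boundary of the cell of `i` on its sensing circle. -/
def circleTerm (P : Network n) (q : Config n) (i : Fin n) : Plane :=
  lineIntegral (circleCurve (q i) (sensingRadius P i)) (Ioc (-Real.pi) Real.pi)
    (frontier (gsvCell P q i) ∩ sensingCircle P q i)
    (fun θ =>
      P.φ (circleCurve (q i) (sensingRadius P i) θ) •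
        outwardNormal (gsvCell P q i) (circleCurve (q i) (sensingRadius P i) θ))

/-- `∫ υ_i^k n_i φ` over the part of the boundary of the cell of `i` on the hyperbolic arc
towards `j`, where `υ_i^k` is the transposed Jacobian with respect to the position of `k`. -/
def hyperbolaTerm (P : Network n) (q : Config n) (k i j : Fin n) : Plane :=
  lineIntegral (branch P q i j) univ
    (frontier (gsvCell P q i) ∩ hyperbolicArc P q i j)
    (fun t =>
      P.φ (branch P q i j t) •
        transposedJacobian P q k i j t (outwardNormal (gsvCell P q i) (branch P q i j t)))

open Classical in
/-- The control law with gains `α`. The sum runs over the agents adjacent to `i` in the guaranteed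
Delaunay graph: `j` is a guaranteed Delaunay neighbour of `i`, or `i` is one of `j`. -/
def control (P : Network n) (α : Fin n → ℝ) (q : Config n) (i : Fin n) : Plane :=
  α i • circleTerm P q i
    + α i • ∑ j with j ∈ gdNeighbors P q i ∨ i ∈ gdNeighbors P q j,
        (hyperbolaTerm P q i i j + hyperbolaTerm P q i j i)

/-! ### Configurations and trajectories -/

/-- Configurations of the network: the agents lie in `Ω`, their uncertainty disks are pairwise
disjoint, and the boundary of no cell contains an arc of positive length which belongs both to the
boundary of `Ω` and to the sensing circle of the agent. -/
structure Admissible (P : Network n) (q : Config n) : Prop where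
  mem_region : ∀ i, q i ∈ P.Ω
  disks_disjoint : ∀ i j, i ≠ j → P.ru i + P.ru j < ‖q i - q j‖
  no_common_arc : ∀ i, 0 < sensingRadius P i →
    volume {θ ∈ Ioc (-Real.pi) Real.pi |
      circleCurve (q i) (sensingRadius P i) θ ∈ frontier P.Ω ∩ gsvCell P q i} = 0

/-- `q` is a trajectory, through admissible configurations and over the set `I` of times, of the
dynamics `q̇_i = u_i` under the control law with gains `α`. -/
def IsTrajectory (P : Network n) (α : Fin n → ℝ) (I : Set ℝ) (q : ℝ → Config n) : Prop :=
  ∀ t ∈ I, Admissible P (q t) ∧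
    ∀ i, HasDerivWithinAt (fun s => q s i) (control P α (q t) i) I t

end GuaranteedVoronoi

end

/-! Differentiability. Up to null sets the cells are disjoint, so the criterion is the sum of the
masses of the single cells. Each mass is written in polar coordinates about the unperturbed position
`q₀ i`, which stays fixed while `q` varies. With `s = P.ru i + P.ru j`, dominance means `‖p - q i‖ +
s ≤ ‖p - q j‖`; after squaring, the terms `‖p‖²` cancel and a convex constraint remains
(`con_eq_affine`, `convexOn_con`). Hence on every ray the constraints hold exactly on an interval
`[0, M(q, θ)]`, and `q` enters the mass on the ray only through the upper limit `M`. Convexity and a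
uniform margin at the centre make `M` Lipschitz in `q`, uniformly in `θ`
(`IsThreshold.abs_sub_mul_le`). Where a single constraint is active, `M` is differentiable by
implicit differentiation (`hasFDerivAt_threshold`), and the mass on the ray by the fundamental
theorem of calculus, provided the endpoint is not on the boundary of `Ω` (`hasFDerivAt_rayMass`).
Differentiation under the integral sign then gives `hasFDerivAt_cellMass`.

Almost every direction is of this kind (`ae_generic`). Two arcs meet in countably many directions,
because a tie is a nontrivial equation `⟪v, dir θ⟫ = C`. A hyperbolic arc meets the boundary of the
convex set `Ω` at most once on each side of its axis, apart from the axis itself, because both foci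
lie in `Ω` (`arcPoint_mem_interior`). Only for the circular arcs does this have to be assumed, and
that is the last clause of `Admissible`.

The control law. The derivative appears as `coverageGrad`, a sum of integrals over directions,
whereas the control integrates over parametrized arcs. On the circle the two agree directly. On a
branch the change of variables is `dθ = (b / ρ) dt`, the outward normal is `N / ‖N‖` with `N =
arcNormal`, and the line element satisfies `‖γ'‖ * headway = b * ‖N‖` (`norm_deriv_branch`), so
`‖N‖` cancels. The Jacobian at fixed `t` differs from the variation at fixed `θ`, but only by motion
along the curve. Its normal part is found by differentiating the defining equation of the hyperbola
(`inner_deriv_branch`), and this produces `nearWeight` and `farWeight`. Agents that are not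
neighbours contribute empty arcs, so `control_eq` holds.

The flow. Along a trajectory the chain rule gives the derivative `∑ (α i)⁻¹ ‖u_i‖²`, so the
criterion is monotone and tends to its value at any admissible limit point. The gradient is
continuous at admissible configurations by dominated convergence (`continuousAt_coverageGrad`). If
it were nonzero at a limit point, the trajectory would return near that point at arbitrarily late
times and stay for a time bounded below, gaining each time a fixed amount of coverage, which
contradicts convergence (`not_le_deriv_near_mapClusterPt`). -/

noncomputable section

namespace GuaranteedVoronoi

variable {n : ℕ}

/-! ### Polar coordinates in the plane -/

/-- The unit vector in direction `θ`. -/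
def dir (θ : ℝ) : Plane := !₂[Real.cos θ, Real.sin θ]

@[simp] lemma dir_zero (θ : ℝ) : dir θ 0 = Real.cos θ := rfl
@[simp] lemma dir_one (θ : ℝ) : dir θ 1 = Real.sin θ := rfl

lemma inner_eq (v w : Plane) : ⟪v, w⟫ = v 0 * w 0 + v 1 * w 1 := by
  simp [PiLp.inner_apply, Fin.sum_univ_two, mul_comm]

lemma norm_sq_eq (v : Plane) : ‖v‖ ^ 2 = v 0 ^ 2 + v 1 ^ 2 := by
  rw [← real_inner_self_eq_norm_sq, inner_eq]; ring

@[simp] lemma norm_dir (θ : ℝ) : ‖dir θ‖ = 1 := by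
  have h : ‖dir θ‖ ^ 2 = 1 := by simp [norm_sq_eq]
  nlinarith [norm_nonneg (dir θ)]

lemma inner_dir_self (θ : ℝ) : ⟪dir θ, dir θ⟫ = 1 := by
  rw [real_inner_self_eq_norm_sq, norm_dir, one_pow]

lemma plane_ext {v w : Plane} (h0 : v 0 = w 0) (h1 : v 1 = w 1) : v = w := by
  ext i; fin_cases i <;> assumption

@[fun_prop] lemma continuous_dir : Continuous dir := by
  unfold dir
  refine (PiLp.continuous_toLp 2 _).comp ?_
  refine continuous_pi fun i => ?_
  fin_cases i <;> simp <;> fun_prop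

lemma dir_add_two_pi (θ : ℝ) : dir (θ + 2 * Real.pi) = dir θ :=
  plane_ext (by simp) (by simp)

lemma exists_smul_dir (v : Plane) : ∃ θ, v = ‖v‖ • dir θ := by
  refine ⟨Complex.arg ⟨v 0, v 1⟩, ?_⟩
  have hn : ‖v‖ = ‖(⟨v 0, v 1⟩ : ℂ)‖ := by
    have : ‖v‖ ^ 2 = ‖(⟨v 0, v 1⟩ : ℂ)‖ ^ 2 := by
      rw [norm_sq_eq, Complex.sq_norm, Complex.normSq_apply]; ring
    exact (pow_left_inj₀ (norm_nonneg _) (norm_nonneg _) two_ne_zero).1 this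
  apply plane_ext
  · simp [hn, Complex.norm_mul_cos_arg]
  · simp [hn, Complex.norm_mul_sin_arg]

/-- Integration over the plane in polar coordinates about the point `c`. -/
lemma integral_polar (c : Plane) (g : Plane → ℝ) (hg : Integrable g) :
    Integrable (fun θ => ∫ ρ in Ioi (0 : ℝ), ρ * g (c + ρ • dir θ))
        (volume.restrict (Ioo (-Real.pi) Real.pi)) ∧
      ∫ p, g p = ∫ θ in Ioo (-Real.pi) Real.pi, ∫ ρ in Ioi (0 : ℝ), ρ * g (c + ρ • dir θ) := by
  let T : Plane ≃ᵐ ℝ × ℝ :=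
    (MeasurableEquiv.toLp 2 (Fin 2 → ℝ)).symm.trans MeasurableEquiv.finTwoArrow
  have hT : MeasurePreserving T volume volume :=
    (volume_preserving_finTwoArrow ℝ).comp
      (EuclideanSpace.volume_preserving_symm_measurableEquiv_toLp (Fin 2))
  let f : ℝ × ℝ → ℝ := fun z => g (c + T.symm z)
  have hfi : Integrable f := by
    have h1 : Integrable (fun p => g (c + p)) := hg.comp_add_left c
    exact (hT.symm.integrable_comp_emb T.symm.measurableEmbedding).2 h1
  have hfe : ∫ z, f z = ∫ p, g p := by
    rw [← integral_add_left_eq_self g c]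
    exact hT.symm.integral_comp T.symm.measurableEmbedding (fun p => g (c + p))
  have hsymm : ∀ z : ℝ × ℝ, f (polarCoord.symm z) = g (c + z.1 • dir z.2) := by
    intro z
    have : T.symm (polarCoord.symm z) = z.1 • dir z.2 := by
      rw [MeasurableEquiv.symm_apply_eq]
      rfl
    simp only [f, this]
  have hint : IntegrableOn (fun z : ℝ × ℝ => z.1 * g (c + z.1 • dir z.2))
      (Ioi 0 ×ˢ Ioo (-Real.pi) Real.pi) := by
    have h2 := (integrableOn_image_iff_integrableOn_abs_det_fderiv_smul volume
      polarCoord.open_target.measurableSet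
      (fun p _ => (hasFDerivAt_polarCoord_symm p).hasFDerivWithinAt)
      polarCoord.symm.injOn f).1 hfi.integrableOn
    refine h2.congr_fun (fun z hz => ?_) polarCoord.open_target.measurableSet
    simp only [det_fderivPolarCoordSymm, hsymm]
    rw [abs_of_pos hz.1, smul_eq_mul]
  have hint' : Integrable (fun z : ℝ × ℝ => z.1 * g (c + z.1 • dir z.2))
      ((volume.restrict (Ioi 0)).prod (volume.restrict (Ioo (-Real.pi) Real.pi))) := by
    rw [Measure.prod_restrict]; exact hint
  refine ⟨hint'.integral_prod_right, ?_⟩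
  rw [← hfe, ← integral_comp_polarCoord_symm f]
  have : ∫ p in polarCoord.target, p.1 • f (polarCoord.symm p)
      = ∫ z in Ioi 0 ×ˢ Ioo (-Real.pi) Real.pi, z.1 * g (c + z.1 • dir z.2) := by
    refine setIntegral_congr_fun polarCoord.open_target.measurableSet (fun z _ => ?_)
    simp only [hsymm, smul_eq_mul]
  rw [this, Measure.volume_eq_prod, ← Measure.prod_restrict, integral_prod_symm _ hint']

/-! ### Countable sets of directions -/

/-- In the amplitude form `r cos (θ - β) = C` with `r ≠ 0`, one solution determines all others up to
sign and multiples of `2π`. -/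
lemma countable_trig_eq {A B C : ℝ} (h : ¬ (A = 0 ∧ B = 0 ∧ C = 0)) :
    {θ : ℝ | A * Real.cos θ + B * Real.sin θ = C}.Countable := by
  rcases eq_empty_or_nonempty {θ : ℝ | A * Real.cos θ + B * Real.sin θ = C} with h0 | ⟨θ₀, h₀⟩
  · rw [h0]; exact countable_empty
  obtain ⟨β, hβ⟩ := exists_smul_dir (!₂[A, B] : Plane)
  set r := ‖(!₂[A, B] : Plane)‖
  have hA : A = r * Real.cos β := congrArg (fun v : Plane => v 0) hβ
  have hB : B = r * Real.sin β := congrArg (fun v : Plane => v 1) hβ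
  have hr : r ≠ 0 := by
    intro hr
    rw [hr, zero_mul] at hA hB
    -- A zero amplitude makes the left side vanish identically, and the solution `θ₀` then forces `C
    -- = 0` too, which is the excluded case.
    refine h ⟨hA, hB, ?_⟩
    have h₀' : A * Real.cos θ₀ + B * Real.sin θ₀ = C := h₀
    rw [hA, hB] at h₀'; linarith
  have hcos : ∀ θ, A * Real.cos θ + B * Real.sin θ = C →
      Real.cos (θ₀ - β) = Real.cos (θ - β) := by
    intro θ hθ
    have h₀' : A * Real.cos θ₀ + B * Real.sin θ₀ = C := h₀
    have : r * Real.cos (θ₀ - β) = r * Real.cos (θ - β) := by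
      rw [Real.cos_sub, Real.cos_sub]
      calc _ = A * Real.cos θ₀ + B * Real.sin θ₀ := by rw [hA, hB]; ring
        _ = A * Real.cos θ + B * Real.sin θ := by rw [h₀', hθ]
        _ = _ := by rw [hA, hB]; ring
    exact mul_left_cancel₀ hr this
  refine Countable.mono (s₂ := (range fun k : ℤ => 2 * k * Real.pi + (θ₀ - β) + β) ∪
    range fun k : ℤ => 2 * k * Real.pi - (θ₀ - β) + β) ?_
    ((countable_range _).union (countable_range _))
  intro θ hθ
  obtain ⟨k, hk | hk⟩ := Real.cos_eq_cos_iff.1 (hcos θ hθ)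
  · exact Or.inl ⟨k, by simp only; linarith⟩
  · exact Or.inr ⟨k, by simp only; linarith⟩

lemma countable_inner_dir_eq {v : Plane} {C : ℝ} (h : ¬ (v = 0 ∧ C = 0)) :
    {θ : ℝ | ⟪v, dir θ⟫ = C}.Countable := by
  simp only [inner_eq, dir_zero, dir_one]
  apply countable_trig_eq
  rintro ⟨h0, h1, hC⟩
  exact h ⟨plane_ext h0 h1, hC⟩

lemma countable_dir_eq (v : Plane) : {θ : ℝ | dir θ = v}.Countable := by
  refine (countable_trig_eq (A := 1) (B := 0) (C := v 0) (by simp)).mono fun θ hθ => ?_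
  have hθ' : dir θ = v := hθ
  simp [← hθ']

lemma countable_dir_mem {S : Set Plane} (hS : S.Countable) : {θ : ℝ | dir θ ∈ S}.Countable := by
  have : {θ : ℝ | dir θ ∈ S} = ⋃ v ∈ S, {θ | dir θ = v} := by ext; simp
  rw [this]
  exact hS.biUnion fun v _ => countable_dir_eq v

/-! ### The endpoint of a ray in a convex set given by finitely many constraints -/

/-- `M` is the parameter at which the ray `[0, ∞)` leaves the set of the points satisfying all the
constraints `g j ≤ 0`. -/
structure IsThreshold {ι : Type*} (g : ι → ℝ → ℝ) (M : ℝ) : Prop where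
  pos : 0 < M
  mem_iff : ∀ ρ, 0 ≤ ρ → ((∀ j, g j ρ ≤ 0) ↔ ρ ≤ M)
  active : ∃ j, g j M = 0

section Threshold

variable {ι : Type*}

/-- Beyond its zero `M`, the function lies above the chord from `0` to `M`, whose slope is at least
`δ / M`. This quantitative transversality gives the Lipschitz bound on the endpoint of a ray. -/
lemma convexOn_growth {g : ℝ → ℝ} (hg : ConvexOn ℝ univ g) {δ M ρ : ℝ} (h0 : g 0 ≤ -δ)
    (hM : 0 < M) (hgM : g M = 0) (hρ : M ≤ ρ) : δ * (ρ - M) ≤ g ρ * M := by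
  have hρ0 : 0 < ρ := hM.trans_le hρ
  have ha : 0 ≤ 1 - M / ρ := by rw [sub_nonneg, div_le_one hρ0]; exact hρ
  have hb : 0 ≤ M / ρ := by positivity
  have h := hg.2 (mem_univ 0) (mem_univ ρ) ha hb (by ring)
  have e : (1 - M / ρ) • (0 : ℝ) + (M / ρ) • ρ = M := by
    simp only [smul_eq_mul]; field_simp; ring
  rw [e, hgM, smul_eq_mul, smul_eq_mul] at h
  have h2 : 0 ≤ (ρ - M) * g 0 + M * g ρ := by
    have := mul_nonneg hρ0.le h
    calc (0 : ℝ) ≤ _ := this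
      _ = _ := by field_simp
  nlinarith

/-- By convexity the feasible parameters form an interval starting at `0`, bounded by `B`. At its
supremum some constraint vanishes, since otherwise continuity would extend the interval. -/
lemma exists_isThreshold [Finite ι] {g : ι → ℝ → ℝ} (hconv : ∀ j, ConvexOn ℝ univ (g j))
    (hcont : ∀ j, Continuous (g j)) (h0 : ∀ j, g j 0 < 0) {B : ℝ} (hB : 0 < B)
    (hBj : ∃ j, 0 < g j B) : ∃ M, IsThreshold g M ∧ M < B := by
  set S : Set ℝ := {ρ | 0 ≤ ρ ∧ ∀ j, g j ρ ≤ 0}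
  have hconvS : ∀ ρ ∈ S, ∀ r, 0 ≤ r → r ≤ ρ → ∀ j, g j r ≤ 0 := by
    rintro ρ ⟨hρ0, hρ⟩ r hr hrρ j
    have := (hconv j).le_max_of_mem_Icc (mem_univ 0) (mem_univ ρ) ⟨hr, hrρ⟩
    exact this.trans (max_le (h0 j).le (hρ j))
  have hlt : ∀ ρ ∈ S, ρ < B := by
    intro ρ hρ
    by_contra hcon
    obtain ⟨j, hj⟩ := hBj
    exact absurd (hconvS ρ hρ B hB.le (not_lt.1 hcon) j) (not_le.2 hj)
  have hS0 : (0 : ℝ) ∈ S := ⟨le_rfl, fun j => (h0 j).le⟩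
  have hbdd : BddAbove S := ⟨B, fun ρ hρ => (hlt ρ hρ).le⟩
  have hclosed : IsClosed S := by
    have : S = Ici 0 ∩ ⋂ j, {ρ | g j ρ ≤ 0} := by
      ext; simp [S]
    rw [this]
    exact isClosed_Ici.inter (isClosed_iInter fun j => isClosed_le (hcont j) continuous_const)
  have hMS : sSup S ∈ S := hclosed.csSup_mem ⟨0, hS0⟩ hbdd
  have hmem : ∀ ρ, 0 ≤ ρ → ((∀ j, g j ρ ≤ 0) ↔ ρ ≤ sSup S) := fun ρ hρ =>
    ⟨fun h => le_csSup hbdd ⟨hρ, h⟩, fun h => hconvS _ hMS ρ hρ h⟩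
  have hnear : ∀ ρ, 0 ≤ ρ → (∀ j, g j ρ < 0) → ρ < sSup S := by
    intro ρ hρ hlt'
    have : ∀ᶠ r in 𝓝 ρ, ∀ j, g j r < 0 :=
      eventually_all.2 fun j => (hcont j).continuousAt.eventually_lt_const (hlt' j)
    obtain ⟨r, hr, hrρ⟩ := ((this.filter_mono nhdsWithin_le_nhds).and
      (self_mem_nhdsWithin : Ioi ρ ∈ 𝓝[>] ρ)).exists
    exact (mem_Ioi.1 hrρ).trans_le
      (le_csSup hbdd ⟨hρ.trans (mem_Ioi.1 hrρ).le, fun j => (hr j).le⟩)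
  refine ⟨sSup S, ⟨hnear 0 le_rfl h0, hmem, ?_⟩, hlt _ hMS⟩
  by_contra hcon
  push Not at hcon
  exact lt_irrefl _ (hnear _ hMS.1 fun j => lt_of_le_of_ne (hMS.2 j) (hcon j))

lemma IsThreshold.le_zero {g : ι → ℝ → ℝ} {M : ℝ} (h : IsThreshold g M) (j : ι) : g j M ≤ 0 :=
  (h.mem_iff M h.pos.le).2 le_rfl j

/-- A constraint that is negative at `0` and vanishes at `ρ` is positive beyond `ρ`, so no feasible
parameter lies beyond `ρ`. -/
lemma IsThreshold.eq_of_eq_zero {g : ι → ℝ → ℝ} {M : ℝ} (h : IsThreshold g M)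
    (hconv : ∀ j, ConvexOn ℝ univ (g j)) (h0 : ∀ j, g j 0 < 0) {ρ : ℝ} (hρ : 0 < ρ)
    (hle : ∀ j, g j ρ ≤ 0) {k : ι} (hk : g k ρ = 0) : ρ = M := by
  refine le_antisymm ((h.mem_iff ρ hρ.le).1 hle) ?_
  by_contra hcon
  push Not at hcon
  have h1 := convexOn_growth (hconv k) (δ := -g k 0) (by simp) hρ hk hcon.le
  nlinarith [h0 k, h.le_zero k, mul_pos (neg_pos.2 (h0 k)) (sub_pos.2 hcon)]

/-- If `M' < M`, the constraint of `g'` active at `M'` has grown to at least `δ (M - M') / M'` at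
`M`, where the corresponding constraint of `g` is still nonpositive; the two differ by at most `ε`.
-/
lemma IsThreshold.sub_mul_le {g g' : ι → ℝ → ℝ} {M M' B δ ε : ℝ} (h : IsThreshold g M)
    (h' : IsThreshold g' M') (hconv : ∀ j, ConvexOn ℝ univ (g' j)) (h0 : ∀ j, g' j 0 ≤ -δ)
    (hδ : 0 ≤ δ) (hM' : M' ≤ B) (hM : M ≤ B) (hε : 0 ≤ ε)
    (hL : ∀ j ρ, 0 ≤ ρ → ρ ≤ B → |g' j ρ - g j ρ| ≤ ε) : δ * (M - M') ≤ B * ε := by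
  rcases le_total M M' with hle | hle
  · nlinarith [h.pos, mul_nonneg hδ (sub_nonneg.2 hle), mul_nonneg (h.pos.le.trans hM) hε]
  · obtain ⟨j, hj⟩ := h'.active
    have h1 := convexOn_growth (hconv j) (h0 j) h'.pos hj hle
    have h2 : g' j M ≤ ε := by
      have := (abs_le.1 (hL j M h.pos.le hM)).2
      linarith [h.le_zero j]
    calc δ * (M - M') ≤ g' j M * M' := h1
      _ ≤ ε * M' := mul_le_mul_of_nonneg_right h2 h'.pos.le
      _ ≤ B * ε := by rw [mul_comm]; exact mul_le_mul_of_nonneg_right hM' hε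

lemma IsThreshold.abs_sub_mul_le {g g' : ι → ℝ → ℝ} {M M' B δ ε : ℝ} (h : IsThreshold g M)
    (h' : IsThreshold g' M') (hconv : ∀ j, ConvexOn ℝ univ (g j))
    (hconv' : ∀ j, ConvexOn ℝ univ (g' j)) (h0 : ∀ j, g j 0 ≤ -δ) (h0' : ∀ j, g' j 0 ≤ -δ)
    (hδ : 0 ≤ δ) (hM : M ≤ B) (hM' : M' ≤ B) (hε : 0 ≤ ε)
    (hL : ∀ j ρ, 0 ≤ ρ → ρ ≤ B → |g j ρ - g' j ρ| ≤ ε) : δ * |M - M'| ≤ B * ε := by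
  rcases abs_cases (M - M') with ⟨e, _⟩ | ⟨e, _⟩
  · rw [e]
    exact h.sub_mul_le h' hconv' h0' hδ hM' hM hε
      fun j ρ h1 h2 => by rw [abs_sub_comm]; exact hL j ρ h1 h2
  · rw [e, neg_sub]
    exact h'.sub_mul_le h hconv h0 hδ hM hM' hε hL

/-- If a single constraint is active, the endpoint of the ray is differentiable. -/
lemma hasFDerivAt_threshold [Finite ι] {E : Type*} [NormedAddCommGroup E] [NormedSpace ℝ E]
    {ψ : ι → E → ℝ → ℝ} {M : E → ℝ} {q₀ : E} {j : ι} {ℓ : E →L[ℝ] ℝ} {a K : ℝ}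
    (hM : ∀ᶠ q in 𝓝 q₀, IsThreshold (fun k => ψ k q) (M q))
    (hlip : ∀ᶠ q in 𝓝 q₀, |M q - M q₀| ≤ K * ‖q - q₀‖)
    (hcont : ∀ k, ContinuousAt (fun z : E × ℝ => ψ k z.1 z.2) (q₀, M q₀))
    (hj : ∀ k, k ≠ j → ψ k q₀ (M q₀) < 0) (ha : a ≠ 0)
    (hd : HasFDerivAt (fun z : E × ℝ => ψ j z.1 z.2)
      (ℓ.comp (ContinuousLinearMap.fst ℝ E ℝ) + a • ContinuousLinearMap.snd ℝ E ℝ) (q₀, M q₀)) :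
    HasFDerivAt M (-a⁻¹ • ℓ) q₀ := by
  have hO : (fun q => M q - M q₀) =O[𝓝 q₀] fun q => q - q₀ :=
    Asymptotics.IsBigO.of_bound K (by simpa using hlip)
  have hMc : ContinuousAt M q₀ := by
    have h1 : Tendsto (fun q => q - q₀) (𝓝 q₀) (𝓝 0) := by
      have : ContinuousAt (fun q => q - q₀) q₀ := by fun_prop
      simpa [ContinuousAt] using this
    have := hO.trans_tendsto h1
    have h2 := this.add_const (M q₀)
    simpa [ContinuousAt] using h2
  have hz : Tendsto (fun q => (q, M q)) (𝓝 q₀) (𝓝 (q₀, M q₀)) :=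
    (continuousAt_id.prodMk hMc)
  -- The other constraints stay strictly negative near `q₀`, so the active one is always `j`, and
  -- `M` solves the single equation `ψ j q (M q) = 0`. With `M q - M q₀ = O(q - q₀)`,
  -- differentiability of `ψ j` at one point suffices, without the `C¹` hypothesis of the implicit
  -- function theorem.
  have hzero : ∀ᶠ q in 𝓝 q₀, ψ j q (M q) = 0 := by
    have h1 : ∀ᶠ q in 𝓝 q₀, ∀ k, k ≠ j → ψ k q (M q) < 0 := by
      refine eventually_all.2 fun k => ?_
      by_cases hk : k = j
      · simp [hk]
      · have := (hz.eventually ((hcont k).eventually_lt_const (hj k hk)))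
        exact this.mono fun q hq _ => hq
    filter_upwards [hM, h1] with q hq hq1
    obtain ⟨k, hk⟩ := hq.active
    by_cases hkj : k = j
    · exact hkj ▸ hk
    · exact absurd hk (hq1 k hkj).ne
  have hzO : (fun q => ((q, M q) : E × ℝ) - (q₀, M q₀)) =O[𝓝 q₀] fun q => q - q₀ :=
    (Asymptotics.isBigO_refl _ _).prod_left hO
  have ho := (hd.isLittleO.comp_tendsto hz).trans_isBigO hzO
  rw [hasFDerivAt_iff_isLittleO]
  refine ((ho.const_mul_left (-a⁻¹))).congr' ?_ EventuallyEq.rfl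
  have hz0 : ψ j q₀ (M q₀) = 0 := hzero.self_of_nhds
  filter_upwards [hzero] with q hq
  simp [hq, hz0]
  field_simp
  ring

end Threshold

/-! ### Cells as sublevel sets of convex functions -/

/-- The uncertainty disks of a configuration are pairwise disjoint. -/
def Separated (P : Network n) (q : Config n) : Prop :=
  ∀ i j, i ≠ j → P.ru i + P.ru j < ‖q i - q j‖

/-- The functions whose nonpositivity describes the guaranteed-sensing cell of agent `i`; the index
`i` itself stands for the constraint of the sensing disk. -/
def con (P : Network n) (i j : Fin n) (q : Config n) (p : Plane) : ℝ :=
  if j = i then ‖p - q i‖ - sensingRadius P i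
  else (‖p - q i‖ + (P.ru i + P.ru j)) ^ 2 - ‖p - q j‖ ^ 2

lemma con_self (P : Network n) (i : Fin n) (q : Config n) (p : Plane) :
    con P i i q p = ‖p - q i‖ - sensingRadius P i := if_pos rfl

lemma con_of_ne (P : Network n) {i j : Fin n} (h : j ≠ i) (q : Config n) (p : Plane) :
    con P i j q p = (‖p - q i‖ + (P.ru i + P.ru j)) ^ 2 - ‖p - q j‖ ^ 2 := if_neg h

/-- The extreme distances are attained at the points of the disks on the lines joining `p` to the
centres: the maximum is `‖p - q i‖ + P.ru i`, the minimum `‖p - q j‖ - P.ru j` when `p` is outside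
the other disk. -/
lemma mem_dominance_iff {P : Network n} (hru : ∀ i, 0 ≤ P.ru i) {q : Config n} {i j : Fin n}
    (hq : P.ru i + P.ru j < ‖q i - q j‖) (p : Plane) :
    p ∈ dominance P q i j ↔ p ∈ P.Ω ∧ ‖p - q i‖ + (P.ru i + P.ru j) ≤ ‖p - q j‖ := by
  refine and_congr_right fun _ => ⟨fun h => ?_, fun h x hx y hy => ?_⟩
  · obtain ⟨θ, hθ⟩ := exists_smul_dir (p - q i)
    have hxmem : q i - P.ru i • dir θ ∈ uncertaintyDisk P q i := by
      simp [uncertaintyDisk, norm_smul, abs_of_nonneg (hru i)]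
    have hxn : ‖p - (q i - P.ru i • dir θ)‖ = ‖p - q i‖ + P.ru i := by
      have : p - (q i - P.ru i • dir θ) = (‖p - q i‖ + P.ru i) • dir θ := by
        rw [add_smul, ← hθ]; abel
      rw [this, norm_smul, norm_dir, mul_one, Real.norm_of_nonneg]
      have := hru i; positivity
    rcases le_total (P.ru j) ‖p - q j‖ with hj | hj
    · obtain ⟨τ, hτ⟩ := exists_smul_dir (p - q j)
      have hymem : q j + P.ru j • dir τ ∈ uncertaintyDisk P q j := by
        simp [uncertaintyDisk, norm_smul, abs_of_nonneg (hru j)]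
      have hyn : ‖p - (q j + P.ru j • dir τ)‖ = ‖p - q j‖ - P.ru j := by
        have : p - (q j + P.ru j • dir τ) = (‖p - q j‖ - P.ru j) • dir τ := by
          rw [sub_smul, ← hτ]; abel
        rw [this, norm_smul, norm_dir, mul_one, Real.norm_of_nonneg (by linarith)]
      have := h _ hxmem _ hymem
      rw [hxn, hyn] at this
      linarith
    -- If `p` lies in the disk of `j`, the minimal distance is zero. This forces `p = q i`, which
    -- disjointness of the disks excludes.
    · have hy : p ∈ uncertaintyDisk P q j := by
        simpa [uncertaintyDisk, dist_eq_norm] using hj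
      have := h _ hxmem _ hy
      rw [hxn, sub_self, norm_zero] at this
      have h1 : ‖p - q i‖ = 0 := by linarith [norm_nonneg (p - q i), hru i]
      have h2 : p = q i := by rwa [norm_eq_zero, sub_eq_zero] at h1
      rw [h2] at hj
      linarith [hru i]
  · have h1 : ‖x - q i‖ ≤ P.ru i := by simpa [uncertaintyDisk, dist_eq_norm] using hx
    have h2 : ‖y - q j‖ ≤ P.ru j := by simpa [uncertaintyDisk, dist_eq_norm] using hy
    have h3 : ‖p - x‖ ≤ ‖p - q i‖ + ‖x - q i‖ := by
      have := norm_sub_le (p - q i) (x - q i); simpa using this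
    have h4 : ‖p - q j‖ ≤ ‖p - y‖ + ‖y - q j‖ := by
      have := norm_add_le (p - y) (y - q j); simpa using this
    linarith

lemma con_nonpos_iff {P : Network n} (hru : ∀ i, 0 ≤ P.ru i) {i j : Fin n} (h : j ≠ i)
    (q : Config n) (p : Plane) :
    con P i j q p ≤ 0 ↔ ‖p - q i‖ + (P.ru i + P.ru j) ≤ ‖p - q j‖ := by
  rw [con_of_ne P h, sub_nonpos]
  have := hru i
  have := hru j
  exact pow_le_pow_iff_left₀ (by positivity) (by positivity) two_ne_zero

lemma mem_gsvCell_iff {P : Network n} (hru : ∀ i, 0 ≤ P.ru i) {q : Config n}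
    (hq : Separated P q) (i : Fin n) (p : Plane) :
    p ∈ gsvCell P q i ↔ p ∈ P.Ω ∧ ∀ j, con P i j q p ≤ 0 := by
  constructor
  · rintro ⟨⟨hΩ, h⟩, -, hR⟩
    refine ⟨hΩ, fun j => ?_⟩
    by_cases hj : j = i
    · subst hj; rw [con_self]; linarith
    · rw [con_nonpos_iff hru hj]
      exact ((mem_dominance_iff hru (hq i j (Ne.symm hj)) p).1 (h j hj)).2
  · rintro ⟨hΩ, h⟩
    refine ⟨⟨hΩ, fun j hj => ?_⟩, hΩ, ?_⟩
    · rw [mem_dominance_iff hru (hq i j (Ne.symm hj)) p]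
      exact ⟨hΩ, (con_nonpos_iff hru hj q p).1 (h j)⟩
    · have := h i
      rw [con_self] at this; linarith

/-- The quadratic terms in `p` cancel: what remains is an affine function plus a nonnegative
multiple of a norm, hence convex. The unsquared difference of norms would not show this. -/
lemma con_eq_affine (P : Network n) {i j : Fin n} (h : j ≠ i) (q : Config n) (p : Plane) :
    con P i j q p = 2 * ⟪p - q i, q j - q i⟫ + 2 * (P.ru i + P.ru j) * ‖p - q i‖
      + (P.ru i + P.ru j) ^ 2 - ‖q j - q i‖ ^ 2 := by
  rw [con_of_ne P h]
  have : p - q j = (p - q i) - (q j - q i) := by abel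
  rw [this, norm_sub_sq_real]
  ring

lemma convexOn_con {P : Network n} (hru : ∀ i, 0 ≤ P.ru i) (i j : Fin n) (q : Config n) :
    ConvexOn ℝ univ (con P i j q) := by
  refine ⟨convex_univ, fun p _ p' _ a b ha hb hab => ?_⟩
  have e : a • p + b • p' - q i = a • (p - q i) + b • (p' - q i) := by
    have : q i = (a + b) • q i := by rw [hab, one_smul]
    nth_rewrite 1 [this]
    module
  have hn : ‖a • p + b • p' - q i‖ ≤ a * ‖p - q i‖ + b * ‖p' - q i‖ := by
    rw [e]
    refine (norm_add_le _ _).trans_eq ?_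
    rw [norm_smul, norm_smul, Real.norm_of_nonneg ha, Real.norm_of_nonneg hb]
  by_cases h : j = i
  · subst h
    simp only [con_self, smul_eq_mul]
    have hb' : b = 1 - a := by linarith
    subst hb'
    linarith
  · simp only [con_eq_affine P h, smul_eq_mul]
    have h1 : ⟪a • p + b • p' - q i, q j - q i⟫
        = a * ⟪p - q i, q j - q i⟫ + b * ⟪p' - q i, q j - q i⟫ := by
      rw [e, inner_add_left, real_inner_smul_left, real_inner_smul_left]
    have hs : 0 ≤ 2 * (P.ru i + P.ru j) := by have := hru i; have := hru j; positivity
    have h2 := mul_le_mul_of_nonneg_left hn hs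
    have hb' : b = 1 - a := by linarith
    rw [h1]
    subst hb'
    nlinarith

lemma convexOn_con_ray {P : Network n} (hru : ∀ i, 0 ≤ P.ru i) (i j : Fin n) (q : Config n)
    (c u : Plane) : ConvexOn ℝ univ (fun ρ : ℝ => con P i j q (c + ρ • u)) := by
  have h := (convexOn_con hru i j q).comp_affineMap (AffineMap.lineMap c (c + u))
  have e : (fun ρ : ℝ => con P i j q (c + ρ • u))
      = con P i j q ∘ (AffineMap.lineMap c (c + u) : ℝ →ᵃ[ℝ] Plane) := by
    ext ρ; simp [AffineMap.lineMap_apply, add_comm]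
  rw [e]; simpa using h

lemma continuous_con (P : Network n) (i j : Fin n) :
    Continuous (fun z : Config n × Plane => con P i j z.1 z.2) := by
  have h : ∀ k, Continuous (fun z : Config n × Plane => ‖z.2 - z.1 k‖) := fun k =>
    (continuous_snd.sub ((continuous_apply k).comp continuous_fst)).norm
  unfold con
  split_ifs
  · exact (h i).sub continuous_const
  · exact (((h i).add continuous_const).pow 2).sub ((h j).pow 2)

lemma continuous_con_right (P : Network n) (i j : Fin n) (q : Config n) :
    Continuous (con P i j q) :=
  Continuous.comp (g := fun z : Config n × Plane => con P i j z.1 z.2) (f := fun p => (q, p))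
    (continuous_con P i j) (Continuous.prodMk_right q)

lemma isOpen_separated (P : Network n) : IsOpen {q : Config n | Separated P q} := by
  have : {q : Config n | Separated P q}
      = ⋂ i, ⋂ j, {q | i ≠ j → P.ru i + P.ru j < ‖q i - q j‖} := by
    ext; simp [Separated]
  rw [this]
  refine isOpen_iInter_of_finite fun i => isOpen_iInter_of_finite fun j => ?_
  by_cases h : i = j
  · simp [h]
  · simp only [ne_eq, h, not_false_eq_true, forall_const]
    exact isOpen_lt continuous_const ((continuous_apply i).sub (continuous_apply j)).norm

lemma isClosed_gsvCell {P : Network n} (hru : ∀ i, 0 ≤ P.ru i) (hΩ : IsClosed P.Ω)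
    {q : Config n} (hq : Separated P q) (i : Fin n) : IsClosed (gsvCell P q i) := by
  have : gsvCell P q i = P.Ω ∩ ⋂ j, {p | con P i j q p ≤ 0} := by
    ext p; simp [mem_gsvCell_iff hru hq]
  rw [this]
  exact hΩ.inter (isClosed_iInter fun j => isClosed_le (continuous_con_right P i j q)
    continuous_const)

/-! ### The boundary arcs in polar coordinates about the agent -/

/-- In direction `θ`, the branch bounding the dominance region of `i` over `j` is at the distance
`(‖q j - q i‖² - s²) / (2 * headway)` from the agent `i`, if the headway is positive. -/
def headway (P : Network n) (q : Config n) (i j : Fin n) (θ : ℝ) : ℝ :=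
  P.ru i + P.ru j + ⟪q j - q i, dir θ⟫

/-- Distance to agent `i`, in direction `θ`, of the zero set of `con P i j q`. -/
def arcRadius (P : Network n) (q : Config n) (i j : Fin n) (θ : ℝ) : ℝ :=
  if j = i then sensingRadius P i
  else (‖q j - q i‖ ^ 2 - (P.ru i + P.ru j) ^ 2) / (2 * headway P q i j θ)

/-- The point of the zero set of `con P i j q` in direction `θ` from agent `i`. -/
def arcPoint (P : Network n) (q : Config n) (i j : Fin n) (θ : ℝ) : Plane :=
  q i + arcRadius P q i j θ • dir θ

lemma arcRadius_self (P : Network n) (q : Config n) (i : Fin n) (θ : ℝ) :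
    arcRadius P q i i θ = sensingRadius P i := if_pos rfl

lemma arcRadius_of_ne (P : Network n) (q : Config n) {i j : Fin n} (h : j ≠ i) (θ : ℝ) :
    arcRadius P q i j θ
      = (‖q j - q i‖ ^ 2 - (P.ru i + P.ru j) ^ 2) / (2 * headway P q i j θ) := if_neg h

lemma norm_ray (c : Plane) {ρ : ℝ} (hρ : 0 ≤ ρ) (θ : ℝ) : ‖c + ρ • dir θ - c‖ = ρ := by
  rw [add_sub_cancel_left, norm_smul, norm_dir, mul_one, Real.norm_of_nonneg hρ]

lemma con_ray_self (P : Network n) (q : Config n) (i : Fin n) {ρ : ℝ} (hρ : 0 ≤ ρ) (θ : ℝ) :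
    con P i i q (q i + ρ • dir θ) = ρ - sensingRadius P i := by
  rw [con_self, norm_ray _ hρ]

/-- Along rays from the agent itself the constraint is affine in `ρ`, which yields the polar
equation of the branch. -/
lemma con_ray (P : Network n) (q : Config n) {i j : Fin n} (h : j ≠ i) {ρ : ℝ} (hρ : 0 ≤ ρ)
    (θ : ℝ) : con P i j q (q i + ρ • dir θ)
      = 2 * ρ * headway P q i j θ - (‖q j - q i‖ ^ 2 - (P.ru i + P.ru j) ^ 2) := by
  rw [con_eq_affine P h, norm_ray _ hρ, add_sub_cancel_left, real_inner_smul_left, headway,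
    real_inner_comm]
  ring

lemma Separated.gap_pos {P : Network n} (hru : ∀ i, 0 ≤ P.ru i) {q : Config n}
    (hq : Separated P q) {i j : Fin n} (h : j ≠ i) :
    0 < ‖q j - q i‖ ^ 2 - (P.ru i + P.ru j) ^ 2 := by
  have h1 := hq i j (Ne.symm h)
  rw [norm_sub_rev] at h1
  have := hru i
  have := hru j
  nlinarith

lemma Separated.ne {P : Network n} (hru : ∀ i, 0 ≤ P.ru i) {q : Config n}
    (hq : Separated P q) {i j : Fin n} (h : j ≠ i) : q j - q i ≠ 0 := by
  have h1 := hq i j (Ne.symm h)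
  rw [norm_sub_rev] at h1
  rw [← norm_pos_iff]
  linarith [hru i, hru j]

lemma con_center_neg {P : Network n} (hru : ∀ i, 0 ≤ P.ru i) {q : Config n}
    (hq : Separated P q) {i : Fin n} (hR : 0 < sensingRadius P i) (j : Fin n) :
    con P i j q (q i) < 0 := by
  by_cases h : j = i
  · subst h; rw [con_self]; simpa using hR
  · have := con_ray P q h le_rfl 0
    rw [zero_smul, add_zero] at this
    rw [this]
    linarith [hq.gap_pos hru h]

lemma headway_pos_of_arcRadius_pos {P : Network n} (hru : ∀ i, 0 ≤ P.ru i) {q : Config n}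
    (hq : Separated P q) {i j : Fin n} (h : j ≠ i) {θ : ℝ} (hρ : 0 < arcRadius P q i j θ) :
    0 < headway P q i j θ := by
  rw [arcRadius_of_ne P q h] at hρ
  by_contra hcon
  have := div_nonpos_of_nonneg_of_nonpos (hq.gap_pos hru h).le
    (by linarith : 2 * headway P q i j θ ≤ 0)
  linarith

lemma two_mul_arcRadius_mul_headway {P : Network n} (hru : ∀ i, 0 ≤ P.ru i) {q : Config n}
    (hq : Separated P q) {i j : Fin n} (h : j ≠ i) {θ : ℝ} (hρ : 0 < arcRadius P q i j θ) :
    2 * arcRadius P q i j θ * headway P q i j θ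
      = ‖q j - q i‖ ^ 2 - (P.ru i + P.ru j) ^ 2 := by
  have := headway_pos_of_arcRadius_pos hru hq h hρ
  rw [arcRadius_of_ne P q h]
  field_simp

lemma con_arcPoint_self {P : Network n} (hru : ∀ i, 0 ≤ P.ru i) {q : Config n}
    (hq : Separated P q) {i j : Fin n} {θ : ℝ} (hρ : 0 < arcRadius P q i j θ) :
    con P i j q (arcPoint P q i j θ) = 0 := by
  unfold arcPoint
  by_cases h : j = i
  · subst h; rw [con_ray_self _ _ _ hρ.le, arcRadius_self, sub_self]
  · rw [con_ray P q h hρ.le, two_mul_arcRadius_mul_headway hru hq h hρ, sub_self]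

lemma eq_arcRadius_of_con_eq_zero {P : Network n} (hru : ∀ i, 0 ≤ P.ru i) {q : Config n}
    (hq : Separated P q) {i j : Fin n} {ρ θ : ℝ} (hρ : 0 < ρ)
    (h0 : con P i j q (q i + ρ • dir θ) = 0) : ρ = arcRadius P q i j θ := by
  by_cases h : j = i
  · subst h; rw [con_ray_self _ _ _ hρ.le] at h0; rw [arcRadius_self]; linarith
  · rw [con_ray P q h hρ.le] at h0
    have hg := hq.gap_pos hru h
    have hne : headway P q i j θ ≠ 0 := by
      intro h'; rw [h'] at h0; linarith
    rw [arcRadius_of_ne P q h, eq_div_iff (by simpa using hne)]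
    linarith

/-- Two of the arcs meet in countably many directions only. -/
lemma countable_tie {P : Network n} (hru : ∀ i, 0 ≤ P.ru i) {q : Config n}
    (hq : Separated P q) {i j k : Fin n} (hkj : k ≠ j) :
    {θ | 0 < arcRadius P q i j θ ∧ con P i k q (arcPoint P q i j θ) = 0}.Countable := by
  by_cases hj : j = i
  · subst hj
    by_cases hR : 0 < sensingRadius P j
    · refine (countable_inner_dir_eq (v := q k - q j)
        (C := (‖q k - q j‖ ^ 2 - (P.ru j + P.ru k) ^ 2) / (2 * sensingRadius P j)
          - (P.ru j + P.ru k)) fun h => hq.ne hru hkj h.1).mono ?_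
      rintro θ ⟨hρ, h0⟩
      unfold arcPoint at h0
      rw [con_ray P q hkj hρ.le, arcRadius_self, headway] at h0
      change ⟪q k - q j, dir θ⟫ = _
      field_simp
      linarith
    · convert countable_empty (α := ℝ)
      ext θ
      simp only [arcRadius_self, mem_ofPred_eq, mem_empty_iff_false, iff_false]
      exact fun h => hR h.1
  · by_cases hk : k = i
    · subst hk
      by_cases hR : 0 < sensingRadius P k
      · refine (countable_inner_dir_eq (v := q j - q k)
          (C := (‖q j - q k‖ ^ 2 - (P.ru k + P.ru j) ^ 2) / (2 * sensingRadius P k)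
            - (P.ru k + P.ru j)) fun h => hq.ne hru hj h.1).mono ?_
        rintro θ ⟨hρ, h0⟩
        have h1 := two_mul_arcRadius_mul_headway hru hq hj hρ
        unfold arcPoint at h0
        rw [con_ray_self _ _ _ hρ.le] at h0
        rw [sub_eq_zero.1 h0, headway] at h1
        change ⟪q j - q k, dir θ⟫ = _
        field_simp
        linarith
      · convert countable_empty (α := ℝ)
        ext θ
        simp only [mem_ofPred_eq, mem_empty_iff_false, iff_false]
        rintro ⟨hρ, h0⟩
        unfold arcPoint at h0
        rw [con_ray_self _ _ _ hρ.le] at h0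
        exact hR (by linarith)
    · set a := ‖q j - q i‖ ^ 2 - (P.ru i + P.ru j) ^ 2 with ha
      set b := ‖q k - q i‖ ^ 2 - (P.ru i + P.ru k) ^ 2 with hb
      have ha0 : 0 < a := hq.gap_pos hru hj
      have hb0 : 0 < b := hq.gap_pos hru hk
      refine (countable_inner_dir_eq (v := a • (q k - q i) - b • (q j - q i))
        (C := b * (P.ru i + P.ru j) - a * (P.ru i + P.ru k)) ?_).mono ?_
      -- If the equation were trivial, `a (q k - q i) = b (q j - q i)` and `a (P.ru i + P.ru k) = b
      -- (P.ru i + P.ru j)`. Taking the difference of squares gives `a² b = b² a`, hence `a = b`,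
      -- and then agents `j` and `k` would share a position.
      · rintro ⟨hv, hC⟩
        rw [sub_eq_zero] at hv hC
        have hn : a * ‖q k - q i‖ = b * ‖q j - q i‖ := by
          have := congrArg norm hv
          rwa [norm_smul, norm_smul, Real.norm_of_nonneg ha0.le, Real.norm_of_nonneg hb0.le]
            at this
        have h1 : a ^ 2 * b = b ^ 2 * a := by
          calc a ^ 2 * b = (a * ‖q k - q i‖) ^ 2 - (a * (P.ru i + P.ru k)) ^ 2 := by
                rw [hb]; ring
            _ = (b * ‖q j - q i‖) ^ 2 - (b * (P.ru i + P.ru j)) ^ 2 := by rw [hn, hC]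
            _ = b ^ 2 * a := by rw [ha]; ring
        have hab : a = b := by
          have : a * b * (a - b) = 0 := by linear_combination h1
          rcases mul_eq_zero.1 this with h | h
          · exact absurd h (mul_pos ha0 hb0).ne'
          · linarith
        rw [hab] at hv
        have h2 := smul_right_injective Plane hb0.ne' hv
        have h3 : q k = q j := sub_left_injective h2
        exact hq.ne hru hkj (sub_eq_zero.2 h3)
      · rintro θ ⟨hρ, h0⟩
        have h1 := two_mul_arcRadius_mul_headway hru hq hj hρ
        unfold arcPoint at h0
        rw [con_ray P q hk hρ.le] at h0
        rw [← ha] at h1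
        rw [← hb] at h0
        have h2 : 2 * arcRadius P q i j θ * headway P q i k θ = b := by linarith
        have h3 : a * headway P q i k θ = b * headway P q i j θ := by
          rw [← h1, ← h2]; ring
        unfold headway at h3
        change ⟪_, dir θ⟫ = _
        rw [inner_sub_left, real_inner_smul_left, real_inner_smul_left]
        linarith

/-! ### The hyperbolic arcs meet the boundary of the region in few points -/

/-- The determinant of two vectors of the plane. -/
def cross (v w : Plane) : ℝ := v 0 * w 1 - v 1 * w 0

lemma mem_interior_of_triangle {S : Set Plane} (hS : Convex ℝ S) {a b c : Plane} (ha : a ∈ S)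
    (hb : b ∈ S) (hc : c ∈ S) (hdet : cross (b - a) (c - a) ≠ 0) {x y : ℝ} (hx : 0 < x)
    (hy : 0 < y) (hxy : x + y < 1) : a + x • (b - a) + y • (c - a) ∈ interior S := by
  set X : Plane → ℝ := fun z => cross (z - a) (c - a) / cross (b - a) (c - a)
  set Y : Plane → ℝ := fun z => cross (b - a) (z - a) / cross (b - a) (c - a)
  have hXc : Continuous X := by simp only [X, cross]; fun_prop
  have hYc : Continuous Y := by simp only [Y, cross]; fun_prop
  have hz : ∀ z, z = (1 - X z - Y z) • a + X z • b + Y z • c := by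
    intro z
    apply plane_ext <;> simp only [X, Y, PiLp.add_apply, PiLp.smul_apply, smul_eq_mul] <;>
      field_simp <;> simp only [cross, PiLp.sub_apply] <;> ring
  rw [mem_interior]
  refine ⟨{z | 0 < X z} ∩ {z | 0 < Y z} ∩ {z | X z + Y z < 1}, ?_, ?_, ?_⟩
  · rintro z ⟨⟨h1, h2⟩, h3⟩
    simp only [mem_ofPred_eq] at h1 h2 h3
    have h4 : 0 < 1 - X z - Y z := by linarith
    rw [hz z]
    have hbc := hS.sum_mem (t := Finset.univ) (w := ![1 - X z - Y z, X z, Y z]) (z := ![a, b, c])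
      (by intro i _; fin_cases i <;> simp <;> linarith)
      (by simp only [Fin.sum_univ_three, Matrix.cons_val]; ring)
      (by intro i _; fin_cases i <;> simpa)
    simpa [Fin.sum_univ_three] using hbc
  · exact ((isOpen_lt continuous_const hXc).inter (isOpen_lt continuous_const hYc)).inter
      (isOpen_lt (hXc.add hYc) continuous_const)
  · have e1 : X (a + x • (b - a) + y • (c - a)) = x := by
      rw [div_eq_iff hdet]
      simp only [cross, PiLp.add_apply, PiLp.smul_apply, PiLp.sub_apply, smul_eq_mul]
      ring
    have e2 : Y (a + x • (b - a) + y • (c - a)) = y := by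
      rw [div_eq_iff hdet]
      simp only [cross, PiLp.add_apply, PiLp.smul_apply, PiLp.sub_apply, smul_eq_mul]
      ring
    simp only [mem_inter_iff, mem_ofPred_eq, e1, e2]
    exact ⟨⟨hx, hy⟩, hxy⟩

/-- Walking straight from `arcPoint P q i j θ₂` to `q j` never decreases `‖p - q i‖ - ‖p - q j‖`, by
the triangle inequality. So that side of the triangle with vertices `q i`, `arcPoint P q i j θ₂`, `q
j` does not re-enter the dominance region, and a ray pointing strictly between the axis and `θ₂`
meets the branch before it meets this side. The point is thus interior to a triangle contained in
`Ω`. The sign `ε` selects the side of the axis. -/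
lemma arcPoint_mem_interior {P : Network n} (hru : ∀ i, 0 ≤ P.ru i) {q : Config n}
    (hq : Separated P q) (hΩ : Convex ℝ P.Ω) {i j : Fin n} (hi : q i ∈ P.Ω) (hj : q j ∈ P.Ω)
    (hji : j ≠ i) {θ₁ θ₂ ε : ℝ} (hε : ε ^ 2 = 1) (h₁ : 0 < ε * cross (q j - q i) (dir θ₁))
    (h₂ : 0 < ε * cross (q j - q i) (dir θ₂)) (h₁₂ : 0 < ε * cross (dir θ₁) (dir θ₂))
    (hρ₁ : 0 < arcRadius P q i j θ₁) (hρ₂ : 0 < arcRadius P q i j θ₂)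
    (hp₂ : arcPoint P q i j θ₂ ∈ P.Ω) : arcPoint P q i j θ₁ ∈ interior P.Ω := by
  set D := q j - q i with hD
  set s := P.ru i + P.ru j with hs
  have hs0 : 0 ≤ s := add_nonneg (hru i) (hru j)
  have hsd : s < ‖D‖ := by
    have := hq i j (Ne.symm hji); rwa [norm_sub_rev] at this
  have hE := hq.gap_pos hru hji
  have e₁ := two_mul_arcRadius_mul_headway hru hq hji hρ₁
  have e₂ := two_mul_arcRadius_mul_headway hru hq hji hρ₂
  unfold arcPoint at hp₂ ⊢
  set ρ₁ := arcRadius P q i j θ₁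
  set ρ₂ := arcRadius P q i j θ₂
  unfold headway at e₁ e₂
  rw [← hD, ← hs] at e₁ e₂ hE
  set E := ‖D‖ ^ 2 - s ^ 2 with hEdef
  have hc2 : cross D (dir θ₂) ≠ 0 := fun h => by rw [h] at h₂; simp at h₂
  set lam := cross D (dir θ₁) / cross D (dir θ₂) with hlam
  set mu := cross (dir θ₁) (dir θ₂) / cross D (dir θ₂) with hmu
  have hε0 : ε ≠ 0 := by rintro rfl; simp at hε
  have hlam0 : 0 < lam := by
    have : lam = (ε * cross D (dir θ₁)) / (ε * cross D (dir θ₂)) := by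
      rw [hlam]; field_simp
    rw [this]; exact div_pos h₁ h₂
  have hmu0 : 0 < mu := by
    have : mu = (ε * cross (dir θ₁) (dir θ₂)) / (ε * cross D (dir θ₂)) := by
      rw [hmu]; field_simp
    rw [this]; exact div_pos h₁₂ h₂
  have hu : dir θ₁ = lam • dir θ₂ + mu • D := by
    have hc2' := hc2
    simp only [cross] at hc2'
    apply plane_ext <;> simp only [hlam, hmu, cross, PiLp.add_apply, PiLp.smul_apply,
      smul_eq_mul] <;> field_simp <;> ring
  have hlam1 : lam ≤ 1 + mu * ‖D‖ := by
    have h3 : lam • dir θ₂ = dir θ₁ - mu • D := by rw [hu]; abel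
    have h4 := congrArg norm h3
    rw [norm_smul, norm_dir, mul_one, Real.norm_of_nonneg hlam0.le] at h4
    have h5 := norm_sub_le (dir θ₁) (mu • D)
    rw [norm_dir, norm_smul, Real.norm_of_nonneg hmu0.le] at h5
    linarith
  have hin : ⟪D, dir θ₁⟫ = lam * ⟪D, dir θ₂⟫ + mu * ‖D‖ ^ 2 := by
    rw [hu, inner_add_right, real_inner_smul_right, real_inner_smul_right,
      real_inner_self_eq_norm_sq]
  -- The expression equals `mu (‖D‖ - s)² + 2 s (1 + mu ‖D‖ - lam)`: the first term is positive
  -- since the disks are disjoint, the second is nonnegative by the triangle inequality `hlam1`.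
  have hkey : 0 < 2 * (s + ⟪D, dir θ₁⟫) - lam * (2 * (s + ⟪D, dir θ₂⟫)) - mu * E := by
    have h6 : 2 * (s + ⟪D, dir θ₁⟫) - lam * (2 * (s + ⟪D, dir θ₂⟫)) - mu * E
        = mu * (‖D‖ - s) ^ 2 + 2 * s * (1 + mu * ‖D‖ - lam) := by
      rw [hin, hEdef]; ring
    rw [h6]
    have : 0 < mu * (‖D‖ - s) ^ 2 := mul_pos hmu0 (pow_pos (sub_pos.2 hsd) 2)
    have : 0 ≤ 2 * s * (1 + mu * ‖D‖ - lam) :=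
      mul_nonneg (by linarith) (by linarith)
    linarith
  have hxy : ρ₁ * lam / ρ₂ + ρ₁ * mu < 1 := by
    have h7 : 0 < (2 * (s + ⟪D, dir θ₁⟫) - lam * (2 * (s + ⟪D, dir θ₂⟫)) - mu * E)
        * (ρ₁ * ρ₂) := mul_pos hkey (mul_pos hρ₁ hρ₂)
    have h8 : (2 * (s + ⟪D, dir θ₁⟫) - lam * (2 * (s + ⟪D, dir θ₂⟫)) - mu * E) * (ρ₁ * ρ₂)
        = E * (ρ₂ - ρ₁ * lam - ρ₁ * ρ₂ * mu) := by
      linear_combination ρ₂ * e₁ - lam * ρ₁ * e₂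
    rw [h8] at h7
    have h9 : 0 < ρ₂ - ρ₁ * lam - ρ₁ * ρ₂ * mu := pos_of_mul_pos_right h7 hE.le
    rw [← sub_pos]
    have : 1 - (ρ₁ * lam / ρ₂ + ρ₁ * mu) = (ρ₂ - ρ₁ * lam - ρ₁ * ρ₂ * mu) / ρ₂ := by
      field_simp; ring
    rw [this]; positivity
  have hdet : cross (q i + ρ₂ • dir θ₂ - q i) (q j - q i) ≠ 0 := by
    have : cross (q i + ρ₂ • dir θ₂ - q i) (q j - q i) = -ρ₂ * cross D (dir θ₂) := by
      rw [add_sub_cancel_left, ← hD]; simp only [cross, PiLp.smul_apply, smul_eq_mul]; ring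
    rw [this]
    exact mul_ne_zero (neg_ne_zero.2 hρ₂.ne') hc2
  have := mem_interior_of_triangle hΩ hi hp₂ hj hdet (x := ρ₁ * lam / ρ₂) (y := ρ₁ * mu)
    (by positivity) (by positivity) hxy
  convert this using 1
  rw [add_sub_cancel_left, hu, ← hD, smul_smul, div_mul_cancel₀ _ hρ₂.ne']
  module

/-- Parallel unit vectors are equal or opposite, and opposite ones lie on different sides of `D`.
The proof shows that their inner product `t` is `1`. -/
lemma dir_eq_of_cross_eq_zero {D : Plane} {θ₁ θ₂ ε : ℝ} (h₁ : 0 < ε * cross D (dir θ₁))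
    (h₂ : 0 < ε * cross D (dir θ₂)) (h : cross (dir θ₁) (dir θ₂) = 0) : dir θ₁ = dir θ₂ := by
  have hc := Real.sin_sq_add_cos_sq θ₁
  have hc' := Real.sin_sq_add_cos_sq θ₂
  simp only [cross, dir_zero, dir_one] at h h₁ h₂
  set t := Real.cos θ₁ * Real.cos θ₂ + Real.sin θ₁ * Real.sin θ₂ with ht
  have e0 : Real.cos θ₁ = t * Real.cos θ₂ := by
    rw [ht]; linear_combination -(Real.cos θ₁) * hc' + Real.sin θ₂ * h
  have e1 : Real.sin θ₁ = t * Real.sin θ₂ := by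
    rw [ht]; linear_combination -(Real.sin θ₁) * hc' - Real.cos θ₂ * h
  have ht2 : t ^ 2 = 1 := by
    have : t ^ 2 * (Real.sin θ₂ ^ 2 + Real.cos θ₂ ^ 2) = Real.sin θ₁ ^ 2 + Real.cos θ₁ ^ 2 := by
      rw [e0, e1]; ring
    rwa [hc, hc', mul_one] at this
  have hpos : 0 < t := by
    have : ε * (D 0 * Real.sin θ₁ - D 1 * Real.cos θ₁)
        = t * (ε * (D 0 * Real.sin θ₂ - D 1 * Real.cos θ₂)) := by
      rw [e0, e1]; ring
    rw [this] at h₁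
    exact pos_of_mul_pos_left h₁ h₂.le
  have ht1 : t = 1 := by nlinarith
  rw [ht1, one_mul] at e0 e1
  exact plane_ext e0 e1

/-- Of two distinct arc points in `Ω` on the same side of the axis, the one nearer the axis is
interior to `Ω`. So each side has at most one boundary point, and the directions along the axis
itself are countable. -/
lemma countable_arcPoint_boundary {P : Network n} (hru : ∀ i, 0 ≤ P.ru i) {q : Config n}
    (hq : Separated P q) (hΩ : Convex ℝ P.Ω) {i j : Fin n} (hi : q i ∈ P.Ω) (hj : q j ∈ P.Ω)
    (hji : j ≠ i) :
    {θ | 0 < arcRadius P q i j θ ∧ arcPoint P q i j θ ∈ P.Ω ∧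
      arcPoint P q i j θ ∉ interior P.Ω}.Countable := by
  set A := {θ | 0 < arcRadius P q i j θ ∧ arcPoint P q i j θ ∈ P.Ω ∧
      arcPoint P q i j θ ∉ interior P.Ω} with hA
  have hside : ∀ ε : ℝ, ε ^ 2 = 1 →
      (A ∩ {θ | 0 < ε * cross (q j - q i) (dir θ)}).Countable := by
    intro ε hε
    have hsub : (dir '' (A ∩ {θ | 0 < ε * cross (q j - q i) (dir θ)})).Subsingleton := by
      rintro _ ⟨θ₁, ⟨hA₁, h₁⟩, rfl⟩ _ ⟨θ₂, ⟨hA₂, h₂⟩, rfl⟩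
      rcases lt_trichotomy (ε * cross (dir θ₁) (dir θ₂)) 0 with hlt | heq | hgt
      · have hlt' : 0 < ε * cross (dir θ₂) (dir θ₁) := by
          have : cross (dir θ₂) (dir θ₁) = - cross (dir θ₁) (dir θ₂) := by
            simp only [cross]; ring
          rw [this]; linarith
        exact absurd (arcPoint_mem_interior hru hq hΩ hi hj hji hε h₂ h₁ hlt' hA₂.1 hA₁.1 hA₁.2.1)
          hA₂.2.2
      · have hε0 : ε ≠ 0 := by rintro rfl; simp at hε
        exact dir_eq_of_cross_eq_zero h₁ h₂ ((mul_eq_zero.1 heq).resolve_left hε0)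
      · exact absurd (arcPoint_mem_interior hru hq hΩ hi hj hji hε h₁ h₂ hgt hA₁.1 hA₂.1 hA₂.2.1)
          hA₁.2.2
    exact (countable_dir_mem hsub.countable).mono fun θ hθ => mem_image_of_mem dir hθ
  have hzero : {θ | cross (q j - q i) (dir θ) = 0}.Countable := by
    have hne := hq.ne hru hji
    refine (countable_trig_eq (A := -(q j - q i) 1) (B := (q j - q i) 0) (C := 0) ?_).mono ?_
    · rintro ⟨h1, h0, -⟩
      exact hne (plane_ext h0 (neg_eq_zero.1 h1))
    · intro θ hθ
      simp only [cross, dir_zero, dir_one, mem_ofPred_eq] at hθ ⊢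
      linarith
  refine (((hside 1 (by norm_num)).union (hside (-1) (by norm_num))).union hzero).mono ?_
  intro θ hθ
  rcases lt_trichotomy (cross (q j - q i) (dir θ)) 0 with h | h | h
  · exact Or.inl (Or.inr ⟨hθ, by simpa using h⟩)
  · exact Or.inr h
  · exact Or.inl (Or.inl ⟨hθ, by simpa using h⟩)

/-! ### The derivative of the constraints along rays -/

lemma hasFDerivAt_norm_plane {v : Plane} (hv : v ≠ 0) :
    HasFDerivAt (fun w : Plane => ‖w‖) (innerSL ℝ (‖v‖⁻¹ • v)) v := by
  have h1 : HasFDerivAt (fun w : Plane => ‖w‖ ^ 2) (2 • innerSL ℝ v) v := by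
    simpa using (hasFDerivAt_id v).norm_sq
  have hn : ‖v‖ ≠ 0 := norm_ne_zero_iff.2 hv
  have h2 := h1.sqrt (by positivity)
  have e : (fun w : Plane => √(‖w‖ ^ 2)) = fun w => ‖w‖ := by
    ext w; exact Real.sqrt_sq (norm_nonneg w)
  rw [e] at h2
  refine h2.congr_fderiv (ContinuousLinearMap.ext fun w => ?_)
  rw [Real.sqrt_sq (norm_nonneg v)]
  simp
  field_simp

/-- The derivative of a configuration's `i`-th position paired with the vector `v`. -/
def pair (i : Fin n) (v : Plane) : Config n →L[ℝ] ℝ :=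
  (innerSL ℝ v).comp (ContinuousLinearMap.proj i)

@[simp] lemma pair_apply (i : Fin n) (v : Plane) (h : Config n) : pair i v h = ⟪v, h i⟫ := rfl

lemma hasFDerivAt_rayVec (c u : Plane) (k : Fin n) (z : Config n × ℝ) :
    HasFDerivAt (fun z : Config n × ℝ => c + z.2 • u - z.1 k)
      ((ContinuousLinearMap.snd ℝ (Config n) ℝ).smulRight u
        - (ContinuousLinearMap.proj k).comp (ContinuousLinearMap.fst ℝ (Config n) ℝ)) z := by
  have h1 : HasFDerivAt (fun z : Config n × ℝ => z.2 • u)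
      ((ContinuousLinearMap.snd ℝ (Config n) ℝ).smulRight u) z :=
    ((ContinuousLinearMap.snd ℝ (Config n) ℝ).smulRight u).hasFDerivAt
  have h2 : HasFDerivAt (fun z : Config n × ℝ => z.1 k)
      ((ContinuousLinearMap.proj k).comp (ContinuousLinearMap.fst ℝ (Config n) ℝ)) z :=
    ((ContinuousLinearMap.proj (R := ℝ) (φ := fun _ : Fin n => Plane) k).comp
      (ContinuousLinearMap.fst ℝ (Config n) ℝ)).hasFDerivAt
  exact (h1.const_add c).sub h2

lemma hasFDerivAt_con_ray_self (P : Network n) (q : Config n) (i : Fin n) (θ : ℝ) {ρ : ℝ}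
    (hρ : 0 < ρ) :
    HasFDerivAt (fun z : Config n × ℝ => con P i i z.1 (q i + z.2 • dir θ))
      ((-pair i (dir θ)).comp (ContinuousLinearMap.fst ℝ (Config n) ℝ)
        + (1 : ℝ) • ContinuousLinearMap.snd ℝ (Config n) ℝ) (q, ρ) := by
  have hv : q i + ρ • dir θ - q i = ρ • dir θ := add_sub_cancel_left _ _
  have hn : ‖ρ • dir θ‖ = ρ := by rw [norm_smul, norm_dir, mul_one, Real.norm_of_nonneg hρ.le]
  have hne : q i + ρ • dir θ - q i ≠ 0 := by
    rw [hv, ← norm_ne_zero_iff, hn]; exact hρ.ne'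
  have h1 := HasFDerivAt.comp (q, ρ) (f := fun z : Config n × ℝ => q i + z.2 • dir θ - z.1 i)
    (hasFDerivAt_norm_plane hne) (hasFDerivAt_rayVec (q i) (dir θ) i (q, ρ))
  have h2 := h1.sub_const (sensingRadius P i)
  refine HasFDerivAt.congr_fderiv (f := fun z : Config n × ℝ => con P i i z.1 (q i + z.2 • dir θ))
    (by simp only [con_self]; exact h2) (ContinuousLinearMap.ext fun z => ?_)
  simp only [hv, hn, inv_smul_smul₀ hρ.ne']
  simp
  ring

/-- The centre of the ray is frozen at `q i`; only the agents in `z.1` move. The coefficient of `ρ`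
is twice the headway, which is positive on the arc, so the endpoint of the ray can be obtained by
implicit differentiation. -/
lemma hasFDerivAt_con_ray (P : Network n) (q : Config n) {i j : Fin n} (h : j ≠ i) (θ : ℝ) {ρ : ℝ}
    (hρ : 0 < ρ) :
    HasFDerivAt (fun z : Config n × ℝ => con P i j z.1 (q i + z.2 • dir θ))
      ((-(2 * (ρ + (P.ru i + P.ru j))) • pair i (dir θ)
          - (2 : ℝ) • pair j (q j - (q i + ρ • dir θ))).comp (ContinuousLinearMap.fst ℝ (Config n) ℝ)
        + (2 * headway P q i j θ) • ContinuousLinearMap.snd ℝ (Config n) ℝ) (q, ρ) := by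
  have hv : q i + ρ • dir θ - q i = ρ • dir θ := add_sub_cancel_left _ _
  have hn : ‖ρ • dir θ‖ = ρ := by rw [norm_smul, norm_dir, mul_one, Real.norm_of_nonneg hρ.le]
  have hne : q i + ρ • dir θ - q i ≠ 0 := by
    rw [hv, ← norm_ne_zero_iff, hn]; exact hρ.ne'
  have h1 := HasFDerivAt.comp (q, ρ) (f := fun z : Config n × ℝ => q i + z.2 • dir θ - z.1 i)
    (hasFDerivAt_norm_plane hne) (hasFDerivAt_rayVec (q i) (dir θ) i (q, ρ))
  have h2 := (h1.add_const (P.ru i + P.ru j)).pow 2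
  have h3 := (hasFDerivAt_rayVec (q i) (dir θ) j (q, ρ)).norm_sq
  refine HasFDerivAt.congr_fderiv (f := fun z : Config n × ℝ => con P i j z.1 (q i + z.2 • dir θ))
    (by simp only [con_of_ne P h]; exact h2.sub h3) (ContinuousLinearMap.ext fun z => ?_)
  have e : q i + ρ • dir θ - q j = ρ • dir θ - (q j - q i) := by abel
  have e' : q j - (q i + ρ • dir θ) = (q j - q i) - ρ • dir θ := by abel
  simp only [Function.comp_apply, hv, hn, inv_smul_smul₀ hρ.ne', e, e', headway]
  simp [inner_sub_left, real_inner_smul_left]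
  ring

/-! ### The weights of the boundary arcs -/

open Classical in
/-- Density, with respect to the direction `θ` from agent `i`, of the rate at which the mass of the
cell grows when the arc `j` of its boundary is pushed outward. -/
def arcDensity (P : Network n) (q : Config n) (i j : Fin n) (θ : ℝ) : ℝ :=
  if 0 < arcRadius P q i j θ ∧ arcPoint P q i j θ ∈ gsvCell P q i then
    arcRadius P q i j θ * P.φ (arcPoint P q i j θ) else 0

/-- Contribution of the arc `j` of the cell of `i` to the derivative in the position of `i`. -/
def nearWeight (P : Network n) (q : Config n) (i j : Fin n) (θ : ℝ) : Plane :=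
  (arcDensity P q i j θ * if j = i then 1 else
    (arcRadius P q i j θ + (P.ru i + P.ru j)) / headway P q i j θ) • dir θ

/-- Contribution of the arc `j` of the cell of `i` to the derivative in the position of `j`. -/
def farWeight (P : Network n) (q : Config n) (i j : Fin n) (θ : ℝ) : Plane :=
  (if j = i then 0 else arcDensity P q i j θ / headway P q i j θ) • (q j - arcPoint P q i j θ)

/-- Derivative of the mass of the cell of `i` on the ray in direction `θ`. -/
def rayDeriv (P : Network n) (q : Config n) (i : Fin n) (θ : ℝ) : Config n →L[ℝ] ℝ :=
  ∑ j, (pair i (nearWeight P q i j θ) + pair j (farWeight P q i j θ))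

/-- In the direction `θ` from agent `i` no two arcs meet, and no arc meets the boundary of the
region at a point of the cell. -/
def Generic (P : Network n) (q : Config n) (i : Fin n) (θ : ℝ) : Prop :=
  ∀ j, 0 < arcRadius P q i j θ → (∀ k, k ≠ j → con P i k q (arcPoint P q i j θ) ≠ 0) ∧
    (arcPoint P q i j θ ∈ gsvCell P q i → arcPoint P q i j θ ∈ interior P.Ω)

lemma gsvCell_subset (P : Network n) (q : Config n) (i : Fin n) : gsvCell P q i ⊆ P.Ω :=
  fun _ h => h.1.1

lemma Admissible.separated {P : Network n} {q : Config n} (h : Admissible P q) : Separated P q :=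
  h.disks_disjoint

lemma arcRadius_le_of_mem {P : Network n} {q : Config n} {i j : Fin n} {θ : ℝ}
    (hρ : 0 < arcRadius P q i j θ) (h : arcPoint P q i j θ ∈ gsvCell P q i) :
    arcRadius P q i j θ ≤ sensingRadius P i := by
  have := h.2.2
  rwa [arcPoint, norm_ray _ hρ.le] at this

lemma circleCurve_eq (P : Network n) (q : Config n) (i : Fin n) (θ : ℝ) :
    circleCurve (q i) (sensingRadius P i) θ = arcPoint P q i i θ := by
  rw [arcPoint, arcRadius_self]; rfl

/-- Only countably many directions are not generic for a hyperbolic arc. -/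
lemma countable_not_generic_arc {P : Network n} (hru : ∀ i, 0 ≤ P.ru i) (hΩ : Convex ℝ P.Ω)
    {q : Config n} (hq : Admissible P q) {i j : Fin n} (hji : j ≠ i) :
    {θ | ¬ (0 < arcRadius P q i j θ → (∀ k, k ≠ j → con P i k q (arcPoint P q i j θ) ≠ 0) ∧
      (arcPoint P q i j θ ∈ gsvCell P q i →
        arcPoint P q i j θ ∈ interior P.Ω))}.Countable := by
  refine ((countable_iUnion fun k => countable_iUnion fun hk : k ≠ j =>
    countable_tie hru hq.separated (i := i) hk).union (countable_arcPoint_boundary hru hq.separated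
      hΩ (hq.mem_region i) (hq.mem_region j) hji)).mono ?_
  intro θ hθ
  simp only [mem_ofPred_eq] at hθ
  push Not at hθ
  obtain ⟨hρ, h⟩ := hθ
  by_cases h' : ∀ k, k ≠ j → con P i k q (arcPoint P q i j θ) ≠ 0
  · obtain ⟨h1, h2⟩ := h h'
    exact Or.inr ⟨hρ, gsvCell_subset P q i h1, h2⟩
  · push Not at h'
    obtain ⟨k, hk, h0⟩ := h'
    exact Or.inl (mem_iUnion.2 ⟨k, mem_iUnion.2 ⟨hk, hρ, h0⟩⟩)

/-- For hyperbolic arcs the exceptional directions are countable. For the circle the ties are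
countable, while contact with the boundary of `Ω` is null by the last clause of admissibility. -/
lemma ae_generic {P : Network n} (hru : ∀ i, 0 ≤ P.ru i) (hΩ : Convex ℝ P.Ω)
    {q : Config n} (hq : Admissible P q) (i : Fin n) :
    ∀ᵐ θ ∂(volume.restrict (Ioc (-Real.pi) Real.pi)), Generic P q i θ := by
  unfold Generic
  rw [ae_all_iff]
  intro j
  by_cases hji : j = i
  · subst hji
    by_cases hR : 0 < sensingRadius P j
    · have h1 : ∀ k, k ≠ j → ∀ᵐ θ ∂(volume : Measure ℝ),
          0 < arcRadius P q j j θ → con P j k q (arcPoint P q j j θ) ≠ 0 := by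
        intro k hk
        have := (countable_tie hru hq.separated (i := j) hk).measure_zero volume
        rw [← compl_mem_ae_iff] at this
        filter_upwards [this] with θ hθ hρ h0 using hθ ⟨hρ, h0⟩
      have h2 : ∀ᵐ θ ∂(volume.restrict (Ioc (-Real.pi) Real.pi)),
          arcPoint P q j j θ ∈ gsvCell P q j → arcPoint P q j j θ ∈ interior P.Ω := by
        have := hq.no_common_arc j hR
        rw [ae_restrict_iff' measurableSet_Ioc]
        rw [← compl_mem_ae_iff] at this
        filter_upwards [this] with θ hθ hI hmem
        by_contra hint
        refine hθ ⟨hI, ?_⟩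
        rw [circleCurve_eq]
        exact ⟨⟨subset_closure (gsvCell_subset P q j hmem), hint⟩, hmem⟩
      have h3 := ae_restrict_of_ae (s := Ioc (-Real.pi) Real.pi)
        (ae_all_iff.2 fun k => (ae_all_iff (p := fun θ hk => _)).2 (h1 k))
      filter_upwards [h2, h3] with θ hθ2 hθ3 hρ
      exact ⟨fun k hk => hθ3 k hk hρ, hθ2⟩
    · filter_upwards with θ hρ
      rw [arcRadius_self] at hρ
      exact absurd hρ hR
  · have := (countable_not_generic_arc hru hΩ hq hji).measure_zero volume
    rw [← compl_mem_ae_iff] at this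
    refine ae_restrict_of_ae ?_
    filter_upwards [this] with θ hθ
    simpa using hθ

/-! ### Measurability and bounds -/

lemma measurable_indicator_density {P : Network n} (hΩ : IsCompact P.Ω)
    (hφ : ContinuousOn P.φ P.Ω) : Measurable (P.Ω.indicator P.φ) := by
  classical
  rw [← piecewise_eq_indicator]
  exact hφ.measurable_piecewise continuousOn_const hΩ.measurableSet

lemma exists_density_bound {P : Network n} (hΩ : IsCompact P.Ω) (hφ : ContinuousOn P.φ P.Ω) :
    ∃ C, 0 ≤ C ∧ ∀ p ∈ P.Ω, |P.φ p| ≤ C := by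
  obtain ⟨C, hC⟩ := hΩ.exists_bound_of_continuousOn hφ
  exact ⟨max C 0, le_max_right _ _, fun p hp => (hC p hp).trans (le_max_left _ _)⟩

lemma abs_indicator_density_le {P : Network n} {C : ℝ} (hC0 : 0 ≤ C)
    (hC : ∀ p ∈ P.Ω, |P.φ p| ≤ C) (p : Plane) : |P.Ω.indicator P.φ p| ≤ C := by
  by_cases hp : p ∈ P.Ω
  · rw [indicator_of_mem hp]; exact hC p hp
  · rw [indicator_of_notMem hp]; simpa using hC0

lemma continuous_headway (P : Network n) (q : Config n) (i j : Fin n) :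
    Continuous (headway P q i j) := by
  unfold headway
  exact continuous_const.add (continuous_const.inner continuous_dir)

lemma measurable_arcRadius (P : Network n) (q : Config n) (i j : Fin n) :
    Measurable (arcRadius P q i j) := by
  unfold arcRadius
  split_ifs
  · exact measurable_const
  · exact measurable_const.div ((continuous_headway P q i j).measurable.const_mul 2)

lemma measurable_arcPoint (P : Network n) (q : Config n) (i j : Fin n) :
    Measurable (arcPoint P q i j) :=
  ((measurable_arcRadius P q i j).smul continuous_dir.measurable).const_add (q i)

lemma measurableSet_active {P : Network n} (hru : ∀ i, 0 ≤ P.ru i) (hΩ : IsCompact P.Ω)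
    {q : Config n} (hq : Separated P q) (i j : Fin n) :
    MeasurableSet {θ | 0 < arcRadius P q i j θ ∧ arcPoint P q i j θ ∈ gsvCell P q i} :=
  (measurableSet_lt measurable_const (measurable_arcRadius P q i j)).inter
    (measurable_arcPoint P q i j (isClosed_gsvCell hru hΩ.isClosed hq i).measurableSet)

/-- The density `P.φ` is controlled on `Ω` only. Replacing it by its indicator, which changes
nothing on the cell, makes measurability available. -/
lemma arcDensity_eq_ite (P : Network n) (q : Config n) (i j : Fin n) (θ : ℝ)
    [Decidable (0 < arcRadius P q i j θ ∧ arcPoint P q i j θ ∈ gsvCell P q i)] :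
    arcDensity P q i j θ =
      if 0 < arcRadius P q i j θ ∧ arcPoint P q i j θ ∈ gsvCell P q i then
        arcRadius P q i j θ * P.Ω.indicator P.φ (arcPoint P q i j θ) else 0 := by
  unfold arcDensity
  split_ifs with h
  · rw [indicator_of_mem (gsvCell_subset P q i h.2)]
  · rfl

lemma measurable_arcDensity {P : Network n} (hru : ∀ i, 0 ≤ P.ru i) (hΩ : IsCompact P.Ω)
    (hφ : ContinuousOn P.φ P.Ω) {q : Config n} (hq : Separated P q) (i j : Fin n) :
    Measurable (arcDensity P q i j) := by
  classical
  have : arcDensity P q i j = fun θ =>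
      if 0 < arcRadius P q i j θ ∧ arcPoint P q i j θ ∈ gsvCell P q i then
        arcRadius P q i j θ * P.Ω.indicator P.φ (arcPoint P q i j θ) else 0 :=
    funext fun θ => arcDensity_eq_ite P q i j θ
  rw [this]
  exact Measurable.ite (measurableSet_active hru hΩ hq i j) ((measurable_arcRadius P q i j).mul
    ((measurable_indicator_density hΩ hφ).comp (measurable_arcPoint P q i j))) measurable_const

lemma measurable_nearWeight {P : Network n} (hru : ∀ i, 0 ≤ P.ru i) (hΩ : IsCompact P.Ω)
    (hφ : ContinuousOn P.φ P.Ω) {q : Config n} (hq : Separated P q) (i j : Fin n) :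
    Measurable (nearWeight P q i j) := by
  unfold nearWeight
  refine ((measurable_arcDensity hru hΩ hφ hq i j).mul ?_).smul continuous_dir.measurable
  split_ifs
  · exact measurable_const
  · exact ((measurable_arcRadius P q i j).add_const _).div (continuous_headway P q i j).measurable

lemma measurable_farWeight {P : Network n} (hru : ∀ i, 0 ≤ P.ru i) (hΩ : IsCompact P.Ω)
    (hφ : ContinuousOn P.φ P.Ω) {q : Config n} (hq : Separated P q) (i j : Fin n) :
    Measurable (farWeight P q i j) := by
  have h : Measurable (fun θ =>
      if j = i then (0 : ℝ) else arcDensity P q i j θ / headway P q i j θ) := by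
    split_ifs
    · exact measurable_const
    · exact (measurable_arcDensity hru hΩ hφ hq i j).div (continuous_headway P q i j).measurable
  exact h.smul ((measurable_arcPoint P q i j).const_sub (q j))

lemma continuous_pair (i : Fin n) : Continuous (fun v : Plane => pair i v) :=
  (innerSL ℝ).continuous.clm_comp continuous_const

lemma measurable_rayDeriv {P : Network n} (hru : ∀ i, 0 ≤ P.ru i) (hΩ : IsCompact P.Ω)
    (hφ : ContinuousOn P.φ P.Ω) {q : Config n} (hq : Separated P q) (i : Fin n) :
    StronglyMeasurable (rayDeriv P q i) := by
  unfold rayDeriv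
  refine Finset.stronglyMeasurable_fun_sum _ fun j _ => ?_
  exact ((continuous_pair i).comp_stronglyMeasurable
    (measurable_nearWeight hru hΩ hφ hq i j).stronglyMeasurable).add
    ((continuous_pair j).comp_stronglyMeasurable
    (measurable_farWeight hru hΩ hφ hq i j).stronglyMeasurable)

lemma weights_eq_zero_of_arcDensity {P : Network n} {q : Config n} {i j : Fin n} {θ : ℝ}
    (h : arcDensity P q i j θ = 0) : nearWeight P q i j θ = 0 ∧ farWeight P q i j θ = 0 := by
  simp [nearWeight, farWeight, h]

lemma arcDensity_eq_zero_of_radius {P : Network n} {i : Fin n} (hR : sensingRadius P i ≤ 0)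
    (q : Config n) (j : Fin n) (θ : ℝ) : arcDensity P q i j θ = 0 := by
  unfold arcDensity
  rw [if_neg]
  rintro ⟨hρ, h⟩
  linarith [arcRadius_le_of_mem hρ h]

/-! ### The mass of a cell on a ray -/

/-- The fixed region `Ω` stays in the integrand as an indicator and is not one of the constraints,
so the configuration enters through the limit `M` alone. -/
lemma rayMass_eq {P : Network n} (hru : ∀ i, 0 ≤ P.ru i) {q : Config n} (hq : Separated P q)
    (i : Fin n) (c : Plane) (θ : ℝ) {M : ℝ}
    (hM : IsThreshold (fun j ρ => con P i j q (c + ρ • dir θ)) M) :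
    ∫ ρ in Ioi (0 : ℝ), ρ * (gsvCell P q i).indicator P.φ (c + ρ • dir θ)
      = ∫ ρ in (0 : ℝ)..M, ρ * P.Ω.indicator P.φ (c + ρ • dir θ) := by
  rw [intervalIntegral.integral_of_le hM.pos.le, ← Ioi_inter_Iic, ← setIntegral_indicator
    measurableSet_Iic]
  refine setIntegral_congr_fun measurableSet_Ioi fun ρ hρ => ?_
  have hiff := hM.mem_iff ρ (mem_Ioi.1 hρ).le
  have hcell := mem_gsvCell_iff hru hq i (c + ρ • dir θ)
  by_cases h : ρ ≤ M
  · simp only [indicator, mem_Iic, h, if_true]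
    by_cases hΩ : c + ρ • dir θ ∈ P.Ω
    · rw [if_pos hΩ, if_pos (hcell.2 ⟨hΩ, hiff.2 h⟩)]
    · rw [if_neg hΩ, if_neg fun h' => hΩ (hcell.1 h').1]
  · simp only [indicator, mem_Iic, h, if_false]
    rw [if_neg fun h' => h (hiff.1 (hcell.1 h').2), mul_zero]

lemma continuousAt_indicator_of_notMem_frontier {f : Plane → ℝ} {s : Set Plane} (hs : IsClosed s)
    (hf : ContinuousOn f s) {p : Plane} (hp : p ∈ s → p ∈ interior s) :
    ContinuousAt (s.indicator f) p := by
  by_cases h : p ∈ s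
  · have hn : s ∈ 𝓝 p := mem_interior_iff_mem_nhds.1 (hp h)
    refine (hf.continuousAt hn).congr ?_
    filter_upwards [hn] with x hx using (indicator_of_mem hx f).symm
  · have hn : sᶜ ∈ 𝓝 p := hs.isOpen_compl.mem_nhds h
    refine (continuousAt_const (y := (0 : ℝ))).congr ?_
    filter_upwards [hn] with x hx using (indicator_of_notMem hx f).symm

lemma intervalIntegrable_ray {P : Network n} (hΩ : IsCompact P.Ω) (hφ : ContinuousOn P.φ P.Ω)
    (c : Plane) (θ a b : ℝ) :
    IntervalIntegrable (fun ρ : ℝ => ρ * P.Ω.indicator P.φ (c + ρ • dir θ)) volume a b := by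
  obtain ⟨C, hC0, hC⟩ := exists_density_bound hΩ hφ
  have hm : Measurable (fun ρ : ℝ => P.Ω.indicator P.φ (c + ρ • dir θ)) :=
    (measurable_indicator_density hΩ hφ).comp (by fun_prop)
  refine IntervalIntegrable.continuousOn_mul ?_ continuousOn_id
  refine (intervalIntegrable_const (c := C)).mono_fun hm.aestronglyMeasurable ?_
  filter_upwards with ρ
  rw [Real.norm_eq_abs, Real.norm_of_nonneg hC0]
  exact abs_indicator_density_le hC0 hC _

/-- In a generic direction, the mass of the cell of `i` on the ray is differentiable. -/
lemma hasFDerivAt_rayMass {P : Network n} (hru : ∀ i, 0 ≤ P.ru i) (hΩ : IsCompact P.Ω)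
    (hφ : ContinuousOn P.φ P.Ω) {q₀ : Config n} (hq : Separated P q₀) {i : Fin n}
    (hR : 0 < sensingRadius P i) {θ K : ℝ} (hθ : Generic P q₀ i θ) {M : Config n → ℝ}
    (hM : ∀ᶠ q in 𝓝 q₀, IsThreshold (fun j ρ => con P i j q (q₀ i + ρ • dir θ)) (M q))
    (hlip : ∀ᶠ q in 𝓝 q₀, |M q - M q₀| ≤ K * ‖q - q₀‖) :
    HasFDerivAt (fun q => ∫ ρ in (0 : ℝ)..M q, ρ * P.Ω.indicator P.φ (q₀ i + ρ • dir θ))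
      (rayDeriv P q₀ i θ) q₀ := by
  have hM₀ := hM.self_of_nhds
  set f : ℝ → ℝ := fun ρ => ρ * P.Ω.indicator P.φ (q₀ i + ρ • dir θ) with hf
  obtain ⟨j, hj⟩ := hM₀.active
  have hMj : M q₀ = arcRadius P q₀ i j θ := eq_arcRadius_of_con_eq_zero hru hq hM₀.pos hj
  have hρ : 0 < arcRadius P q₀ i j θ := hMj ▸ hM₀.pos
  have hpt : q₀ i + M q₀ • dir θ = arcPoint P q₀ i j θ := by rw [arcPoint, hMj]
  have hle : ∀ k, con P i k q₀ (arcPoint P q₀ i j θ) ≤ 0 := fun k => by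
    rw [← hpt]; exact hM₀.le_zero k
  obtain ⟨htie, hint⟩ := hθ j hρ
  have hmem : arcPoint P q₀ i j θ ∈ gsvCell P q₀ i ↔ arcPoint P q₀ i j θ ∈ P.Ω := by
    rw [mem_gsvCell_iff hru hq]; exact ⟨fun h => h.1, fun h => ⟨h, hle⟩⟩
  have hcont : ∀ k, ContinuousAt
      (fun z : Config n × ℝ => con P i k z.1 (q₀ i + z.2 • dir θ)) (q₀, M q₀) := by
    intro k
    have hc : Continuous fun z : Config n × ℝ => (z.1, q₀ i + z.2 • dir θ) := by fun_prop
    exact (Continuous.comp (g := fun z : Config n × Plane => con P i k z.1 z.2)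
      (continuous_con P i k) hc).continuousAt
  have hneg : ∀ k, k ≠ j → con P i k q₀ (q₀ i + M q₀ • dir θ) < 0 := fun k hk => by
    rw [hpt]; exact lt_of_le_of_ne (hle k) (htie k hk)
  have hfc : ContinuousAt f (M q₀) := by
    refine continuousAt_id.mul ?_
    refine ContinuousAt.comp (f := fun ρ : ℝ => q₀ i + ρ • dir θ) (g := P.Ω.indicator P.φ) ?_
      (by fun_prop)
    refine continuousAt_indicator_of_notMem_frontier hΩ.isClosed hφ ?_
    rw [hpt]
    exact fun h => hint (hmem.2 h)
  have hfm : Measurable f := measurable_id.mul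
    ((measurable_indicator_density hΩ hφ).comp (by fun_prop))
  have hF : HasDerivAt (fun m => ∫ ρ in (0 : ℝ)..m, f ρ) (f (M q₀)) (M q₀) :=
    intervalIntegral.integral_hasDerivAt_right (intervalIntegrable_ray hΩ hφ _ _ _ _)
      hfm.stronglyMeasurable.stronglyMeasurableAtFilter hfc
  have hdens : arcDensity P q₀ i j θ = f (M q₀) := by
    classical
    simp only [hf]
    rw [arcDensity_eq_ite, hpt, hMj]
    by_cases h : arcPoint P q₀ i j θ ∈ P.Ω
    · rw [if_pos ⟨hρ, hmem.2 h⟩]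
    · rw [if_neg fun h' => h (hmem.1 h'.2), indicator_of_notMem h, mul_zero]
  -- Any arc point lying in the cell is the endpoint of the ray, so a second contributing arc would
  -- be a tie with `j`.
  have hother : ∀ k, k ≠ j → arcDensity P q₀ i k θ = 0 := by
    intro k hk
    unfold arcDensity
    rw [if_neg]
    rintro ⟨hρk, hcell⟩
    have h1 : arcRadius P q₀ i k θ = M q₀ := by
      refine hM₀.eq_of_eq_zero (fun l => convexOn_con_ray hru i l q₀ (q₀ i) (dir θ)) (fun l => ?_)
        hρk ((mem_gsvCell_iff hru hq i _).1 hcell).2 (con_arcPoint_self hru hq hρk)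
      simp only [zero_smul, add_zero]
      exact con_center_neg hru hq hR l
    have h2 := con_arcPoint_self hru hq hρk
    rw [arcPoint, h1] at h2
    exact (hneg k hk).ne h2
  have hsum : rayDeriv P q₀ i θ
      = pair i (nearWeight P q₀ i j θ) + pair j (farWeight P q₀ i j θ) := by
    unfold rayDeriv
    refine Finset.sum_eq_single j (fun k _ hk => ?_) (by simp)
    obtain ⟨h1, h2⟩ := weights_eq_zero_of_arcDensity (hother k hk)
    rw [h1, h2]; ext h; simp
  by_cases hji : j = i
  · subst hji
    have hd := hasFDerivAt_con_ray_self P q₀ j θ (ρ := M q₀) hM₀.pos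
    have hMd := hasFDerivAt_threshold (ψ := fun k q ρ => con P j k q (q₀ j + ρ • dir θ))
      hM hlip hcont hneg one_ne_zero hd
    refine (hF.comp_hasFDerivAt q₀ hMd).congr_fderiv ?_
    rw [hsum, nearWeight, farWeight, if_pos rfl, if_pos rfl, ← hdens]
    ext h
    simp [real_inner_smul_left]
  · have hhead := headway_pos_of_arcRadius_pos hru hq hji hρ
    have hd := hasFDerivAt_con_ray P q₀ hji θ (ρ := M q₀) hM₀.pos
    have hMd := hasFDerivAt_threshold (ψ := fun k q ρ => con P i k q (q₀ i + ρ • dir θ))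
      hM hlip hcont hneg (mul_pos two_pos hhead).ne' hd
    refine (hF.comp_hasFDerivAt q₀ hMd).congr_fderiv ?_
    rw [hsum, nearWeight, farWeight, if_neg hji, if_neg hji, ← hdens, hpt, hMj]
    ext h
    simp only [add_apply, smul_apply, sub_apply, pair_apply, real_inner_smul_left, smul_eq_mul]
    field_simp
    ring

lemma exists_con_center_lt {P : Network n} (hru : ∀ i, 0 ≤ P.ru i) {q : Config n}
    (hq : Separated P q) {i : Fin n} (hR : 0 < sensingRadius P i) :
    ∃ δ : ℝ, 0 < δ ∧ ∀ j, con P i j q (q i) < -δ := by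
  obtain ⟨j₀, -, hj₀⟩ := Finset.exists_max_image Finset.univ (fun j => con P i j q (q i))
    ⟨i, Finset.mem_univ i⟩
  have h0 := con_center_neg hru hq hR j₀
  refine ⟨-con P i j₀ q (q i) / 2, by linarith, fun j => ?_⟩
  have := hj₀ j (Finset.mem_univ j)
  linarith

/-- On a bounded set of points the difference of two squares is controlled by the change in distance
times a bounded sum. -/
lemma exists_con_lipschitz {P : Network n} (hru : ∀ i, 0 ≤ P.ru i) (q₀ : Config n) (i : Fin n)
    {B : ℝ} (hB : 0 ≤ B) :
    ∃ L : ℝ, 0 ≤ L ∧ ∀ q : Config n, ‖q - q₀‖ ≤ 1 → ∀ (j : Fin n) (p : Plane), ‖p - q₀ i‖ ≤ B →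
      |con P i j q p - con P i j q₀ p| ≤ L * ‖q - q₀‖ := by
  set Lj : Fin n → ℝ := fun j =>
    1 + 2 * (B + 1 + (P.ru i + P.ru j)) + 2 * (B + ‖q₀ j - q₀ i‖ + 1) with hLj
  have hLj0 : ∀ j, 0 ≤ Lj j := fun j => by
    have := hru i; have := hru j; simp only [hLj]; positivity
  refine ⟨∑ j, Lj j, Finset.sum_nonneg fun j _ => hLj0 j, fun q hε1 j p hpc => ?_⟩
  have hle : Lj j ≤ ∑ j, Lj j :=
    Finset.single_le_sum (fun k _ => hLj0 k) (Finset.mem_univ j)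
  refine le_trans ?_ (mul_le_mul_of_nonneg_right hle (norm_nonneg _))
  have hdist : ∀ k, |‖p - q k‖ - ‖p - q₀ k‖| ≤ ‖q - q₀‖ := by
    intro k
    refine (abs_norm_sub_norm_le _ _).trans ?_
    have : p - q k - (p - q₀ k) = -((q - q₀) k) := by
      rw [Pi.sub_apply]; abel
    rw [this, norm_neg]
    exact norm_le_pi_norm (q - q₀) k
  have hε0 : 0 ≤ ‖q - q₀‖ := norm_nonneg _
  generalize ‖q - q₀‖ = ε at *
  have hi := abs_le.1 (hdist i)
  have hj := abs_le.1 (hdist j)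
  have hs : 0 ≤ P.ru i + P.ru j := add_nonneg (hru i) (hru j)
  have hD := norm_nonneg (q₀ j - q₀ i)
  have e2 : Lj j * ε = ε + ε * (2 * (B + 1 + (P.ru i + P.ru j)))
      + ε * (2 * (B + ‖q₀ j - q₀ i‖ + 1)) := by
    simp only [hLj]; ring
  rw [e2]
  by_cases hji : j = i
  · subst hji
    rw [con_self, con_self]
    have h1 : ‖p - q j‖ - sensingRadius P j - (‖p - q₀ j‖ - sensingRadius P j)
        = ‖p - q j‖ - ‖p - q₀ j‖ := by ring
    rw [h1]
    refine (hdist j).trans ?_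
    have t1 : 0 ≤ ε * (2 * (B + 1 + (P.ru j + P.ru j))) := by positivity
    have t2 : 0 ≤ ε * (2 * (B + ‖q₀ j - q₀ j‖ + 1)) := by positivity
    linarith
  · rw [con_of_ne P hji, con_of_ne P hji]
    have hFj : ‖p - q₀ j‖ ≤ B + ‖q₀ j - q₀ i‖ := by
      have h2 := norm_sub_le (p - q₀ i) (q₀ j - q₀ i)
      have h3 : p - q₀ i - (q₀ j - q₀ i) = p - q₀ j := by abel
      rw [h3] at h2; linarith
    have hA0 := norm_nonneg (p - q i)
    have hA0' := norm_nonneg (p - q₀ i)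
    have hF0 := norm_nonneg (p - q j)
    have hF0' := norm_nonneg (p - q₀ j)
    have hdi := hdist i
    have hdj := hdist j
    generalize ‖p - q i‖ = x at *
    generalize ‖p - q₀ i‖ = x₀ at *
    generalize ‖p - q j‖ = y at *
    generalize ‖p - q₀ j‖ = y₀ at *
    generalize P.ru i + P.ru j = s at *
    have e1 : (x + s) ^ 2 - y ^ 2 - ((x₀ + s) ^ 2 - y₀ ^ 2)
        = (x - x₀) * (x + x₀ + 2 * s) - (y - y₀) * (y + y₀) := by ring
    rw [e1]
    refine (abs_sub _ _).trans ?_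
    rw [abs_mul, abs_mul]
    have b1 : |x + x₀ + 2 * s| ≤ 2 * (B + 1 + s) := by
      rw [abs_of_nonneg (by positivity)]; linarith
    have b2 : |y + y₀| ≤ 2 * (B + ‖q₀ j - q₀ i‖ + 1) := by
      rw [abs_of_nonneg (by positivity)]; linarith
    have t1 := mul_le_mul hdi b1 (abs_nonneg _) hε0
    have t2 := mul_le_mul hdj b2 (abs_nonneg _) hε0
    linarith

lemma rayDeriv_eq_zero_of_radius {P : Network n} {i : Fin n} (hR : sensingRadius P i ≤ 0)
    (q : Config n) (θ : ℝ) : rayDeriv P q i θ = 0 := by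
  refine Finset.sum_eq_zero fun j _ => ?_
  obtain ⟨h1, h2⟩ := weights_eq_zero_of_arcDensity (arcDensity_eq_zero_of_radius hR q j θ)
  rw [h1, h2]; ext h; simp

lemma cellMass_eq_zero_of_radius {P : Network n} {i : Fin n} (hR : sensingRadius P i ≤ 0)
    (q : Config n) : ∫ p in gsvCell P q i, P.φ p = 0 := by
  have hsub : gsvCell P q i ⊆ {q i} := by
    intro p hp
    have : ‖p - q i‖ ≤ sensingRadius P i := hp.2.2
    have h2 : ‖p - q i‖ = 0 := le_antisymm (this.trans hR) (norm_nonneg _)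
    exact sub_eq_zero.1 (norm_eq_zero.1 h2)
  exact setIntegral_measure_zero _ (measure_mono_null hsub (measure_singleton _))

lemma continuous_con_left (P : Network n) (i j : Fin n) (p : Plane) :
    Continuous (fun q : Config n => con P i j q p) :=
  Continuous.comp (g := fun z : Config n × Plane => con P i j z.1 z.2) (f := fun q => (q, p))
    (continuous_con P i j) (Continuous.prodMk_left p)

/-- The mass of the cell of `i` is differentiable at admissible configurations. -/
lemma hasFDerivAt_cellMass {P : Network n} (hru : ∀ i, 0 ≤ P.ru i) (hΩ : IsCompact P.Ω)
    (hconv : Convex ℝ P.Ω) (hφ : ContinuousOn P.φ P.Ω) {q₀ : Config n} (hq : Admissible P q₀)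
    (i : Fin n) :
    Integrable (rayDeriv P q₀ i) (volume.restrict (Ioo (-Real.pi) Real.pi)) ∧
    HasFDerivAt (fun q => ∫ p in gsvCell P q i, P.φ p)
      (∫ θ in Ioo (-Real.pi) Real.pi, rayDeriv P q₀ i θ) q₀ := by
  rcases le_or_gt (sensingRadius P i) 0 with hR | hR
  · have h0 : rayDeriv P q₀ i = fun _ => 0 := funext (rayDeriv_eq_zero_of_radius hR q₀)
    have h1 : (fun q => ∫ p in gsvCell P q i, P.φ p) = fun _ => 0 :=
      funext (cellMass_eq_zero_of_radius hR)
    rw [h0, h1, integral_zero]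
    exact ⟨integrable_const 0, hasFDerivAt_const _ _⟩
  have hsep := hq.separated
  -- The rays start at the unperturbed position for every `q`, so that the domain of integration
  -- does not move. For `q i ≠ c` the constraints along them are no longer affine, and convexity
  -- takes over.
  set c := q₀ i with hc
  -- For `‖q - q₀‖ < 1` the sensing disk about `q i` lies within distance `B` of `c`, so the
  -- constraint with index `i` is violated at `B`.
  set B := sensingRadius P i + 1 with hB
  have hB0 : 0 < B := by linarith
  obtain ⟨C, hC0, hC⟩ := exists_density_bound hΩ hφ
  obtain ⟨δ, hδ0, hδ⟩ := exists_con_center_lt hru hsep hR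
  set U : Set (Config n) := {q | ‖q - q₀‖ < 1 ∧ Separated P q ∧ ∀ j, con P i j q c ≤ -δ} with hU
  have hUn : U ∈ 𝓝 q₀ := by
    have h1 : ∀ᶠ q in 𝓝 q₀, ‖q - q₀‖ < 1 := by
      filter_upwards [Metric.ball_mem_nhds q₀ one_pos] with q hq
      simpa [dist_eq_norm] using hq
    have h2 : ∀ᶠ q in 𝓝 q₀, Separated P q := (isOpen_separated P).mem_nhds hsep
    have h3 : ∀ᶠ q in 𝓝 q₀, ∀ j, con P i j q c ≤ -δ := by
      refine eventually_all.2 fun j => ?_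
      have hcc := (continuous_con_left P i j c).tendsto q₀
      exact (hcc.eventually_lt_const (hδ j)).mono fun q h => h.le
    filter_upwards [h1, h2, h3] with q a b d using ⟨a, b, d⟩
  have hthr : ∀ q ∈ U, ∀ θ,
      ∃ M, IsThreshold (fun j ρ => con P i j q (c + ρ • dir θ)) M ∧ M < B := by
    intro q hqU θ
    refine exists_isThreshold (fun j => convexOn_con_ray hru i j q c (dir θ))
      (fun j => (continuous_con_right P i j q).comp (by fun_prop)) (fun j => ?_) hB0 ⟨i, ?_⟩
    · simp only [zero_smul, add_zero]
      linarith [hqU.2.2 j]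
    · rw [con_self]
      have h1 : ‖q i - c‖ < 1 := (norm_le_pi_norm (q - q₀) i).trans_lt hqU.1
      have h2 : ‖c + B • dir θ - c‖ ≤ ‖c + B • dir θ - q i‖ + ‖q i - c‖ := by
        have := norm_add_le (c + B • dir θ - q i) (q i - c); simpa using this
      rw [norm_ray c hB0.le] at h2
      linarith
  choose! M hM hMB using hthr
  obtain ⟨L, hL0, hL⟩ : ∃ L : ℝ, 0 ≤ L ∧ ∀ q ∈ U, ∀ θ j ρ, 0 ≤ ρ → ρ ≤ B →
      |con P i j q (c + ρ • dir θ) - con P i j q₀ (c + ρ • dir θ)| ≤ L * ‖q - q₀‖ := by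
    obtain ⟨L, hL0, hL⟩ := exists_con_lipschitz hru q₀ i hB0.le
    exact ⟨L, hL0, fun q hqU θ j ρ hρ0 hρB =>
      hL q hqU.1.le j _ (by rw [hc, norm_ray _ hρ0]; exact hρB)⟩
  have hq₀U : q₀ ∈ U := mem_of_mem_nhds hUn
  have hMlip : ∀ q ∈ U, ∀ θ, |M q θ - M q₀ θ| ≤ (B * L / δ) * ‖q - q₀‖ := by
    intro q hqU θ
    have h1 := (hM q hqU θ).abs_sub_mul_le (hM q₀ hq₀U θ) (B := B) (δ := δ)
      (ε := L * ‖q - q₀‖) (fun j => convexOn_con_ray hru i j q c (dir θ))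
      (fun j => convexOn_con_ray hru i j q₀ c (dir θ))
      (fun j => by simpa using hqU.2.2 j) (fun j => by simpa using hq₀U.2.2 j) hδ0.le
      (hMB q hqU θ).le (hMB q₀ hq₀U θ).le (by positivity) (fun j ρ => hL q hqU θ j ρ)
    have e : (B * L / δ) * ‖q - q₀‖ = (B * (L * ‖q - q₀‖)) / δ := by ring
    rw [e, le_div_iff₀ hδ0]
    linarith
  set F : Config n → ℝ → ℝ := fun q θ =>
    ∫ ρ in Ioi (0 : ℝ), ρ * (gsvCell P q i).indicator P.φ (c + ρ • dir θ) with hF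
  have hcellm : ∀ q ∈ U, MeasurableSet (gsvCell P q i) := fun q hqU =>
    (isClosed_gsvCell hru hΩ.isClosed hqU.2.1 i).measurableSet
  have hpolar : ∀ q ∈ U, Integrable (F q) (volume.restrict (Ioo (-Real.pi) Real.pi)) ∧
      ∫ p in gsvCell P q i, P.φ p = ∫ θ in Ioo (-Real.pi) Real.pi, F q θ := by
    intro q hqU
    have hi : IntegrableOn P.φ (gsvCell P q i) :=
      (hφ.integrableOn_compact hΩ).mono_set (gsvCell_subset P q i)
    have := integral_polar c ((gsvCell P q i).indicator P.φ)
      ((integrable_indicator_iff (hcellm q hqU)).2 hi)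
    rwa [integral_indicator (hcellm q hqU)] at this
  have hFM : ∀ q ∈ U, ∀ θ,
      F q θ = ∫ ρ in (0 : ℝ)..M q θ, ρ * P.Ω.indicator P.φ (c + ρ • dir θ) := fun q hqU θ =>
    rayMass_eq hru hqU.2.1 i c θ (hM q hqU θ)
  have hFlip : ∀ q ∈ U, ∀ θ, ‖F q θ - F q₀ θ‖ ≤ (B * C * (B * L / δ)) * ‖q - q₀‖ := by
    intro q hqU θ
    rw [hFM q hqU, hFM q₀ hq₀U, intervalIntegral.integral_interval_sub_left
      (intervalIntegrable_ray hΩ hφ _ _ _ _) (intervalIntegrable_ray hΩ hφ _ _ _ _)]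
    have h1 : ∀ ρ ∈ uIoc (M q₀ θ) (M q θ), ‖ρ * P.Ω.indicator P.φ (c + ρ • dir θ)‖ ≤ B * C := by
      intro ρ hρ
      have hρ1 : 0 ≤ ρ := ((lt_min (hM q₀ hq₀U θ).pos (hM q hqU θ).pos).trans hρ.1).le
      have hρ2 : ρ ≤ B := hρ.2.trans (max_le (hMB q₀ hq₀U θ).le (hMB q hqU θ).le)
      rw [norm_mul, Real.norm_of_nonneg hρ1]
      exact mul_le_mul hρ2 (abs_indicator_density_le hC0 hC _) (norm_nonneg _) hB0.le
    refine (intervalIntegral.norm_integral_le_of_norm_le_const h1).trans ?_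
    rw [mul_assoc (B * C)]
    exact mul_le_mul_of_nonneg_left (hMlip q hqU θ) (mul_nonneg hB0.le hC0)
  -- The Lipschitz bound for the ray masses holds for all directions with one constant, whereas
  -- differentiability at `q₀` is needed for almost every direction only.
  have hmain := hasFDerivAt_integral_of_dominated_loc_of_lip' (𝕜 := ℝ)
    (μ := volume.restrict (Ioo (-Real.pi) Real.pi)) (F := F) (x₀ := q₀) (s := U)
    (F' := rayDeriv P q₀ i) (bound := fun _ => B * C * (B * L / δ)) hUn
    (fun q hqU => (hpolar q hqU).1.aestronglyMeasurable) (hpolar q₀ hq₀U).1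
    (measurable_rayDeriv hru hΩ hφ hsep i).aestronglyMeasurable
    (Eventually.of_forall fun θ q hqU => hFlip q hqU θ) (integrable_const _) (by
      have hg := ae_mono (Measure.restrict_mono Ioo_subset_Ioc_self le_rfl)
        (ae_generic hru hconv hq i)
      filter_upwards [hg] with θ hθ
      have hd := hasFDerivAt_rayMass hru hΩ hφ hsep hR hθ (M := fun q => M q θ)
        (by filter_upwards [hUn] with q hqU using hM q hqU θ)
        (by filter_upwards [hUn] with q hqU using hMlip q hqU θ)
      refine hd.congr_of_eventuallyEq ?_
      filter_upwards [hUn] with q hqU using hFM q hqU θ)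
  refine ⟨hmain.1, hmain.2.congr_of_eventuallyEq ?_⟩
  filter_upwards [hUn] with q hqU using (hpolar q hqU).2

/-! ### The gradient of the coverage criterion -/

lemma arcDensity_nonneg {P : Network n} (hφ : ∀ p, 0 ≤ P.φ p) (q : Config n) (i j : Fin n)
    (θ : ℝ) : 0 ≤ arcDensity P q i j θ := by
  unfold arcDensity
  split_ifs with h
  · exact mul_nonneg h.1.le (hφ _)
  · exact le_rfl

lemma norm_far_vector {P : Network n} (hru : ∀ i, 0 ≤ P.ru i) {q : Config n} (hq : Separated P q)
    {i j : Fin n} (hji : j ≠ i) {θ : ℝ} (hρ : 0 < arcRadius P q i j θ) :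
    ‖q j - arcPoint P q i j θ‖ = arcRadius P q i j θ + (P.ru i + P.ru j) := by
  have h := con_arcPoint_self hru hq hρ
  rw [con_of_ne P hji, arcPoint, norm_ray _ hρ.le, sub_eq_zero] at h
  have hs : 0 ≤ P.ru i + P.ru j := add_nonneg (hru i) (hru j)
  rw [norm_sub_rev, arcPoint]
  exact ((pow_left_inj₀ (by positivity) (norm_nonneg _) two_ne_zero).1 h).symm

/-- On an arc in the cell the polar equation bounds `1 / headway` by `2 R / E`. The gap enters only
through its lower bound `E`, so one constant serves all nearby configurations, as dominated
convergence requires. -/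
lemma norm_weights_le {P : Network n} (hru : ∀ i, 0 ≤ P.ru i) (hφ : ∀ p, 0 ≤ P.φ p)
    {q : Config n} (hq : Separated P q)
    {C : ℝ} (hC0 : 0 ≤ C) (hC : ∀ p ∈ P.Ω, |P.φ p| ≤ C) (i j : Fin n) {E : ℝ} (hE0 : 0 < E)
    (hE : j ≠ i → E ≤ ‖q j - q i‖ ^ 2 - (P.ru i + P.ru j) ^ 2) (θ : ℝ) :
    let R := |sensingRadius P i|
    let K := R * C * (1 + (R + (P.ru i + P.ru j)) * (2 * R / E))
    ‖nearWeight P q i j θ‖ ≤ K ∧ ‖farWeight P q i j θ‖ ≤ K := by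
  intro R K
  have hs : 0 ≤ P.ru i + P.ru j := add_nonneg (hru i) (hru j)
  have hR0 : 0 ≤ R := abs_nonneg _
  have hK0 : 0 ≤ K := by positivity
  by_cases hact : 0 < arcRadius P q i j θ ∧ arcPoint P q i j θ ∈ gsvCell P q i
  swap
  · have h0 : arcDensity P q i j θ = 0 := by unfold arcDensity; rw [if_neg hact]
    obtain ⟨h1, h2⟩ := weights_eq_zero_of_arcDensity h0
    rw [h1, h2, norm_zero]
    exact ⟨hK0, hK0⟩
  have hρ := hact.1
  have hρR : arcRadius P q i j θ ≤ R := (arcRadius_le_of_mem hρ hact.2).trans (le_abs_self _)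
  have hd0 := arcDensity_nonneg hφ q i j θ
  have hd : arcDensity P q i j θ ≤ R * C := by
    unfold arcDensity
    rw [if_pos hact]
    exact mul_le_mul hρR ((le_abs_self _).trans (hC _ (gsvCell_subset P q i hact.2)))
      (hφ _) hR0
  by_cases hji : j = i
  · simp only [nearWeight, farWeight, hji, if_true, zero_smul, norm_zero, mul_one]
    subst hji
    refine ⟨?_, hK0⟩
    rw [norm_smul, norm_dir, mul_one, Real.norm_of_nonneg hd0]
    refine hd.trans (le_mul_of_one_le_right (by positivity) ?_)
    have : 0 ≤ (R + (P.ru j + P.ru j)) * (2 * R / E) := by positivity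
    linarith
  · have hσ := headway_pos_of_arcRadius_pos hru hq hji hρ
    have e := two_mul_arcRadius_mul_headway hru hq hji hρ
    have hinv : (headway P q i j θ)⁻¹ ≤ 2 * R / E := by
      rw [inv_le_iff_one_le_mul₀ hσ, div_mul_eq_mul_div, le_div_iff₀ hE0, one_mul]
      refine (hE hji).trans ?_
      rw [← e]
      exact mul_le_mul_of_nonneg_right (by linarith) hσ.le
    have hbound : arcDensity P q i j θ *
        ((arcRadius P q i j θ + (P.ru i + P.ru j)) * (headway P q i j θ)⁻¹) ≤ K := by
      have h1 : (arcRadius P q i j θ + (P.ru i + P.ru j)) * (headway P q i j θ)⁻¹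
          ≤ (R + (P.ru i + P.ru j)) * (2 * R / E) :=
        mul_le_mul (by linarith) hinv (inv_nonneg.2 hσ.le) (by positivity)
      refine mul_le_mul hd (h1.trans (by linarith)) ?_ (by positivity)
      exact mul_nonneg (by positivity) (inv_nonneg.2 hσ.le)
    constructor
    · rw [nearWeight, if_neg hji, norm_smul, norm_dir, mul_one, div_eq_mul_inv,
        Real.norm_of_nonneg]
      · exact hbound
      · exact mul_nonneg hd0 (mul_nonneg (by positivity) (inv_nonneg.2 hσ.le))
    · rw [farWeight, if_neg hji, norm_smul, norm_far_vector hru hq hji hρ,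
        Real.norm_of_nonneg (div_nonneg hd0 hσ.le)]
      calc _ = _ := by rw [div_eq_mul_inv]; ring
        _ ≤ K := hbound

lemma integrable_weights {P : Network n} (hru : ∀ i, 0 ≤ P.ru i) (hΩ : IsCompact P.Ω)
    (hφ0 : ∀ p, 0 ≤ P.φ p) (hφ : ContinuousOn P.φ P.Ω) {q : Config n} (hq : Separated P q)
    (i j : Fin n) (s : Set ℝ) (hs : volume s ≠ ⊤) :
    IntegrableOn (nearWeight P q i j) s ∧ IntegrableOn (farWeight P q i j) s := by
  obtain ⟨C, hC0, hC⟩ := exists_density_bound hΩ hφ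
  obtain ⟨E, hE0, hE⟩ : ∃ E : ℝ, 0 < E ∧
      (j ≠ i → E ≤ ‖q j - q i‖ ^ 2 - (P.ru i + P.ru j) ^ 2) := by
    by_cases hji : j = i
    · exact ⟨1, one_pos, fun h => absurd hji h⟩
    · exact ⟨_, hq.gap_pos hru hji, fun _ => le_rfl⟩
  have := norm_weights_le hru hφ0 hq hC0 hC i j hE0 hE
  have hfin : IsFiniteMeasure (volume.restrict s) := ⟨by simpa using hs.lt_top⟩
  exact ⟨Integrable.of_bound (measurable_nearWeight hru hΩ hφ hq i j).aestronglyMeasurable _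
      (Eventually.of_forall fun θ => (this θ).1),
    Integrable.of_bound (measurable_farWeight hru hΩ hφ hq i j).aestronglyMeasurable _
      (Eventually.of_forall fun θ => (this θ).2)⟩

/-- The gradient of the coverage criterion in the position of agent `k`, as a sum of integrals over
the directions. -/
def coverageGrad (P : Network n) (q : Config n) (k : Fin n) : Plane :=
  ∑ j, ((∫ θ in Ioc (-Real.pi) Real.pi, nearWeight P q k j θ)
    + ∫ θ in Ioc (-Real.pi) Real.pi, farWeight P q j k θ)

/-- Adding the two dominance inequalities makes the distances to both agents equal, so the overlap
lies on the perpendicular bisector, a null set. -/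
lemma aedisjoint_gsvCell {P : Network n} (hru : ∀ i, 0 ≤ P.ru i) {q : Config n}
    (hq : Separated P q) {i j : Fin n} (hij : i ≠ j) :
    AEDisjoint volume (gsvCell P q i) (gsvCell P q j) := by
  have hsub : gsvCell P q i ∩ gsvCell P q j ⊆ AffineSubspace.perpBisector (q i) (q j) := by
    rintro p ⟨hi, hj⟩
    have h1 := (con_nonpos_iff hru hij.symm q p).1 (((mem_gsvCell_iff hru hq i p).1 hi).2 j)
    have h2 := (con_nonpos_iff hru hij q p).1 (((mem_gsvCell_iff hru hq j p).1 hj).2 i)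
    rw [SetLike.mem_coe, AffineSubspace.mem_perpBisector_iff_dist_eq, dist_eq_norm, dist_eq_norm]
    linarith [hru i, hru j]
  refine measure_mono_null hsub (Measure.addHaar_affineSubspace _ _ ?_)
  rw [Ne, AffineSubspace.perpBisector_eq_top]
  intro h
  exact hq.ne hru hij (sub_eq_zero.2 h)

lemma coverage_eq_sum {P : Network n} (hru : ∀ i, 0 ≤ P.ru i) (hΩ : IsCompact P.Ω)
    (hφ : ContinuousOn P.φ P.Ω) {q : Config n} (hq : Separated P q) :
    coverage P q = ∑ i, ∫ p in gsvCell P q i, P.φ p := by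
  unfold coverage
  rw [integral_iUnion_ae
    (fun i => (isClosed_gsvCell hru hΩ.isClosed hq i).measurableSet.nullMeasurableSet)
    (fun i j hij => aedisjoint_gsvCell hru hq hij)
    ((hφ.integrableOn_compact hΩ).mono_set (iUnion_subset fun i => gsvCell_subset P q i)),
    tsum_fintype]

lemma integral_rayDeriv_apply {P : Network n} (hru : ∀ i, 0 ≤ P.ru i) (hΩ : IsCompact P.Ω)
    (hφ0 : ∀ p, 0 ≤ P.φ p) (hφ : ContinuousOn P.φ P.Ω) {q : Config n} (hq : Separated P q)
    (i : Fin n) (hint : Integrable (rayDeriv P q i) (volume.restrict (Ioo (-Real.pi) Real.pi)))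
    (h : Config n) :
    (∫ θ in Ioo (-Real.pi) Real.pi, rayDeriv P q i θ) h
      = ∑ j, (⟪∫ θ in Ioc (-Real.pi) Real.pi, nearWeight P q i j θ, h i⟫
          + ⟪∫ θ in Ioc (-Real.pi) Real.pi, farWeight P q i j θ, h j⟫) := by
  have hI := fun j => integrable_weights hru hΩ hφ0 hφ hq i j (Ioc (-Real.pi) Real.pi)
    (by simp)
  rw [ContinuousLinearMap.integral_apply hint, ← integral_Ioc_eq_integral_Ioo]
  simp only [rayDeriv, sum_apply, add_apply, pair_apply]
  have hn : ∀ j, IntegrableOn (fun θ => ⟪nearWeight P q i j θ, h i⟫)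
      (Ioc (-Real.pi) Real.pi) := fun j => (hI j).1.inner_const (h i)
  have hf : ∀ j, IntegrableOn (fun θ => ⟪farWeight P q i j θ, h j⟫)
      (Ioc (-Real.pi) Real.pi) := fun j => (hI j).2.inner_const (h j)
  have hnf : ∀ j ∈ (Finset.univ : Finset (Fin n)), IntegrableOn
      (fun θ => ⟪nearWeight P q i j θ, h i⟫ + ⟪farWeight P q i j θ, h j⟫)
      (Ioc (-Real.pi) Real.pi) := fun j _ => (hn j).add (hf j)
  rw [integral_finsetSum _ hnf]
  refine Finset.sum_congr rfl fun j _ => ?_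
  rw [integral_add (hn j) (hf j)]
  congr 1
  · simp only [real_inner_comm (h i)]
    exact integral_inner (hI j).1 (h i)
  · simp only [real_inner_comm (h j)]
    exact integral_inner (hI j).2 (h j)

lemma hasFDerivAt_coverage {P : Network n} (hru : ∀ i, 0 ≤ P.ru i) (hΩ : IsCompact P.Ω)
    (hconv : Convex ℝ P.Ω) (hφ0 : ∀ p, 0 ≤ P.φ p) (hφ : ContinuousOn P.φ P.Ω) {q : Config n}
    (hq : Admissible P q) :
    HasFDerivAt (coverage P) (∑ k, pair k (coverageGrad P q k)) q := by
  have h1 := HasFDerivAt.fun_sum (u := Finset.univ)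
    fun i _ => (hasFDerivAt_cellMass hru hΩ hconv hφ hq i).2
  have h2 : HasFDerivAt (coverage P)
      (∑ i, ∫ θ in Ioo (-Real.pi) Real.pi, rayDeriv P q i θ) q := by
    refine h1.congr_of_eventuallyEq ?_
    filter_upwards [(isOpen_separated P).mem_nhds hq.separated] with q' hq'
    exact coverage_eq_sum hru hΩ hφ hq'
  refine h2.congr_fderiv (ContinuousLinearMap.ext fun h => ?_)
  simp only [sum_apply, pair_apply]
  rw [Finset.sum_congr rfl fun i _ => integral_rayDeriv_apply hru hΩ hφ0 hφ hq.separated i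
    (hasFDerivAt_cellMass hru hΩ hconv hφ hq i).1 h]
  simp only [coverageGrad, Finset.sum_add_distrib, sum_inner, inner_add_left]
  congr 1
  exact Finset.sum_comm

/-! ### The parametrized hyperbola branch -/

/-- Rotation by a right angle, as a continuous linear map. -/
def rotCLM : Plane →L[ℝ] Plane :=
  LinearMap.toContinuousLinearMap
    { toFun := rot
      map_add' := fun v w => plane_ext (by simp [rot]; ring) (by simp [rot])
      map_smul' := fun c v => plane_ext (by simp [rot]) (by simp [rot]) }

@[simp] lemma rot_zero_coord (v : Plane) : rot v 0 = -(v 1) := rfl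
@[simp] lemma rot_one_coord (v : Plane) : rot v 1 = v 0 := rfl

lemma norm_sq_frame {e : Plane} (he : ‖e‖ = 1) (A B : ℝ) :
    ‖A • e + B • rot e‖ ^ 2 = A ^ 2 + B ^ 2 := by
  have h := norm_sq_eq e
  rw [he] at h
  rw [norm_sq_eq]
  simp only [PiLp.add_apply, PiLp.smul_apply, smul_eq_mul, rot_zero_coord, rot_one_coord]
  linear_combination -(A ^ 2 + B ^ 2) * h

lemma dir_add (β τ : ℝ) :
    dir (β + τ) = Real.cos τ • dir β + Real.sin τ • rot (dir β) := by
  apply plane_ext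
  · simp [Real.cos_add]; ring
  · simp [Real.sin_add]; ring

/-- The unit vector from the focus `x` to the focus `y`. -/
def axis (x y : Plane) : Plane := ‖y - x‖⁻¹ • (y - x)

/-- The semi-minor axis of the hyperbola with foci `x`, `y` and semi-major axis `a`. -/
def semiMinor (a : ℝ) (x y : Plane) : ℝ := Real.sqrt ((‖y - x‖ / 2) ^ 2 - a ^ 2)

section Hyperbola

variable {a : ℝ} {x y : Plane}

lemma hyperbolaCurve_eq (t : ℝ) : hyperbolaCurve a x y t = midpoint ℝ x y
    - (a * Real.cosh t) • axis x y + (semiMinor a x y * Real.sinh t) • rot (axis x y) := rfl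

lemma norm_axis (h : y - x ≠ 0) : ‖axis x y‖ = 1 := by
  rw [axis, norm_smul, norm_inv, norm_norm, inv_mul_cancel₀ (norm_ne_zero_iff.2 h)]

lemma smul_axis (h : y - x ≠ 0) : ‖y - x‖ • axis x y = y - x := by
  rw [axis, smul_inv_smul₀ (norm_ne_zero_iff.2 h)]

lemma sub_ne_zero_of_foci (ha : 0 ≤ a) (h : 2 * a < ‖y - x‖) : y - x ≠ 0 := by
  rw [← norm_pos_iff]; linarith

lemma semiMinor_pos (ha : 0 ≤ a) (h : 2 * a < ‖y - x‖) : 0 < semiMinor a x y := by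
  refine Real.sqrt_pos.2 ?_
  nlinarith

lemma semiMinor_sq (ha : 0 ≤ a) (h : 2 * a < ‖y - x‖) :
    semiMinor a x y ^ 2 = (‖y - x‖ / 2) ^ 2 - a ^ 2 := by
  refine Real.sq_sqrt ?_
  nlinarith

lemma hyperbolaCurve_sub_left (h : y - x ≠ 0) (t : ℝ) : hyperbolaCurve a x y t - x
    = (‖y - x‖ / 2 - a * Real.cosh t) • axis x y
      + (semiMinor a x y * Real.sinh t) • rot (axis x y) := by
  have h1 : midpoint ℝ x y - x = (‖y - x‖ / 2) • axis x y := by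
    rw [div_eq_inv_mul, mul_smul, smul_axis h, midpoint_sub_left]
    simp
  calc _ = (midpoint ℝ x y - x) - (a * Real.cosh t) • axis x y
      + (semiMinor a x y * Real.sinh t) • rot (axis x y) := by rw [hyperbolaCurve_eq]; abel
    _ = _ := by rw [h1, sub_smul]

lemma hyperbolaCurve_sub_right (h : y - x ≠ 0) (t : ℝ) : hyperbolaCurve a x y t - y
    = (-(‖y - x‖ / 2) - a * Real.cosh t) • axis x y
      + (semiMinor a x y * Real.sinh t) • rot (axis x y) := by
  have h1 : hyperbolaCurve a x y t - y
      = (hyperbolaCurve a x y t - x) - ‖y - x‖ • axis x y := by rw [smul_axis h]; abel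
  rw [h1, hyperbolaCurve_sub_left h]
  module

lemma focal_radius_pos (ha : 0 ≤ a) (h : 2 * a < ‖y - x‖) (t : ℝ) :
    0 < ‖y - x‖ / 2 * Real.cosh t - a := by
  nlinarith [Real.one_le_cosh t]

lemma norm_hyperbolaCurve_sub_left (ha : 0 ≤ a) (h : 2 * a < ‖y - x‖) (t : ℝ) :
    ‖hyperbolaCurve a x y t - x‖ = ‖y - x‖ / 2 * Real.cosh t - a := by
  have hne := sub_ne_zero_of_foci ha h
  have h1 : ‖hyperbolaCurve a x y t - x‖ ^ 2 = (‖y - x‖ / 2 * Real.cosh t - a) ^ 2 := by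
    rw [hyperbolaCurve_sub_left hne, norm_sq_frame (norm_axis hne), mul_pow,
      semiMinor_sq ha h, Real.sinh_sq]
    ring
  exact (pow_left_inj₀ (norm_nonneg _) (focal_radius_pos ha h t).le two_ne_zero).1 h1

lemma norm_hyperbolaCurve_sub_right (ha : 0 ≤ a) (h : 2 * a < ‖y - x‖) (t : ℝ) :
    ‖hyperbolaCurve a x y t - y‖ = ‖y - x‖ / 2 * Real.cosh t + a := by
  have hne := sub_ne_zero_of_foci ha h
  have h1 : ‖hyperbolaCurve a x y t - y‖ ^ 2 = (‖y - x‖ / 2 * Real.cosh t + a) ^ 2 := by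
    rw [hyperbolaCurve_sub_right hne, norm_sq_frame (norm_axis hne), mul_pow,
      semiMinor_sq ha h, Real.sinh_sq]
    ring
  refine (pow_left_inj₀ (norm_nonneg _) ?_ two_ne_zero).1 h1
  linarith [focal_radius_pos ha h t]

lemma hasDerivAt_hyperbolaCurve (t : ℝ) : HasDerivAt (hyperbolaCurve a x y)
    (-(a * Real.sinh t) • axis x y + (semiMinor a x y * Real.cosh t) • rot (axis x y)) t := by
  have h1 := ((Real.hasDerivAt_cosh t).const_mul a).smul_const (axis x y)
  have h2 := ((Real.hasDerivAt_sinh t).const_mul (semiMinor a x y)).smul_const (rot (axis x y))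
  have h3 := (h1.const_sub (midpoint ℝ x y)).add h2
  exact h3.congr_deriv (by module)

lemma norm_sq_deriv_hyperbolaCurve (ha : 0 ≤ a) (h : 2 * a < ‖y - x‖) (t : ℝ) :
    ‖deriv (hyperbolaCurve a x y) t‖ ^ 2
      = (‖y - x‖ / 2 * Real.cosh t + a) * (‖y - x‖ / 2 * Real.cosh t - a) := by
  rw [(hasDerivAt_hyperbolaCurve t).deriv, norm_sq_frame (norm_axis (sub_ne_zero_of_foci ha h)),
    mul_pow, semiMinor_sq ha h, neg_sq, mul_pow, Real.sinh_sq]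
  ring

/-- Polar angle, relative to the axis, of the point with parameter `t` as seen from `x`. -/
def branchAngle (a : ℝ) (x y : Plane) (t : ℝ) : ℝ :=
  Complex.arg ⟨‖y - x‖ / 2 - a * Real.cosh t, semiMinor a x y * Real.sinh t⟩

lemma norm_branchComplex (ha : 0 ≤ a) (h : 2 * a < ‖y - x‖) (t : ℝ) :
    ‖(⟨‖y - x‖ / 2 - a * Real.cosh t, semiMinor a x y * Real.sinh t⟩ : ℂ)‖
      = ‖y - x‖ / 2 * Real.cosh t - a := by
  have h1 : ‖(⟨‖y - x‖ / 2 - a * Real.cosh t, semiMinor a x y * Real.sinh t⟩ : ℂ)‖ ^ 2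
      = (‖y - x‖ / 2 * Real.cosh t - a) ^ 2 := by
    rw [Complex.sq_norm, Complex.normSq_apply]
    have := semiMinor_sq ha h
    have h2 := Real.sinh_sq t
    simp only
    calc _ = (‖y - x‖ / 2 - a * Real.cosh t) ^ 2 + semiMinor a x y ^ 2 * Real.sinh t ^ 2 := by ring
      _ = _ := by rw [this, h2]; ring
  exact (pow_left_inj₀ (norm_nonneg _) (focal_radius_pos ha h t).le two_ne_zero).1 h1

lemma hyperbolaCurve_polar (ha : 0 ≤ a) (h : 2 * a < ‖y - x‖) {β : ℝ} (hβ : axis x y = dir β)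
    (t : ℝ) : hyperbolaCurve a x y t
      = x + (‖y - x‖ / 2 * Real.cosh t - a) • dir (β + branchAngle a x y t) := by
  have hne := sub_ne_zero_of_foci ha h
  rw [← sub_eq_iff_eq_add', hyperbolaCurve_sub_left hne, dir_add, smul_add, smul_smul, smul_smul,
    ← hβ, ← norm_branchComplex ha h t, branchAngle, Complex.norm_mul_cos_arg,
    Complex.norm_mul_sin_arg]

/-- The angle is the imaginary part of `log w` for the point `w` of the branch in the complex plane.
So its derivative is `Im (w' / w)`, where `|w| = ρ` and the numerator `Im (w' * conj w)` reduces to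
`b ρ`. -/
lemma hasDerivAt_branchAngle (ha : 0 ≤ a) (h : 2 * a < ‖y - x‖) (t : ℝ) :
    HasDerivAt (branchAngle a x y)
      (semiMinor a x y / (‖y - x‖ / 2 * Real.cosh t - a)) t := by
  set c := ‖y - x‖ / 2 with hc
  set b := semiMinor a x y with hb
  have hb0 : 0 < b := semiMinor_pos ha h
  have hρ : 0 < c * Real.cosh t - a := focal_radius_pos ha h t
  set w : ℝ → ℂ := fun t => ((c - a * Real.cosh t : ℝ) : ℂ) + ((b * Real.sinh t : ℝ) : ℂ) * Complex.I
    with hw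
  have hwt : ∀ t, w t = ⟨c - a * Real.cosh t, b * Real.sinh t⟩ := fun t => by
    apply Complex.ext <;> simp only [hw, Complex.add_re, Complex.add_im, Complex.mul_re,
      Complex.mul_im, Complex.ofReal_re, Complex.ofReal_im, Complex.I_re, Complex.I_im] <;> ring
  have hd : HasDerivAt w (((-(a * Real.sinh t) : ℝ) : ℂ) + ((b * Real.cosh t : ℝ) : ℂ) * Complex.I)
      t := by
    have h1 := (((Real.hasDerivAt_cosh t).const_mul a).const_sub c).ofReal_comp
    have h2 := (((Real.hasDerivAt_sinh t).const_mul b).ofReal_comp).mul_const Complex.I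
    exact h1.add h2
  -- The branch crosses the real axis only at `t = 0`, in the point `c - a > 0`, so it avoids the
  -- cut of the logarithm.
  have hslit : w t ∈ Complex.slitPlane := by
    rw [Complex.mem_slitPlane_iff, hwt]
    by_cases ht : t = 0
    · left
      simp only [ht, Real.cosh_zero, mul_one]
      linarith
    · right
      simp only [ne_eq, mul_eq_zero, hb0.ne', false_or, Real.sinh_eq_zero]
      exact ht
  have h3 := hd.clog_real hslit
  have h4 := (Complex.imCLM.hasFDerivAt (x := Complex.log (w t))).comp_hasDerivAt t h3
  have e1 : (branchAngle a x y) = fun t => (Complex.log (w t)).im := by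
    ext t; rw [Complex.log_im, hwt]; rfl
  rw [e1]
  refine h4.congr_deriv ?_
  have hn : Complex.normSq (w t) = (c * Real.cosh t - a) ^ 2 := by
    rw [← Complex.sq_norm, hwt, norm_branchComplex ha h t]
  rw [Complex.imCLM_apply, Complex.div_im, hn, hwt]
  simp only [Complex.add_re, Complex.add_im, Complex.ofReal_re, Complex.ofReal_im, Complex.mul_re,
    Complex.mul_im, Complex.I_re, Complex.I_im]
  have h5 := Real.cosh_sq t
  have hρ' := hρ.ne'
  rw [← sub_div, div_eq_div_iff (pow_ne_zero 2 hρ') hρ']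
  linear_combination (-(a * b) * (c * Real.cosh t - a)) * h5

lemma strictMono_branchAngle (ha : 0 ≤ a) (h : 2 * a < ‖y - x‖) :
    StrictMono (branchAngle a x y) := by
  refine strictMono_of_deriv_pos fun t => ?_
  rw [(hasDerivAt_branchAngle ha h t).deriv]
  exact div_pos (semiMinor_pos ha h) (focal_radius_pos ha h t)

/-- Every direction in which a ray from `x` meets the branch is attained. -/
lemma exists_branchAngle_eq (ha : 0 ≤ a) (h : 2 * a < ‖y - x‖) {τ ρ : ℝ}
    (hτ : τ ∈ Ioc (-Real.pi) Real.pi) (hρ : 0 < ρ)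
    (heq : ρ * (2 * a + ‖y - x‖ * Real.cos τ) * 2 = ‖y - x‖ ^ 2 - (2 * a) ^ 2) :
    ∃ t, branchAngle a x y t = τ := by
  set c := ‖y - x‖ / 2 with hc
  have hd : ‖y - x‖ = 2 * c := by rw [hc]; ring
  have hb0 := semiMinor_pos ha h
  have hb2 := semiMinor_sq ha h
  rw [← hc] at hb2
  set b := semiMinor a x y with hb
  have hca : a < c := by rw [hd] at h; linarith
  have hc0 : 0 < c := ha.trans_lt hca
  rw [hd] at heq
  have e1 : a * ρ + c * (ρ * Real.cos τ) = b ^ 2 := by rw [hb2]; linarith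
  -- The parameter is chosen to match the coordinate transverse to the axis; the polar equation and
  -- the positivity of `ρ + a` then give `c cosh t = ρ + a`, hence the other coordinate.
  have hsin : Real.sinh (Real.arsinh (ρ * Real.sin τ / b)) = ρ * Real.sin τ / b :=
    Real.sinh_arsinh _
  set t := Real.arsinh (ρ * Real.sin τ / b) with ht
  have hsin' : b * Real.sinh t = ρ * Real.sin τ := by rw [hsin]; field_simp
  have hch : c * Real.cosh t = ρ + a := by
    have h1 : (c * Real.cosh t) ^ 2 = (ρ + a) ^ 2 := by
      have h2 : b ^ 2 * (c * Real.cosh t) ^ 2 = b ^ 2 * (ρ + a) ^ 2 := by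
        have h3 : b ^ 2 * (c * Real.cosh t) ^ 2 = c ^ 2 * (b ^ 2 + (b * Real.sinh t) ^ 2) := by
          rw [mul_pow, Real.cosh_sq]; ring
        rw [h3, hsin']
        have h4 := Real.sin_sq_add_cos_sq τ
        have h5 : c * (ρ * Real.cos τ) = b ^ 2 - a * ρ := by linarith
        have h6 : (c * (ρ * Real.cos τ)) ^ 2 = (b ^ 2 - a * ρ) ^ 2 := by rw [h5]
        have h7 : c ^ 2 = b ^ 2 + a ^ 2 := by linarith
        have h8 : c ^ 2 * (ρ * Real.sin τ) ^ 2 = c ^ 2 * ρ ^ 2 - (b ^ 2 - a * ρ) ^ 2 := by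
          rw [← h6]; linear_combination c ^ 2 * ρ ^ 2 * h4
        rw [mul_add, h8, h7]; ring
      exact mul_left_cancel₀ (pow_pos hb0 2).ne' h2
    exact (pow_left_inj₀ (by have := Real.cosh_pos t; positivity) (by positivity)
      two_ne_zero).1 h1
  have hx : c - a * Real.cosh t = ρ * Real.cos τ := by
    have : c * (c - a * Real.cosh t) = c * (ρ * Real.cos τ) := by
      linear_combination -a * hch - e1 - hb2
    exact mul_left_cancel₀ hc0.ne' this
  refine ⟨t, ?_⟩
  rw [branchAngle, ← hc, ← hb, hx, hsin']
  have := Complex.arg_mul_cos_add_sin_mul_I hρ hτ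
  refine Eq.trans (congrArg Complex.arg ?_) this
  apply Complex.ext <;> simp [Complex.cos_ofReal_re, Complex.sin_ofReal_re]

lemma differentiableAt_hyperbolaCurve_left (ha : 0 ≤ a) (h : 2 * a < ‖y - x‖) (t : ℝ) :
    DifferentiableAt ℝ (fun z => hyperbolaCurve a z y t) x := by
  have hne := sub_ne_zero_of_foci ha h
  have hn : DifferentiableAt ℝ (fun z : Plane => ‖y - z‖) x :=
    DifferentiableAt.norm ℝ (by fun_prop) hne
  have hs : (‖y - x‖ / 2) ^ 2 - a ^ 2 ≠ 0 := by
    rw [← semiMinor_sq ha h]; exact (pow_pos (semiMinor_pos ha h) 2).ne'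
  have hax : DifferentiableAt ℝ (fun z : Plane => ‖y - z‖⁻¹ • (y - z)) x :=
    (hn.inv (norm_ne_zero_iff.2 hne)).smul (by fun_prop)
  have hb : DifferentiableAt ℝ (fun z : Plane => Real.sqrt ((‖y - z‖ / 2) ^ 2 - a ^ 2)) x :=
    DifferentiableAt.sqrt (by fun_prop) hs
  have hm : DifferentiableAt ℝ (fun z : Plane => midpoint ℝ z y) x := by
    simp only [midpoint_eq_smul_add]; fun_prop
  exact (hm.sub (hax.const_smul (a * Real.cosh t))).add
    ((hb.mul_const (Real.sinh t)).smul (rotCLM.differentiableAt.comp x hax))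

lemma differentiableAt_hyperbolaCurve_right (ha : 0 ≤ a) (h : 2 * a < ‖y - x‖) (t : ℝ) :
    DifferentiableAt ℝ (fun z => hyperbolaCurve a x z t) y := by
  have hne := sub_ne_zero_of_foci ha h
  have hn : DifferentiableAt ℝ (fun z : Plane => ‖z - x‖) y :=
    DifferentiableAt.norm ℝ (by fun_prop) hne
  have hs : (‖y - x‖ / 2) ^ 2 - a ^ 2 ≠ 0 := by
    rw [← semiMinor_sq ha h]; exact (pow_pos (semiMinor_pos ha h) 2).ne'
  have hax : DifferentiableAt ℝ (fun z : Plane => ‖z - x‖⁻¹ • (z - x)) y :=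
    (hn.inv (norm_ne_zero_iff.2 hne)).smul (by fun_prop)
  have hb : DifferentiableAt ℝ (fun z : Plane => Real.sqrt ((‖z - x‖ / 2) ^ 2 - a ^ 2)) y :=
    DifferentiableAt.sqrt (by fun_prop) hs
  have hm : DifferentiableAt ℝ (fun z : Plane => midpoint ℝ x z) y := by
    simp only [midpoint_eq_smul_add]; fun_prop
  exact (hm.sub (hax.const_smul (a * Real.cosh t))).add
    ((hb.mul_const (Real.sinh t)).smul (rotCLM.differentiableAt.comp y hax))

/-- The derivative of the branch when its foci move, in the direction normal to the branch. -/
lemma inner_deriv_branch {E : Type*} [NormedAddCommGroup E] [NormedSpace ℝ E] {p X Y : E → Plane}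
    {p' X' Y' : E →L[ℝ] Plane} {z : E} (hp : HasFDerivAt p p' z) (hX : HasFDerivAt X X' z)
    (hY : HasFDerivAt Y Y' z) (hpX : p z - X z ≠ 0) (hpY : p z - Y z ≠ 0) {s : ℝ}
    (hconst : ∀ᶠ w in 𝓝 z, ‖p w - Y w‖ - ‖p w - X w‖ = s) (h : E) :
    ⟪‖p z - X z‖⁻¹ • (p z - X z) + ‖p z - Y z‖⁻¹ • (Y z - p z), p' h⟫
      = ⟪‖p z - X z‖⁻¹ • (p z - X z), X' h⟫ + ⟪‖p z - Y z‖⁻¹ • (Y z - p z), Y' h⟫ := by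
  have h1 := HasFDerivAt.comp z (f := fun w => p w - X w) (hasFDerivAt_norm_plane hpX) (hp.sub hX)
  have h2 := HasFDerivAt.comp z (f := fun w => p w - Y w) (hasFDerivAt_norm_plane hpY) (hp.sub hY)
  have h3 := h2.sub h1
  have h4 : HasFDerivAt (fun _ : E => s) (0 : E →L[ℝ] ℝ) z := hasFDerivAt_const _ _
  have h5 := h4.congr_of_eventuallyEq hconst
  have h6 := congrArg (fun L : E →L[ℝ] ℝ => L h) (h3.unique h5)
  have e : Y z - p z = -(p z - Y z) := by abel
  simp only [sub_apply, ContinuousLinearMap.comp_apply, innerSL_apply_apply, zero_apply,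
    inner_sub_right] at h6
  rw [e, smul_neg, inner_add_left, inner_neg_left, inner_neg_left]
  linarith

end Hyperbola

/-! ### Outward normals of the cells -/

/-- A normal vector of the arc `j` of the cell of `i`. -/
def arcNormal (P : Network n) (q : Config n) (i j : Fin n) (θ : ℝ) : Plane :=
  if j = i then dir θ else (q j - q i) + (P.ru i + P.ru j) • dir θ

lemma arcPoint_sub (P : Network n) (q : Config n) (i j : Fin n) (θ : ℝ) :
    arcPoint P q i j θ - q i = arcRadius P q i j θ • dir θ := add_sub_cancel_left _ _

lemma inner_arcNormal_dir_pos {P : Network n} (hru : ∀ i, 0 ≤ P.ru i) {q : Config n}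
    (hq : Separated P q) {i j : Fin n} {θ : ℝ} (hρ : 0 < arcRadius P q i j θ) :
    0 < ⟪arcNormal P q i j θ, dir θ⟫ := by
  unfold arcNormal
  split_ifs with h
  · rw [inner_dir_self]; exact one_pos
  · rw [inner_add_left, real_inner_smul_left, inner_dir_self, mul_one, add_comm]
    exact headway_pos_of_arcRadius_pos hru hq h hρ

lemma arcNormal_ne_zero {P : Network n} (hru : ∀ i, 0 ≤ P.ru i) {q : Config n}
    (hq : Separated P q) {i j : Fin n} {θ : ℝ} (hρ : 0 < arcRadius P q i j θ) :
    arcNormal P q i j θ ≠ 0 := by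
  intro h
  have := inner_arcNormal_dir_pos hru hq hρ
  rw [h, inner_zero_left] at this
  exact lt_irrefl _ this

/-- The normal vector is the gradient of the constraint up to a positive factor, `1` on the circle
and `2` on a branch. -/
lemma exists_hasFDerivAt_con {P : Network n} {q : Config n} {i j : Fin n} {θ : ℝ}
    (hρ : 0 < arcRadius P q i j θ) :
    ∃ κ : ℝ, 0 < κ ∧ HasFDerivAt (con P i j q) (innerSL ℝ (κ • arcNormal P q i j θ))
      (arcPoint P q i j θ) := by
  have hn : ‖arcPoint P q i j θ - q i‖ = arcRadius P q i j θ := norm_ray _ hρ.le _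
  have hne : arcPoint P q i j θ - q i ≠ 0 := by
    rw [← norm_ne_zero_iff, hn]; exact hρ.ne'
  have hu : ‖arcPoint P q i j θ - q i‖⁻¹ • (arcPoint P q i j θ - q i) = dir θ := by
    rw [hn, arcPoint_sub, inv_smul_smul₀ hρ.ne']
  have hsub : HasFDerivAt (fun p : Plane => p - q i) (ContinuousLinearMap.id ℝ Plane)
      (arcPoint P q i j θ) := (hasFDerivAt_id _).sub_const (q i)
  have h1 := HasFDerivAt.comp _ (f := fun p : Plane => p - q i) (hasFDerivAt_norm_plane hne) hsub
  rw [hu] at h1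
  by_cases hji : j = i
  · refine ⟨1, one_pos, ?_⟩
    have e : con P i j q = fun p => ‖p - q i‖ - sensingRadius P i := by
      ext p; rw [hji, con_self]
    rw [e, arcNormal, if_pos hji, one_smul]
    exact h1.sub_const _
  · refine ⟨2, two_pos, ?_⟩
    have e : con P i j q = fun p => 2 * ⟪q j - q i, p - q i⟫
        + 2 * (P.ru i + P.ru j) * ‖p - q i‖
        + ((P.ru i + P.ru j) ^ 2 - ‖q j - q i‖ ^ 2) := by
      ext p; rw [con_eq_affine P hji, real_inner_comm]; ring
    have h2 := HasFDerivAt.comp _ (f := fun p : Plane => p - q i)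
      ((innerSL ℝ (q j - q i)).hasFDerivAt) hsub
    have h3 := ((h2.const_mul 2).add (h1.const_mul (2 * (P.ru i + P.ru j)))).add_const
      ((P.ru i + P.ru j) ^ 2 - ‖q j - q i‖ ^ 2)
    rw [e, arcNormal, if_neg hji]
    refine h3.congr_fderiv (ContinuousLinearMap.ext fun z => ?_)
    simp only [add_apply, smul_apply, ContinuousLinearMap.comp_apply, innerSL_apply_apply,
      ContinuousLinearMap.id_apply, smul_eq_mul, inner_add_left, real_inner_smul_left, smul_add]
    ring

/-- This is the gradient inequality of the convex constraint at a zero; here it follows from `⟪x - q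
i, dir θ⟫ ≤ ‖x - q i‖`. -/
lemma inner_arcNormal_nonpos {P : Network n} (hru : ∀ i, 0 ≤ P.ru i) {q : Config n}
    (hq : Separated P q) {i j : Fin n} {θ : ℝ} (hρ : 0 < arcRadius P q i j θ) {x : Plane}
    (hx : con P i j q x ≤ 0) : ⟪x - arcPoint P q i j θ, arcNormal P q i j θ⟫ ≤ 0 := by
  have hsplit : x - arcPoint P q i j θ = (x - q i) - arcRadius P q i j θ • dir θ := by
    rw [← arcPoint_sub]; abel
  have hcs : ⟪x - q i, dir θ⟫ ≤ ‖x - q i‖ := by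
    have := real_inner_le_norm (x - q i) (dir θ); rwa [norm_dir, mul_one] at this
  unfold arcNormal
  split_ifs with hji
  · subst hji
    rw [con_self] at hx
    rw [hsplit, inner_sub_left, real_inner_smul_left, inner_dir_self, mul_one, arcRadius_self]
    linarith
  · have h0 := con_arcPoint_self hru hq hρ
    rw [con_eq_affine P hji, arcPoint_sub, norm_smul, norm_dir, mul_one,
      Real.norm_of_nonneg hρ.le, real_inner_smul_left] at h0
    rw [con_eq_affine P hji] at hx
    have hs : 0 ≤ P.ru i + P.ru j := add_nonneg (hru i) (hru j)
    rw [hsplit]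
    generalize x - q i = v at *
    rw [inner_add_right, real_inner_smul_right, inner_sub_left, inner_sub_left,
      real_inner_smul_left, real_inner_smul_left, inner_dir_self]
    nlinarith [mul_le_mul_of_nonneg_left hcs hs]

lemma arcPoint_notMem_interior {P : Network n} (hru : ∀ i, 0 ≤ P.ru i) {q : Config n}
    (hq : Separated P q) {i j : Fin n} {θ : ℝ} (hρ : 0 < arcRadius P q i j θ) {T : Set Plane}
    (hT : ∀ p ∈ T, con P i j q p ≤ 0) : arcPoint P q i j θ ∉ interior T := by
  intro h
  have hc : ContinuousAt (fun ε : ℝ => arcPoint P q i j θ + ε • dir θ) 0 := by fun_prop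
  have hev : ∀ᶠ ε : ℝ in 𝓝 0, arcPoint P q i j θ + ε • dir θ ∈ T := by
    have hn : T ∈ 𝓝 (arcPoint P q i j θ + (0 : ℝ) • dir θ) := by
      rw [zero_smul, add_zero]; exact mem_interior_iff_mem_nhds.1 h
    exact hc.eventually_mem hn
  obtain ⟨ε, hε, hε0⟩ := ((hev.filter_mono nhdsWithin_le_nhds).and
    (self_mem_nhdsWithin : Ioi (0 : ℝ) ∈ 𝓝[>] 0)).exists
  have h1 := inner_arcNormal_nonpos hru hq hρ (hT _ hε)
  rw [add_sub_cancel_left, real_inner_smul_left, real_inner_comm] at h1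
  have := mul_pos (mem_Ioi.1 hε0) (inner_arcNormal_dir_pos hru hq hρ)
  linarith

/-- If the set contains a short step in every direction of the open half-plane `⟪z, A⟫ < 0`, its
supporting line at `p` is unique, so the choice made in `outwardNormal` is forced. -/
lemma outwardNormal_eq {S : Set Plane} {p A : Plane} (hA : A ≠ 0)
    (hsup : ∀ x ∈ S, ⟪x - p, A⟫ ≤ 0)
    (hin : ∀ z : Plane, ⟪z, A⟫ < 0 → ∃ ε : ℝ, 0 < ε ∧ p + ε • z ∈ S) :
    outwardNormal S p = ‖A‖⁻¹ • A := by
  have hA0 : 0 < ‖A‖ := norm_pos_iff.2 hA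
  have hex : ∃ v, IsOutwardUnitNormal S p v := by
    refine ⟨‖A‖⁻¹ • A, ?_, fun x hx => ?_⟩
    · rw [norm_smul, norm_inv, norm_norm, inv_mul_cancel₀ hA0.ne']
    · rw [real_inner_smul_right]
      exact mul_nonpos_of_nonneg_of_nonpos (by positivity) (hsup x hx)
  unfold outwardNormal
  rw [dif_pos hex]
  obtain ⟨hv1, hv2⟩ := hex.choose_spec
  set v := hex.choose
  have hneg : ∀ z : Plane, ⟪z, A⟫ < 0 → ⟪z, v⟫ ≤ 0 := by
    intro z hz
    obtain ⟨ε, hε, hmem⟩ := hin z hz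
    have := hv2 _ hmem
    rw [add_sub_cancel_left, real_inner_smul_left] at this
    exact nonpos_of_mul_nonpos_right this hε
  set k := ⟪v, A⟫ with hk
  have hk0 : 0 ≤ k := by
    have := hneg (-A) (by rw [inner_neg_left, real_inner_self_eq_norm_sq]; nlinarith)
    rw [inner_neg_left, real_inner_comm] at this
    linarith
  have hkA : ‖A‖ ≤ k := by
    by_contra hcon
    push Not at hcon
    have key : ∀ η : ℝ, 0 < η → ‖A‖ ^ 2 ≤ (k + η) * k := by
      intro η hη
      -- The test vector is `v` minus slightly more than its component along `A`, so its product
      -- with `A` is `-η`. For `η = ‖A‖ - k` the resulting inequality reads `‖A‖² ≤ ‖A‖ k`,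
      -- contradicting `k < ‖A‖`.
      have h1 := hneg (v - ((k + η) / ‖A‖ ^ 2) • A) (by
        rw [inner_sub_left, real_inner_smul_left, real_inner_self_eq_norm_sq,
          div_mul_cancel₀ _ (pow_pos hA0 2).ne', ← hk]
        linarith)
      rw [inner_sub_left, real_inner_smul_left, real_inner_self_eq_norm_sq, hv1,
        real_inner_comm, ← hk, one_pow, sub_nonpos, div_mul_eq_mul_div,
        le_div_iff₀ (pow_pos hA0 2), one_mul] at h1
      exact h1
    have h2 := key (‖A‖ - k) (by linarith)
    nlinarith
  have hkeq : k = ‖A‖ := le_antisymm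
    (by have := real_inner_le_norm v A; rwa [hv1, one_mul] at this) hkA
  have hzero : ‖v - ‖A‖⁻¹ • A‖ ^ 2 = 0 := by
    rw [norm_sub_sq_real, hv1, real_inner_smul_right, ← hk, hkeq, norm_smul, norm_inv, norm_norm,
      inv_mul_cancel₀ hA0.ne']
    norm_num
  rw [← sub_eq_zero, ← norm_eq_zero]
  exact pow_eq_zero_iff two_ne_zero |>.1 hzero

/-- At a generic point only constraint `j` is active and `Ω` is a neighbourhood, so a direction that
decreases constraint `j` to first order enters the cell. -/
lemma outwardNormal_gsvCell {P : Network n} (hru : ∀ i, 0 ≤ P.ru i) {q : Config n}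
    (hq : Separated P q) {i j : Fin n} {θ : ℝ} (hρ : 0 < arcRadius P q i j θ)
    (htie : ∀ k, k ≠ j → con P i k q (arcPoint P q i j θ) ≠ 0)
    (hmem : arcPoint P q i j θ ∈ gsvCell P q i) (hint : arcPoint P q i j θ ∈ interior P.Ω) :
    outwardNormal (gsvCell P q i) (arcPoint P q i j θ)
      = ‖arcNormal P q i j θ‖⁻¹ • arcNormal P q i j θ := by
  refine outwardNormal_eq (arcNormal_ne_zero hru hq hρ)
    (fun x hx => inner_arcNormal_nonpos hru hq hρ (((mem_gsvCell_iff hru hq i x).1 hx).2 j))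
    fun z hz => ?_
  set p := arcPoint P q i j θ with hp
  have hcp := ((mem_gsvCell_iff hru hq i p).1 hmem).2
  have hline : HasDerivAt (fun ε : ℝ => p + ε • z) z 0 := by
    simpa using ((hasDerivAt_id (0 : ℝ)).smul_const z).const_add p
  have hline0 : p + (0 : ℝ) • z = p := by rw [zero_smul, add_zero]
  have htend : Tendsto (fun ε : ℝ => p + ε • z) (𝓝[>] 0) (𝓝 p) := by
    have := hline.continuousAt.tendsto
    rw [hline0] at this
    exact this.mono_left nhdsWithin_le_nhds
  obtain ⟨κ, hκ, hd⟩ := exists_hasFDerivAt_con (P := P) (q := q) hρ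
  have hj : ∀ᶠ ε : ℝ in 𝓝[>] 0, con P i j q (p + ε • z) ≤ 0 := by
    have h1 : HasDerivAt (fun ε : ℝ => con P i j q (p + ε • z))
        (innerSL ℝ (κ • arcNormal P q i j θ) z) 0 := by
      refine HasFDerivAt.comp_hasDerivAt (0 : ℝ) (l := con P i j q) ?_ hline
      rw [hline0]; exact hd
    have hneg : innerSL ℝ (κ • arcNormal P q i j θ) z < 0 := by
      rw [innerSL_apply_apply, real_inner_smul_left, real_inner_comm]
      exact mul_neg_of_pos_of_neg hκ hz
    have h2 := hasDerivAt_iff_tendsto_slope.1 h1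
    have h3 : ∀ᶠ ε : ℝ in 𝓝[>] 0, slope (fun ε : ℝ => con P i j q (p + ε • z)) 0 ε < 0 :=
      (h2.eventually_lt_const hneg).filter_mono
        (nhdsWithin_mono _ fun x hx => (mem_Ioi.1 hx).ne')
    filter_upwards [h3, self_mem_nhdsWithin] with ε hε hε0
    have h0 : con P i j q p = 0 := con_arcPoint_self hru hq hρ
    rw [slope_def_field, hline0, h0, sub_zero, sub_zero, div_lt_iff₀ (mem_Ioi.1 hε0),
      zero_mul] at hε
    exact hε.le
  have hk : ∀ᶠ ε : ℝ in 𝓝[>] 0, ∀ k, con P i k q (p + ε • z) ≤ 0 := by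
    refine eventually_all.2 fun k => ?_
    by_cases hkj : k = j
    · rw [hkj]; exact hj
    · have hlt : con P i k q p < 0 := lt_of_le_of_ne (hcp k) (htie k hkj)
      have := ((continuous_con_right P i k q).tendsto p).comp htend
      exact (this.eventually_lt_const hlt).mono fun ε h => h.le
  have hΩ : ∀ᶠ ε : ℝ in 𝓝[>] 0, p + ε • z ∈ P.Ω :=
    htend.eventually (mem_interior_iff_mem_nhds.1 hint)
  obtain ⟨ε, ⟨h1, h2⟩, h3⟩ := ((hk.and hΩ).and self_mem_nhdsWithin).exists
  exact ⟨ε, h3, (mem_gsvCell_iff hru hq i _).2 ⟨h2, h1⟩⟩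

lemma arcPoint_mem_frontier_iff {P : Network n} (hru : ∀ i, 0 ≤ P.ru i) (hΩ : IsClosed P.Ω)
    {q : Config n} (hq : Separated P q) {i j : Fin n} {θ : ℝ} (hρ : 0 < arcRadius P q i j θ) :
    arcPoint P q i j θ ∈ frontier (gsvCell P q i) ↔ arcPoint P q i j θ ∈ gsvCell P q i := by
  rw [(isClosed_gsvCell hru hΩ hq i).frontier_eq]
  exact ⟨fun h => h.1, fun h => ⟨h, arcPoint_notMem_interior hru hq hρ fun p hp =>
    ((mem_gsvCell_iff hru hq i p).1 hp).2 j⟩⟩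

/-! ### The circular arcs -/

lemma norm_deriv_circleCurve (c : Plane) (R θ : ℝ) : ‖deriv (circleCurve c R) θ‖ = |R| := by
  have hd : HasDerivAt dir (rot (dir θ)) θ := by
    have h1 : HasDerivAt (fun θ => Real.cos θ • (!₂[1, 0] : Plane) + Real.sin θ • (!₂[0, 1] : Plane))
        (-Real.sin θ • (!₂[1, 0] : Plane) + Real.cos θ • (!₂[0, 1] : Plane)) θ :=
      ((Real.hasDerivAt_cos θ).smul_const _).add ((Real.hasDerivAt_sin θ).smul_const _)
    have e1 : dir = fun θ => Real.cos θ • (!₂[1, 0] : Plane) + Real.sin θ • (!₂[0, 1] : Plane) := by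
      ext1 θ; apply plane_ext <;> simp
    rw [e1]
    refine h1.congr_deriv ?_
    apply plane_ext <;> simp
  have h2 : HasDerivAt (circleCurve c R) (R • rot (dir θ)) θ := (hd.const_smul R).const_add c
  have h3 : ‖rot (dir θ)‖ ^ 2 = 1 := by
    rw [norm_sq_eq]; simp
  have h4 : ‖rot (dir θ)‖ = 1 := by nlinarith [norm_nonneg (rot (dir θ))]
  rw [h2.deriv, norm_smul, h4, mul_one, Real.norm_eq_abs]

lemma circleTerm_eq {P : Network n} (hru : ∀ i, 0 ≤ P.ru i) (hΩ : IsCompact P.Ω)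
    (hconv : Convex ℝ P.Ω) {q : Config n} (hq : Admissible P q) (i : Fin n) :
    circleTerm P q i = ∫ θ in Ioc (-Real.pi) Real.pi, nearWeight P q i i θ := by
  unfold circleTerm lineIntegral
  rcases le_or_gt (sensingRadius P i) 0 with hR | hR
  · have h1 : ∀ θ, nearWeight P q i i θ = 0 := fun θ =>
      (weights_eq_zero_of_arcDensity (arcDensity_eq_zero_of_radius hR q i θ)).1
    simp only [h1, integral_zero]
    -- A negative radius leaves no point on the circle; for radius zero the speed of the
    -- parametrization vanishes.
    rcases hR.lt_or_eq with hR | hR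
    · have : {t ∈ Ioc (-Real.pi) Real.pi | circleCurve (q i) (sensingRadius P i) t
          ∈ frontier (gsvCell P q i) ∩ sensingCircle P q i} = ∅ := by
        refine eq_empty_of_forall_notMem fun t ht => ?_
        have h2 : ‖_‖ = sensingRadius P i := ht.2.2
        have := norm_nonneg (circleCurve (q i) (sensingRadius P i) t - q i)
        linarith
      rw [this, setIntegral_empty]
    · simp only [norm_deriv_circleCurve, hR, abs_zero, zero_smul, integral_zero]
  · have hsep := hq.separated
    have hρ : ∀ θ, 0 < arcRadius P q i i θ := fun θ => by rw [arcRadius_self]; exact hR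
    have hset : {t ∈ Ioc (-Real.pi) Real.pi | circleCurve (q i) (sensingRadius P i) t
        ∈ frontier (gsvCell P q i) ∩ sensingCircle P q i}
        = Ioc (-Real.pi) Real.pi ∩ {θ | 0 < arcRadius P q i i θ ∧
            arcPoint P q i i θ ∈ gsvCell P q i} := by
      ext θ
      simp only [circleCurve_eq, mem_ofPred_eq, mem_inter_iff,
        arcPoint_mem_frontier_iff hru hΩ.isClosed hsep (hρ θ)]
      refine and_congr_right fun _ => ⟨fun h => ⟨hρ θ, h.1⟩, fun h => ⟨h.2, ?_⟩⟩
      have := norm_ray (q i) (hρ θ).le θ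
      rw [arcRadius_self] at this
      rw [sensingCircle, mem_ofPred_eq, arcPoint, arcRadius_self]
      exact this
    have hmeas := measurableSet_active hru hΩ hsep i i
    rw [hset, ← setIntegral_indicator hmeas]
    refine integral_congr_ae ?_
    filter_upwards [ae_generic hru hconv hq i] with θ hθ
    by_cases hmem : arcPoint P q i i θ ∈ gsvCell P q i
    · rw [indicator_of_mem (show θ ∈ {θ | 0 < arcRadius P q i i θ ∧
        arcPoint P q i i θ ∈ gsvCell P q i} from ⟨hρ θ, hmem⟩)]
      obtain ⟨htie, hint⟩ := hθ i (hρ θ)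
      rw [norm_deriv_circleCurve, abs_of_pos hR, circleCurve_eq,
        outwardNormal_gsvCell hru hsep (hρ θ) htie hmem (hint hmem), arcNormal, if_pos rfl,
        norm_dir, inv_one, one_smul, smul_smul, nearWeight, if_pos rfl, mul_one, arcDensity,
        if_pos ⟨hρ θ, hmem⟩, arcRadius_self]
    · rw [indicator_of_notMem fun h => hmem h.2, nearWeight, arcDensity,
        if_neg fun h => hmem h.2, zero_mul, zero_smul]

/-! ### The hyperbolic arcs -/

lemma semiMajor_nonneg {P : Network n} (hru : ∀ i, 0 ≤ P.ru i) (i j : Fin n) :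
    0 ≤ semiMajor P i j := by
  have := hru i; have := hru j; unfold semiMajor; positivity

lemma two_mul_semiMajor (P : Network n) (i j : Fin n) :
    2 * semiMajor P i j = P.ru i + P.ru j := by
  unfold semiMajor; ring

lemma Separated.two_mul_semiMajor_lt {P : Network n} {q : Config n} (hq : Separated P q)
    {i j : Fin n} (hji : j ≠ i) : 2 * semiMajor P i j < ‖q j - q i‖ := by
  rw [two_mul_semiMajor, norm_sub_rev]; exact hq i j hji.symm

lemma exists_axis_eq_dir {x y : Plane} (h : y - x ≠ 0) : ∃ β, axis x y = dir β := by
  obtain ⟨β, hβ⟩ := exists_smul_dir (axis x y)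
  exact ⟨β, by rw [hβ, norm_axis h, one_smul]⟩

/-- Direction, from the agent `i`, of the point with parameter `t` on the branch towards `j`, when
the axis has the direction `β`. -/
def branchDir (P : Network n) (q : Config n) (i j : Fin n) (β t : ℝ) : ℝ :=
  β + branchAngle (semiMajor P i j) (q i) (q j) t

lemma arcRadius_branchDir {P : Network n} (hru : ∀ i, 0 ≤ P.ru i) {q : Config n}
    (hq : Separated P q) {i j : Fin n} (hji : j ≠ i) {β : ℝ} (hβ : axis (q i) (q j) = dir β)
    (t : ℝ) : arcRadius P q i j (branchDir P q i j β t)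
      = ‖q j - q i‖ / 2 * Real.cosh t - semiMajor P i j := by
  have ha := semiMajor_nonneg hru i j
  have h := hq.two_mul_semiMajor_lt hji
  symm
  refine eq_arcRadius_of_con_eq_zero hru hq (focal_radius_pos ha h t) ?_
  rw [branchDir, ← hyperbolaCurve_polar ha h hβ, con_of_ne P hji,
    norm_hyperbolaCurve_sub_left ha h, norm_hyperbolaCurve_sub_right ha h, ← two_mul_semiMajor]
  ring

lemma arcRadius_branchDir_pos {P : Network n} (hru : ∀ i, 0 ≤ P.ru i) {q : Config n}
    (hq : Separated P q) {i j : Fin n} (hji : j ≠ i) {β : ℝ} (hβ : axis (q i) (q j) = dir β)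
    (t : ℝ) : 0 < arcRadius P q i j (branchDir P q i j β t) := by
  rw [arcRadius_branchDir hru hq hji hβ]
  exact focal_radius_pos (semiMajor_nonneg hru i j) (hq.two_mul_semiMajor_lt hji) t

lemma branch_eq_arcPoint {P : Network n} (hru : ∀ i, 0 ≤ P.ru i) {q : Config n}
    (hq : Separated P q) {i j : Fin n} (hji : j ≠ i) {β : ℝ} (hβ : axis (q i) (q j) = dir β)
    (t : ℝ) : branch P q i j t = arcPoint P q i j (branchDir P q i j β t) := by
  rw [arcPoint, arcRadius_branchDir hru hq hji hβ, branch, branchDir,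
    ← hyperbolaCurve_polar (semiMajor_nonneg hru i j) (hq.two_mul_semiMajor_lt hji) hβ]

/-- `branchAngle` is a principal argument, whence the window of length `2π` centred at the direction
`β` of the axis. Every direction in it with an arc point in the cell is attained, by the polar
equation. -/
lemma image_branchDir {P : Network n} (hru : ∀ i, 0 ≤ P.ru i) {q : Config n}
    (hq : Separated P q) {i j : Fin n} (hji : j ≠ i) {β : ℝ} (hβ : axis (q i) (q j) = dir β) :
    branchDir P q i j β '' {t | branch P q i j t ∈ gsvCell P q i}
      = Ioc (β - Real.pi) (β + Real.pi) ∩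
        {θ | 0 < arcRadius P q i j θ ∧ arcPoint P q i j θ ∈ gsvCell P q i} := by
  have ha := semiMajor_nonneg hru i j
  have h := hq.two_mul_semiMajor_lt hji
  apply Subset.antisymm
  · rintro _ ⟨t, ht, rfl⟩
    rw [mem_ofPred_eq, branch_eq_arcPoint hru hq hji hβ] at ht
    refine ⟨?_, arcRadius_branchDir_pos hru hq hji hβ t, ht⟩
    have := Complex.arg_mem_Ioc (⟨‖q j - q i‖ / 2 - semiMajor P i j * Real.cosh t,
      semiMinor (semiMajor P i j) (q i) (q j) * Real.sinh t⟩ : ℂ)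
    unfold branchDir branchAngle
    exact ⟨by linarith [this.1], by linarith [this.2]⟩
  · rintro θ ⟨hI, hρ, hmem⟩
    have e := two_mul_arcRadius_mul_headway hru hq hji hρ
    have hcos : ⟪q j - q i, dir θ⟫ = ‖q j - q i‖ * Real.cos (θ - β) := by
      conv_lhs => rw [← smul_axis (hq.ne hru hji)]
      rw [real_inner_smul_left, hβ, inner_eq, Real.cos_sub]
      simp only [dir_zero, dir_one]
      ring
    obtain ⟨t, ht⟩ := exists_branchAngle_eq ha h (τ := θ - β)
      ⟨by linarith [hI.1], by linarith [hI.2]⟩ hρ (by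
        rw [two_mul_semiMajor, ← hcos, ← e, headway]; ring)
    have htθ : branchDir P q i j β t = θ := by rw [branchDir, ht]; ring
    refine ⟨t, ?_, htθ⟩
    rw [mem_ofPred_eq, branch_eq_arcPoint hru hq hji hβ, htθ]
    exact hmem

lemma hasDerivAt_branchDir {P : Network n} (hru : ∀ i, 0 ≤ P.ru i) {q : Config n}
    (hq : Separated P q) {i j : Fin n} (hji : j ≠ i) {β : ℝ} (hβ : axis (q i) (q j) = dir β)
    (t : ℝ) : HasDerivAt (branchDir P q i j β) (semiMinor (semiMajor P i j) (q i) (q j)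
      / arcRadius P q i j (branchDir P q i j β t)) t := by
  rw [arcRadius_branchDir hru hq hji hβ]
  exact (hasDerivAt_branchAngle (semiMajor_nonneg hru i j)
    (hq.two_mul_semiMajor_lt hji) t).const_add β

lemma injective_branchDir {P : Network n} (hru : ∀ i, 0 ≤ P.ru i) {q : Config n}
    (hq : Separated P q) {i j : Fin n} (hji : j ≠ i) (β : ℝ) :
    Function.Injective (branchDir P q i j β) := fun _ _ h =>
  (strictMono_branchAngle (semiMajor_nonneg hru i j) (hq.two_mul_semiMajor_lt hji)).injective
    (add_left_cancel h)

lemma continuous_branch (P : Network n) (q : Config n) (i j : Fin n) :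
    Continuous (branch P q i j) :=
  continuous_iff_continuousAt.2 fun t => (hasDerivAt_hyperbolaCurve t).continuousAt

/-- Change of variables between the direction and the parameter of the branch. -/
lemma integral_direction_eq {P : Network n} (hru : ∀ i, 0 ≤ P.ru i) (hΩ : IsCompact P.Ω)
    {q : Config n} (hq : Separated P q) {i j : Fin n} (hji : j ≠ i) {β : ℝ}
    (hβ : axis (q i) (q j) = dir β) {W : ℝ → Plane} (hper : Function.Periodic W (2 * Real.pi))
    (hW : ∀ θ, ¬ (0 < arcRadius P q i j θ ∧ arcPoint P q i j θ ∈ gsvCell P q i) → W θ = 0) :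
    ∫ θ in Ioc (-Real.pi) Real.pi, W θ
      = ∫ t in {t | branch P q i j t ∈ gsvCell P q i},
          (semiMinor (semiMajor P i j) (q i) (q j)
            / arcRadius P q i j (branchDir P q i j β t)) • W (branchDir P q i j β t) := by
  have hS : MeasurableSet {t | branch P q i j t ∈ gsvCell P q i} :=
    ((isClosed_gsvCell hru hΩ.isClosed hq i).preimage (continuous_branch P q i j)).measurableSet
  have hb := semiMinor_pos (semiMajor_nonneg hru i j) (hq.two_mul_semiMajor_lt hji)
  have h1 := integral_image_eq_integral_abs_deriv_smul hS
    (fun t _ => (hasDerivAt_branchDir hru hq hji hβ t).hasDerivWithinAt)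
    (injective_branchDir hru hq hji β).injOn W
  have h2 : ∫ θ in Ioc (-Real.pi) Real.pi, W θ = ∫ θ in Ioc (β - Real.pi) (β + Real.pi), W θ := by
    have h3 := hper.intervalIntegral_add_eq (-Real.pi) (β - Real.pi)
    have e1 : -Real.pi + 2 * Real.pi = Real.pi := by ring
    have e2 : β - Real.pi + 2 * Real.pi = β + Real.pi := by ring
    rw [e1, e2, intervalIntegral.integral_of_le (by linarith [Real.pi_pos]),
      intervalIntegral.integral_of_le (by linarith [Real.pi_pos])] at h3
    exact h3
  have h3 : ∫ θ in Ioc (β - Real.pi) (β + Real.pi), W θ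
      = ∫ θ in branchDir P q i j β '' {t | branch P q i j t ∈ gsvCell P q i}, W θ := by
    rw [image_branchDir hru hq hji hβ]
    refine setIntegral_eq_of_subset_of_forall_sdiff_eq_zero measurableSet_Ioc inter_subset_left ?_
    rintro θ ⟨h1, h2⟩
    exact hW θ fun h => h2 ⟨h1, h⟩
  rw [h2, h3, h1]
  refine setIntegral_congr_fun hS fun t _ => ?_
  rw [abs_of_pos (div_pos hb (arcRadius_branchDir_pos hru hq hji hβ t))]

lemma arc_periodic (P : Network n) (q : Config n) (i j : Fin n) (θ : ℝ) :
    headway P q i j (θ + 2 * Real.pi) = headway P q i j θ ∧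
    arcRadius P q i j (θ + 2 * Real.pi) = arcRadius P q i j θ ∧
    arcPoint P q i j (θ + 2 * Real.pi) = arcPoint P q i j θ ∧
    arcDensity P q i j (θ + 2 * Real.pi) = arcDensity P q i j θ := by
  have h1 : headway P q i j (θ + 2 * Real.pi) = headway P q i j θ := by
    simp only [headway, dir_add_two_pi]
  have h2 : arcRadius P q i j (θ + 2 * Real.pi) = arcRadius P q i j θ := by
    simp only [arcRadius, h1]
  have h3 : arcPoint P q i j (θ + 2 * Real.pi) = arcPoint P q i j θ := by
    simp only [arcPoint, h2, dir_add_two_pi]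
  exact ⟨h1, h2, h3, by unfold arcDensity; rw [h2, h3]⟩

lemma periodic_nearWeight (P : Network n) (q : Config n) (i j : Fin n) :
    Function.Periodic (nearWeight P q i j) (2 * Real.pi) := fun θ => by
  obtain ⟨h1, h2, -, h4⟩ := arc_periodic P q i j θ
  simp only [nearWeight, h1, h2, h4, dir_add_two_pi]

lemma periodic_farWeight (P : Network n) (q : Config n) (i j : Fin n) :
    Function.Periodic (farWeight P q i j) (2 * Real.pi) := fun θ => by
  obtain ⟨h1, -, h3, h4⟩ := arc_periodic P q i j θ
  simp only [farWeight, h1, h3, h4]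

lemma arcNormal_eq {P : Network n} {q : Config n} {i j : Fin n} (hji : j ≠ i) (θ : ℝ) :
    arcNormal P q i j θ = (arcRadius P q i j θ + (P.ru i + P.ru j)) • dir θ
      + (q j - arcPoint P q i j θ) := by
  rw [arcNormal, if_neg hji, arcPoint]
  module

/-- The line element of the branch in terms of the normal vector. -/
lemma norm_deriv_branch {P : Network n} (hru : ∀ i, 0 ≤ P.ru i) {q : Config n}
    (hq : Separated P q) {i j : Fin n} (hji : j ≠ i) {β : ℝ} (hβ : axis (q i) (q j) = dir β)
    (t : ℝ) : ‖deriv (branch P q i j) t‖ * headway P q i j (branchDir P q i j β t)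
      = semiMinor (semiMajor P i j) (q i) (q j)
        * ‖arcNormal P q i j (branchDir P q i j β t)‖ := by
  have ha := semiMajor_nonneg hru i j
  have h := hq.two_mul_semiMajor_lt hji
  have hb := semiMinor_pos ha h
  have hb2 := semiMinor_sq ha h
  have hρ := arcRadius_branchDir_pos hru hq hji hβ t
  have hσ := headway_pos_of_arcRadius_pos hru hq hji hρ
  have e := two_mul_arcRadius_mul_headway hru hq hji hρ
  have hr := arcRadius_branchDir hru hq hji hβ t
  have hsp := norm_sq_deriv_hyperbolaCurve ha h t
  have hN : ‖arcNormal P q i j (branchDir P q i j β t)‖ ^ 2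
      = ‖q j - q i‖ ^ 2 + (P.ru i + P.ru j) ^ 2
        + 2 * (P.ru i + P.ru j) * (headway P q i j (branchDir P q i j β t)
          - (P.ru i + P.ru j)) := by
    rw [arcNormal, if_neg hji, norm_add_sq_real, norm_smul, norm_dir, mul_one,
      real_inner_smul_right, headway, Real.norm_of_nonneg (add_nonneg (hru i) (hru j))]
    ring
  rw [← two_mul_semiMajor] at e hN
  rw [← hr] at hsp
  change ‖deriv (branch P q i j) t‖ ^ 2 = _ at hsp
  set θ := branchDir P q i j β t
  set a := semiMajor P i j
  set b := semiMinor a (q i) (q j)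
  set ρ := arcRadius P q i j θ
  set σ := headway P q i j θ
  set d := ‖q j - q i‖
  have hch : d / 2 * Real.cosh t = ρ + a := by linarith
  rw [hch] at hsp
  have e2 : ρ * σ = 2 * b ^ 2 := by rw [hb2]; linarith
  -- With `P.ru i + P.ru j = 2a` the ingredients are `‖γ'‖² = ρ (ρ + 2a)`, `ρ σ = 2 b²` and `d² = 4
  -- (a² + b²)`.
  have key : (‖deriv (branch P q i j) t‖ * σ) ^ 2 = (b * ‖arcNormal P q i j θ‖) ^ 2 := by
    rw [mul_pow, mul_pow, hsp, hN]
    have h4 : d ^ 2 = 4 * (b ^ 2 + a ^ 2) := by rw [hb2]; ring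
    rw [h4]
    linear_combination (σ * (ρ + 2 * a)) * e2 - (-2) * b ^ 2 * e2
  exact (pow_left_inj₀ (mul_nonneg (norm_nonneg _) hσ.le) (mul_nonneg hb.le (norm_nonneg _))
    two_ne_zero).1 key

/-- The equation `‖p - q j‖ - ‖p - q i‖ = 2a` persists as `q i` moves at fixed `t`. Differentiating
it determines the component of the velocity along `N`, although the tangential component depends on
the parametrization. -/
lemma transposedJacobian_near {P : Network n} (hru : ∀ i, 0 ≤ P.ru i) {q : Config n}
    (hq : Separated P q) {i j : Fin n} (hji : j ≠ i) {β : ℝ} (hβ : axis (q i) (q j) = dir β)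
    (t : ℝ) : transposedJacobian P q i i j t (arcNormal P q i j (branchDir P q i j β t))
      = (arcRadius P q i j (branchDir P q i j β t) + (P.ru i + P.ru j))
        • dir (branchDir P q i j β t) := by
  have ha := semiMajor_nonneg hru i j
  have h := hq.two_mul_semiMajor_lt hji
  have hρ := arcRadius_branchDir_pos hru hq hji hβ t
  have hbr := branch_eq_arcPoint hru hq hji hβ t
  set θ := branchDir P q i j β t
  have hfun : (fun x : Plane => branch P (Function.update q i x) i j t)
      = fun x => hyperbolaCurve (semiMajor P i j) x (q j) t := by
    ext1 x; simp [branch, Function.update_of_ne hji]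
  refine ext_inner_right ℝ fun v => ?_
  rw [transposedJacobian, hfun, ContinuousLinearMap.adjoint_inner_left]
  have hd := (differentiableAt_hyperbolaCurve_left ha h t).hasFDerivAt
  have hfar := norm_far_vector hru hq hji hρ
  have hs : 0 ≤ P.ru i + P.ru j := add_nonneg (hru i) (hru j)
  have hpX : hyperbolaCurve (semiMajor P i j) (q i) (q j) t - q i
      = arcRadius P q i j θ • dir θ := by
    rw [← arcPoint_sub, ← hbr]; rfl
  have hpY : hyperbolaCurve (semiMajor P i j) (q i) (q j) t = arcPoint P q i j θ := hbr
  have hnX : ‖hyperbolaCurve (semiMajor P i j) (q i) (q j) t - q i‖ = arcRadius P q i j θ := by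
    rw [hpX, norm_smul, norm_dir, mul_one, Real.norm_of_nonneg hρ.le]
  have hnY : ‖hyperbolaCurve (semiMajor P i j) (q i) (q j) t - q j‖
      = arcRadius P q i j θ + (P.ru i + P.ru j) := by
    rw [hpY, norm_sub_rev, hfar]
  have hN0 : 0 < arcRadius P q i j θ + (P.ru i + P.ru j) := by positivity
  have hconst : ∀ᶠ x in 𝓝 (q i), ‖hyperbolaCurve (semiMajor P i j) x (q j) t - q j‖
      - ‖hyperbolaCurve (semiMajor P i j) x (q j) t - x‖ = 2 * semiMajor P i j := by
    have hc : ContinuousAt (fun x : Plane => ‖q j - x‖) (q i) := by fun_prop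
    filter_upwards [hc.eventually_const_lt h] with x hx
    rw [norm_hyperbolaCurve_sub_left ha hx, norm_hyperbolaCurve_sub_right ha hx]
    ring
  have key := inner_deriv_branch hd (hasFDerivAt_id (q i)) (hasFDerivAt_const (q j) (q i))
    (by rw [← norm_ne_zero_iff, id_eq, hnX]; exact hρ.ne')
    (by rw [← norm_ne_zero_iff, hnY]; exact hN0.ne') hconst v
  simp only [id_eq, hnX, hnY, ContinuousLinearMap.id_apply, zero_apply, inner_zero_right,
    add_zero] at key
  rw [hpX, inv_smul_smul₀ hρ.ne', hpY] at key
  rw [arcNormal_eq hji, real_inner_smul_left, ← key, ← real_inner_smul_left, smul_add,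
    smul_inv_smul₀ hN0.ne']

lemma transposedJacobian_far {P : Network n} (hru : ∀ i, 0 ≤ P.ru i) {q : Config n}
    (hq : Separated P q) {i j : Fin n} (hji : j ≠ i) {β : ℝ} (hβ : axis (q i) (q j) = dir β)
    (t : ℝ) : transposedJacobian P q j i j t (arcNormal P q i j (branchDir P q i j β t))
      = q j - arcPoint P q i j (branchDir P q i j β t) := by
  have ha := semiMajor_nonneg hru i j
  have h := hq.two_mul_semiMajor_lt hji
  have hρ := arcRadius_branchDir_pos hru hq hji hβ t
  have hbr := branch_eq_arcPoint hru hq hji hβ t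
  set θ := branchDir P q i j β t
  have hfun : (fun x : Plane => branch P (Function.update q j x) i j t)
      = fun x => hyperbolaCurve (semiMajor P i j) (q i) x t := by
    ext1 x; simp [branch, Function.update_of_ne hji.symm]
  refine ext_inner_right ℝ fun v => ?_
  rw [transposedJacobian, hfun, ContinuousLinearMap.adjoint_inner_left]
  have hd := (differentiableAt_hyperbolaCurve_right ha h t).hasFDerivAt
  have hfar := norm_far_vector hru hq hji hρ
  have hs : 0 ≤ P.ru i + P.ru j := add_nonneg (hru i) (hru j)
  have hpX : hyperbolaCurve (semiMajor P i j) (q i) (q j) t - q i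
      = arcRadius P q i j θ • dir θ := by
    rw [← arcPoint_sub, ← hbr]; rfl
  have hpY : hyperbolaCurve (semiMajor P i j) (q i) (q j) t = arcPoint P q i j θ := hbr
  have hnX : ‖hyperbolaCurve (semiMajor P i j) (q i) (q j) t - q i‖ = arcRadius P q i j θ := by
    rw [hpX, norm_smul, norm_dir, mul_one, Real.norm_of_nonneg hρ.le]
  have hnY : ‖hyperbolaCurve (semiMajor P i j) (q i) (q j) t - q j‖
      = arcRadius P q i j θ + (P.ru i + P.ru j) := by
    rw [hpY, norm_sub_rev, hfar]
  have hN0 : 0 < arcRadius P q i j θ + (P.ru i + P.ru j) := by positivity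
  have hconst : ∀ᶠ y in 𝓝 (q j), ‖hyperbolaCurve (semiMajor P i j) (q i) y t - y‖
      - ‖hyperbolaCurve (semiMajor P i j) (q i) y t - q i‖ = 2 * semiMajor P i j := by
    have hc : ContinuousAt (fun y : Plane => ‖y - q i‖) (q j) := by fun_prop
    filter_upwards [hc.eventually_const_lt h] with y hy
    rw [norm_hyperbolaCurve_sub_left ha hy, norm_hyperbolaCurve_sub_right ha hy]
    ring
  have key := inner_deriv_branch hd (hasFDerivAt_const (q i) (q j)) (hasFDerivAt_id (q j))
    (by rw [← norm_ne_zero_iff, hnX]; exact hρ.ne')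
    (by rw [← norm_ne_zero_iff, id_eq, hnY]; exact hN0.ne') hconst v
  simp only [id_eq, hnX, hnY, ContinuousLinearMap.id_apply, zero_apply, inner_zero_right,
    zero_add] at key
  rw [hpX, inv_smul_smul₀ hρ.ne', hpY] at key
  have h1 : arcNormal P q i j θ = (arcRadius P q i j θ + (P.ru i + P.ru j)) • (dir θ
      + (arcRadius P q i j θ + (P.ru i + P.ru j))⁻¹ • (q j - arcPoint P q i j θ)) := by
    rw [arcNormal_eq hji, smul_add, smul_inv_smul₀ hN0.ne']
  rw [h1, real_inner_smul_left, key, ← real_inner_smul_left, smul_inv_smul₀ hN0.ne']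

/-- Form common to both agents `k`: normalizing `N` cancels against the line element and leaves the
factor `b / headway`. -/
lemma hyperbolaTerm_eq_integral {P : Network n} (hru : ∀ i, 0 ≤ P.ru i) (hΩ : IsCompact P.Ω)
    (hconv : Convex ℝ P.Ω) {q : Config n} (hq : Admissible P q) {i j : Fin n} (hji : j ≠ i)
    {β : ℝ} (hβ : axis (q i) (q j) = dir β) (k : Fin n) :
    hyperbolaTerm P q k i j = ∫ t in {t | branch P q i j t ∈ gsvCell P q i},
      ((semiMinor (semiMajor P i j) (q i) (q j)
        / headway P q i j (branchDir P q i j β t)) * P.φ (branch P q i j t))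
        • transposedJacobian P q k i j t (arcNormal P q i j (branchDir P q i j β t)) := by
  have hsep := hq.separated
  have hset : {t ∈ univ | branch P q i j t ∈ frontier (gsvCell P q i) ∩ hyperbolicArc P q i j}
      = {t | branch P q i j t ∈ gsvCell P q i} := by
    ext t
    have hρ := arcRadius_branchDir_pos hru hsep hji hβ t
    have hfr := arcPoint_mem_frontier_iff hru hΩ.isClosed hsep hρ
    have hbr := branch_eq_arcPoint hru hsep hji hβ t
    rw [← hbr] at hfr
    simp only [mem_univ, true_and, mem_ofPred_eq, mem_inter_iff, hfr]
    refine ⟨fun h => h.1, fun h => ⟨h, gsvCell_subset P q i h, ?_⟩⟩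
    have h1 := norm_far_vector hru hsep hji hρ
    rw [norm_sub_rev] at h1
    rw [hbr, h1, arcPoint, norm_ray _ hρ.le]
    ring
  have hS : MeasurableSet {t | branch P q i j t ∈ gsvCell P q i} :=
    ((isClosed_gsvCell hru hΩ.isClosed hsep i).preimage (continuous_branch P q i j)).measurableSet
  unfold hyperbolaTerm lineIntegral
  rw [hset]
  refine setIntegral_congr_ae hS ?_
  -- The direction is an injective function of the parameter, so countably many bad directions mean
  -- countably many bad parameters; corners and their arbitrary normals play no role.
  have hbad := ((countable_not_generic_arc hru hconv hq hji).preimage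
    (injective_branchDir hru hsep hji β)).measure_zero volume
  rw [← compl_mem_ae_iff] at hbad
  filter_upwards [hbad] with t ht hmem
  have hρ := arcRadius_branchDir_pos hru hsep hji hβ t
  have hbr := branch_eq_arcPoint hru hsep hji hβ t
  have hsp := norm_deriv_branch hru hsep hji hβ t
  have hσ := headway_pos_of_arcRadius_pos hru hsep hji hρ
  have hA := norm_pos_iff.2 (arcNormal_ne_zero hru hsep hρ)
  obtain ⟨htie, hint⟩ := (not_not.1 ht) hρ
  rw [hbr] at hmem
  rw [hbr, outwardNormal_gsvCell hru hsep hρ htie hmem (hint hmem), map_smul, smul_smul,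
    smul_smul]
  congr 1
  field_simp
  linear_combination P.φ (arcPoint P q i j (branchDir P q i j β t)) * hsp

lemma hyperbolaTerm_near {P : Network n} (hru : ∀ i, 0 ≤ P.ru i) (hΩ : IsCompact P.Ω)
    (hconv : Convex ℝ P.Ω) {q : Config n} (hq : Admissible P q) {i j : Fin n} (hji : j ≠ i) :
    hyperbolaTerm P q i i j = ∫ θ in Ioc (-Real.pi) Real.pi, nearWeight P q i j θ := by
  have hsep := hq.separated
  obtain ⟨β, hβ⟩ := exists_axis_eq_dir (hsep.ne hru hji)
  rw [hyperbolaTerm_eq_integral hru hΩ hconv hq hji hβ, integral_direction_eq hru hΩ hsep hji hβ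
    (periodic_nearWeight P q i j) fun θ h => (weights_eq_zero_of_arcDensity (by
      unfold arcDensity; rw [if_neg h])).1]
  refine setIntegral_congr_fun ((isClosed_gsvCell hru hΩ.isClosed hsep i).preimage
    (continuous_branch P q i j)).measurableSet fun t hmem => ?_
  have hρ := arcRadius_branchDir_pos hru hsep hji hβ t
  have hbr := branch_eq_arcPoint hru hsep hji hβ t
  have hσ := headway_pos_of_arcRadius_pos hru hsep hji hρ
  rw [mem_ofPred_eq, hbr] at hmem
  rw [transposedJacobian_near hru hsep hji hβ, nearWeight, if_neg hji, arcDensity,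
    if_pos ⟨hρ, hmem⟩, hbr, smul_smul, smul_smul]
  congr 1
  field_simp

lemma hyperbolaTerm_far {P : Network n} (hru : ∀ i, 0 ≤ P.ru i) (hΩ : IsCompact P.Ω)
    (hconv : Convex ℝ P.Ω) {q : Config n} (hq : Admissible P q) {i j : Fin n} (hji : j ≠ i) :
    hyperbolaTerm P q j i j = ∫ θ in Ioc (-Real.pi) Real.pi, farWeight P q i j θ := by
  have hsep := hq.separated
  obtain ⟨β, hβ⟩ := exists_axis_eq_dir (hsep.ne hru hji)
  rw [hyperbolaTerm_eq_integral hru hΩ hconv hq hji hβ, integral_direction_eq hru hΩ hsep hji hβ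
    (periodic_farWeight P q i j) fun θ h => (weights_eq_zero_of_arcDensity (by
      unfold arcDensity; rw [if_neg h])).2]
  refine setIntegral_congr_fun ((isClosed_gsvCell hru hΩ.isClosed hsep i).preimage
    (continuous_branch P q i j)).measurableSet fun t hmem => ?_
  have hρ := arcRadius_branchDir_pos hru hsep hji hβ t
  have hbr := branch_eq_arcPoint hru hsep hji hβ t
  have hσ := headway_pos_of_arcRadius_pos hru hsep hji hρ
  rw [mem_ofPred_eq, hbr] at hmem
  rw [transposedJacobian_far hru hsep hji hβ, farWeight, if_neg hji, arcDensity,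
    if_pos ⟨hρ, hmem⟩, hbr, smul_smul]
  congr 1
  field_simp

/-- Agents which are not guaranteed Delaunay neighbours do not contribute. -/
lemma hyperbolaTerm_eq_zero {P : Network n} (hru : ∀ i, 0 ≤ P.ru i) (hΩ : IsCompact P.Ω)
    {q : Config n} (hq : Separated P q) {i j : Fin n} (hji : j ≠ i)
    (h : j ∉ gdNeighbors P q i) (k : Fin n) : hyperbolaTerm P q k i j = 0 := by
  obtain ⟨β, hβ⟩ := exists_axis_eq_dir (hq.ne hru hji)
  unfold hyperbolaTerm lineIntegral
  have hset : {t ∈ univ | branch P q i j t ∈ frontier (gsvCell P q i) ∩ hyperbolicArc P q i j}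
      = ∅ := by
    -- A boundary point of the sensing cell on this branch also lies on the boundary of the larger
    -- Voronoi cell, since stepping outward across the branch leaves the dominance region. It would
    -- make `j` a neighbour.
    refine eq_empty_of_forall_notMem fun t ht => h ⟨hji, branch P q i j t, ht.2.2, ?_⟩
    have hρ := arcRadius_branchDir_pos hru hq hji hβ t
    have hbr := branch_eq_arcPoint hru hq hji hβ t
    have hmem : branch P q i j t ∈ gsvCell P q i :=
      (isClosed_gsvCell hru hΩ.isClosed hq i).frontier_subset ht.2.1
    refine ⟨subset_closure hmem.1, ?_⟩
    rw [hbr]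
    exact arcPoint_notMem_interior hru hq hρ fun p hp => (con_nonpos_iff hru hji q p).2
      ((mem_dominance_iff hru (hq i j hji.symm) p).1 (hp.2 j hji)).2
  rw [hset, setIntegral_empty]

lemma control_eq {P : Network n} (hru : ∀ i, 0 ≤ P.ru i) (hΩ : IsCompact P.Ω)
    (hconv : Convex ℝ P.Ω) (α : Fin n → ℝ) {q : Config n} (hq : Admissible P q) (i : Fin n) :
    control P α q i = α i • coverageGrad P q i := by
  classical
  have hterm : ∀ j, j ≠ i → hyperbolaTerm P q i i j + hyperbolaTerm P q i j i
      = (∫ θ in Ioc (-Real.pi) Real.pi, nearWeight P q i j θ)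
        + ∫ θ in Ioc (-Real.pi) Real.pi, farWeight P q j i θ := fun j hji => by
    rw [hyperbolaTerm_near hru hΩ hconv hq hji, hyperbolaTerm_far hru hΩ hconv hq hji.symm]
  have hself : (∫ θ in Ioc (-Real.pi) Real.pi, nearWeight P q i i θ)
      + ∫ θ in Ioc (-Real.pi) Real.pi, farWeight P q i i θ = circleTerm P q i := by
    rw [circleTerm_eq hru hΩ hconv hq]
    simp [farWeight]
  rw [control, ← smul_add, coverageGrad, ← Finset.add_sum_erase _ _ (Finset.mem_univ i), hself,
    ← Finset.sum_congr rfl fun j hj => hterm j (Finset.ne_of_mem_erase hj)]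
  congr 2
  refine Finset.sum_subset_zero_on_sdiff (fun j hj => ?_) (fun j hj => ?_) fun _ _ => by congr
  · have hne : j ≠ i := by
      rcases (Finset.mem_filter.1 hj).2 with h | h
      · exact h.1
      · exact h.1.symm
    exact Finset.mem_erase.2 ⟨hne, Finset.mem_univ j⟩
  · obtain ⟨h1, h2⟩ := Finset.mem_sdiff.1 hj
    have hne := Finset.ne_of_mem_erase h1
    have h3 : ¬ (j ∈ gdNeighbors P q i ∨ i ∈ gdNeighbors P q j) := fun h =>
      h2 (Finset.mem_filter.2 ⟨Finset.mem_univ j, h⟩)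
    push Not at h3
    rw [hyperbolaTerm_eq_zero hru hΩ hq.separated hne h3.1,
      hyperbolaTerm_eq_zero hru hΩ hq.separated hne.symm h3.2, add_zero]

/-! ### Continuity of the gradient -/

lemma continuous_headway_left (P : Network n) (i j : Fin n) (θ : ℝ) :
    Continuous (fun q : Config n => headway P q i j θ) := by
  unfold headway
  exact continuous_const.add (((continuous_apply j).sub (continuous_apply i)).inner
    continuous_const)

lemma continuous_gap (P : Network n) (i j : Fin n) :
    Continuous (fun q : Config n => ‖q j - q i‖ ^ 2 - (P.ru i + P.ru j) ^ 2) :=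
  ((((continuous_apply j).sub (continuous_apply i)).norm).pow 2).sub continuous_const

lemma continuousAt_arcRadius (P : Network n) {q : Config n} {i j : Fin n} {θ : ℝ}
    (hσ : j ≠ i → headway P q i j θ ≠ 0) :
    ContinuousAt (fun q : Config n => arcRadius P q i j θ) q := by
  by_cases hji : j = i
  · subst hji
    simp only [arcRadius_self]
    exact continuousAt_const
  · simp only [arcRadius_of_ne P _ hji]
    exact (continuous_gap P i j).continuousAt.div
      ((continuous_headway_left P i j θ).continuousAt.const_mul 2)
      (mul_ne_zero two_ne_zero (hσ hji))

lemma continuousAt_arcPoint (P : Network n) {q : Config n} {i j : Fin n} {θ : ℝ}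
    (hσ : j ≠ i → headway P q i j θ ≠ 0) :
    ContinuousAt (fun q : Config n => arcPoint P q i j θ) q :=
  (continuous_apply i).continuousAt.add ((continuousAt_arcRadius P hσ).smul continuousAt_const)

lemma continuousAt_con_arcPoint (P : Network n) {q : Config n} {i j : Fin n} {θ : ℝ}
    (hσ : j ≠ i → headway P q i j θ ≠ 0) (k : Fin n) :
    ContinuousAt (fun q : Config n => con P i k q (arcPoint P q i j θ)) q :=
  ContinuousAt.comp (g := fun z : Config n × Plane => con P i k z.1 z.2)
    (f := fun q : Config n => (q, arcPoint P q i j θ)) (continuous_con P i k).continuousAt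
    (continuousAt_id.prodMk (continuousAt_arcPoint P hσ))

/-- In a generic direction activity of the arc is stable: it either fails through a strict or open
condition, or holds with all other constraints strict and the point interior to `Ω`. A nonzero
headway keeps the arc point continuous. -/
lemma continuousAt_arcDensity {P : Network n} (hru : ∀ i, 0 ≤ P.ru i) (hΩ : IsClosed P.Ω)
    (hφ : ContinuousOn P.φ P.Ω) {q : Config n} (hq : Separated P q) {i j : Fin n} {θ : ℝ}
    (hθ : Generic P q i θ) (hσ : j ≠ i → headway P q i j θ ≠ 0) :
    ContinuousAt (fun q : Config n => arcDensity P q i j θ) q := by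
  have hρc := continuousAt_arcRadius P hσ
  have hpc := continuousAt_arcPoint P hσ
  have hzero : ∀ s : Config n → Prop, (∀ᶠ x in 𝓝 q, s x) →
      (∀ x, Separated P x → s x → ¬ (0 < arcRadius P x i j θ ∧
        arcPoint P x i j θ ∈ gsvCell P x i)) →
      ContinuousAt (fun q : Config n => arcDensity P q i j θ) q := fun s hs h => by
    refine (continuousAt_const (y := (0 : ℝ))).congr ?_
    filter_upwards [hs, (isOpen_separated P).mem_nhds hq] with x hx hsep
    unfold arcDensity
    rw [if_neg (h x hsep hx)]
  rcases le_or_gt (sensingRadius P i) 0 with hR | hR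
  · simp only [arcDensity_eq_zero_of_radius hR]
    exact continuousAt_const
  have hρ0 : arcRadius P q i j θ ≠ 0 := by
    by_cases hji : j = i
    · subst hji; rw [arcRadius_self]; exact hR.ne'
    · rw [arcRadius_of_ne P q hji]
      exact div_ne_zero (hq.gap_pos hru hji).ne' (mul_ne_zero two_ne_zero (hσ hji))
  rcases hρ0.lt_or_gt with hρ | hρ
  · exact hzero _ (hρc.eventually_lt_const hρ) fun x _ hx h => absurd h.1 hx.not_gt
  by_cases hpΩ : arcPoint P q i j θ ∈ P.Ω
  swap
  · exact hzero _ (hpc.eventually (hΩ.isOpen_compl.mem_nhds hpΩ)) fun x _ hx h =>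
      hx (gsvCell_subset P x i h.2)
  by_cases hk : ∃ k, 0 < con P i k q (arcPoint P q i j θ)
  · obtain ⟨k, hk⟩ := hk
    exact hzero _ ((continuousAt_con_arcPoint P hσ k).eventually_const_lt hk) fun x hsep hx h =>
      absurd (((mem_gsvCell_iff hru hsep i _).1 h.2).2 k) hx.not_ge
  push Not at hk
  obtain ⟨htie, hint⟩ := hθ j hρ
  have hin := hint ((mem_gsvCell_iff hru hq i _).2 ⟨hpΩ, hk⟩)
  have hφc : ContinuousAt P.φ (arcPoint P q i j θ) :=
    hφ.continuousAt (mem_interior_iff_mem_nhds.1 hin)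
  refine (hρc.mul (ContinuousAt.comp (g := P.φ) hφc hpc)).congr ?_
  have hcon : ∀ᶠ x in 𝓝 q, ∀ k, k ≠ j → con P i k x (arcPoint P x i j θ) < 0 := by
    rw [eventually_all]
    intro k
    by_cases hkj : k = j
    · simp [hkj]
    · filter_upwards [(continuousAt_con_arcPoint P hσ k).eventually_lt_const
        (lt_of_le_of_ne (hk k) (htie k hkj))] with x hx _ using hx
  filter_upwards [(isOpen_separated P).mem_nhds hq, hρc.eventually_const_lt hρ,
    hpc.eventually (isOpen_interior.mem_nhds hin), hcon] with x hsep hx hxin hxcon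
  unfold arcDensity
  rw [if_pos]
  · rfl
  refine ⟨hx, (mem_gsvCell_iff hru hsep i _).2 ⟨interior_subset hxin, fun k => ?_⟩⟩
  by_cases hkj : k = j
  · rw [hkj, con_arcPoint_self hru hsep hx]
  · exact (hxcon k hkj).le

lemma continuousAt_weights {P : Network n} (hru : ∀ i, 0 ≤ P.ru i) (hΩ : IsClosed P.Ω)
    (hφ : ContinuousOn P.φ P.Ω) {q : Config n} (hq : Separated P q) {i j : Fin n} {θ : ℝ}
    (hθ : Generic P q i θ) (hσ : j ≠ i → headway P q i j θ ≠ 0) :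
    ContinuousAt (fun q : Config n => nearWeight P q i j θ) q ∧
    ContinuousAt (fun q : Config n => farWeight P q i j θ) q := by
  have hd := continuousAt_arcDensity hru hΩ hφ hq hθ hσ
  unfold nearWeight farWeight
  by_cases hji : j = i
  · simp only [if_pos hji, mul_one, zero_smul]
    exact ⟨hd.smul continuousAt_const, continuousAt_const⟩
  · simp only [if_neg hji]
    have hh := (continuous_headway_left P i j θ).continuousAt (x := q)
    exact ⟨(hd.mul (((continuousAt_arcRadius P hσ).add continuousAt_const).div hh
      (hσ hji))).smul continuousAt_const, (hd.div hh (hσ hji)).smul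
      ((continuous_apply j).continuousAt.sub (continuousAt_arcPoint P hσ))⟩

lemma ae_headway_ne_zero {P : Network n} (hru : ∀ i, 0 ≤ P.ru i) {q : Config n}
    (hq : Separated P q) (i j : Fin n) : ∀ᵐ θ, j ≠ i → headway P q i j θ ≠ 0 := by
  by_cases hji : j = i
  · exact Eventually.of_forall fun _ h => absurd hji h
  have h := (countable_inner_dir_eq (v := q j - q i) (C := -(P.ru i + P.ru j))
    fun h => hq.ne hru hji h.1).measure_zero volume
  filter_upwards [compl_mem_ae_iff.2 h] with θ hθ _ h0
  refine hθ ?_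
  rw [mem_ofPred_eq]
  unfold headway at h0
  linarith

lemma continuousAt_integral_weights {P : Network n} (hru : ∀ i, 0 ≤ P.ru i)
    (hΩ : IsCompact P.Ω) (hconv : Convex ℝ P.Ω) (hφ0 : ∀ p, 0 ≤ P.φ p)
    (hφ : ContinuousOn P.φ P.Ω) {q : Config n} (hq : Admissible P q) (i j : Fin n) :
    ContinuousAt (fun q => ∫ θ in Ioc (-Real.pi) Real.pi, nearWeight P q i j θ) q ∧
    ContinuousAt (fun q => ∫ θ in Ioc (-Real.pi) Real.pi, farWeight P q i j θ) q := by
  have hsep := hq.separated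
  have hnear := (isOpen_separated P).mem_nhds hsep
  obtain ⟨C, hC0, hC⟩ := exists_density_bound hΩ hφ
  obtain ⟨E, hE0, hE⟩ : ∃ E : ℝ, 0 < E ∧
      ∀ᶠ x in 𝓝 q, j ≠ i → E ≤ ‖x j - x i‖ ^ 2 - (P.ru i + P.ru j) ^ 2 := by
    by_cases hji : j = i
    · exact ⟨1, one_pos, Eventually.of_forall fun _ h => absurd hji h⟩
    · have hg := hsep.gap_pos hru hji
      refine ⟨_, half_pos hg, ?_⟩
      filter_upwards [(continuous_gap P i j).continuousAt.eventually_const_lt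
        (half_lt_self hg)] with x hx _ using hx.le
  have hcont : ∀ᵐ θ ∂(volume.restrict (Ioc (-Real.pi) Real.pi)),
      ContinuousAt (fun q : Config n => nearWeight P q i j θ) q ∧
      ContinuousAt (fun q : Config n => farWeight P q i j θ) q := by
    filter_upwards [ae_generic hru hconv hq i,
      ae_restrict_of_ae (ae_headway_ne_zero hru hsep i j)] with θ h1 h2 using
      continuousAt_weights hru hΩ.isClosed hφ hsep h1 h2
  constructor
  · refine continuousAt_of_dominated ?_ ?_ (integrable_const (|sensingRadius P i| * C *
      (1 + (|sensingRadius P i| + (P.ru i + P.ru j)) * (2 * |sensingRadius P i| / E)))) ?_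
    · filter_upwards [hnear] with x hx using
        (measurable_nearWeight hru hΩ hφ hx i j).aestronglyMeasurable
    · filter_upwards [hnear, hE] with x hx hxE using Eventually.of_forall fun θ =>
        (norm_weights_le hru hφ0 hx hC0 hC i j hE0 hxE θ).1
    · filter_upwards [hcont] with θ h using h.1
  · refine continuousAt_of_dominated ?_ ?_ (integrable_const (|sensingRadius P i| * C *
      (1 + (|sensingRadius P i| + (P.ru i + P.ru j)) * (2 * |sensingRadius P i| / E)))) ?_
    · filter_upwards [hnear] with x hx using
        (measurable_farWeight hru hΩ hφ hx i j).aestronglyMeasurable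
    · filter_upwards [hnear, hE] with x hx hxE using Eventually.of_forall fun θ =>
        (norm_weights_le hru hφ0 hx hC0 hC i j hE0 hxE θ).2
    · filter_upwards [hcont] with θ h using h.2

/-- Continuity is in a full neighbourhood, including configurations that are not admissible; there
`coverageGrad` is still defined by its integrals, even if it need not be a gradient. -/
lemma continuousAt_coverageGrad {P : Network n} (hru : ∀ i, 0 ≤ P.ru i)
    (hΩ : IsCompact P.Ω) (hconv : Convex ℝ P.Ω) (hφ0 : ∀ p, 0 ≤ P.φ p)
    (hφ : ContinuousOn P.φ P.Ω) {q : Config n} (hq : Admissible P q) (k : Fin n) :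
    ContinuousAt (fun q => coverageGrad P q k) q := by
  unfold coverageGrad
  exact tendsto_finsetSum _ fun j _ =>
    (continuousAt_integral_weights hru hΩ hconv hφ0 hφ hq k j).1.add
      (continuousAt_integral_weights hru hΩ hconv hφ0 hφ hq j k).2

/-! ### The gradient flow -/

lemma hasGradientAt_coverage_update {P : Network n} (hru : ∀ i, 0 ≤ P.ru i)
    (hΩ : IsCompact P.Ω) (hconv : Convex ℝ P.Ω) (hφ0 : ∀ p, 0 ≤ P.φ p)
    (hφ : ContinuousOn P.φ P.Ω) {q : Config n} (hq : Admissible P q) (i : Fin n) :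
    HasGradientAt (fun x : Plane => coverage P (Function.update q i x)) (coverageGrad P q i)
      (q i) := by
  have h1 : HasFDerivAt (coverage P) (∑ k, pair k (coverageGrad P q k))
      (Function.update q i (q i)) := by
    rw [Function.update_eq_self]
    exact hasFDerivAt_coverage hru hΩ hconv hφ0 hφ hq
  rw [hasGradientAt_iff_hasFDerivAt]
  refine (h1.comp (q i) (hasFDerivAt_update q (q i))).congr_fderiv ?_
  ext v
  rw [ContinuousLinearMap.comp_apply, sum_apply]
  simp only [pair_apply, InnerProductSpace.toDual_apply_apply]
  rw [Finset.sum_eq_single i]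
  · simp
  · intro k _ hk
    simp [hk]
  · simp

lemma hasDerivWithinAt_coverage {P : Network n} (hru : ∀ i, 0 ≤ P.ru i)
    (hΩ : IsCompact P.Ω) (hconv : Convex ℝ P.Ω) (hφ0 : ∀ p, 0 ≤ P.φ p)
    (hφ : ContinuousOn P.φ P.Ω) {α : Fin n → ℝ} (hα : ∀ i, 0 < α i) {I : Set ℝ}
    {q : ℝ → Config n} (hq : IsTrajectory P α I q) {t : ℝ} (ht : t ∈ I) :
    HasDerivWithinAt (fun s => coverage P (q s))
      (∑ i, (α i)⁻¹ * ‖control P α (q t) i‖ ^ 2) I t := by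
  obtain ⟨hadm, hder⟩ := hq t ht
  refine ((hasFDerivAt_coverage hru hΩ hconv hφ0 hφ hadm).comp_hasDerivWithinAt t
    (hasDerivWithinAt_pi.2 hder)).congr_deriv ?_
  rw [sum_apply]
  refine Finset.sum_congr rfl fun k _ => ?_
  have := (hα k).ne'
  rw [pair_apply, control_eq hru hΩ hconv α hadm, real_inner_smul_right,
    real_inner_self_eq_norm_sq, norm_smul, mul_pow, Real.norm_eq_abs, sq_abs]
  field_simp

lemma monotoneOn_coverage {P : Network n} (hru : ∀ i, 0 ≤ P.ru i)
    (hΩ : IsCompact P.Ω) (hconv : Convex ℝ P.Ω) (hφ0 : ∀ p, 0 ≤ P.φ p)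
    (hφ : ContinuousOn P.φ P.Ω) {α : Fin n → ℝ} (hα : ∀ i, 0 < α i) {I : Set ℝ}
    (hI : I.OrdConnected) {q : ℝ → Config n} (hq : IsTrajectory P α I q) :
    MonotoneOn (fun s => coverage P (q s)) I := by
  have hd := fun t (ht : t ∈ I) => hasDerivWithinAt_coverage hru hΩ hconv hφ0 hφ hα hq ht
  exact monotoneOn_of_hasDerivWithinAt_nonneg hI.convex
    (fun t ht => (hd t ht).continuousWithinAt)
    (fun t ht => (hd t (interior_subset ht)).mono interior_subset)
    fun t _ => Finset.sum_nonneg fun i _ => mul_nonneg (inv_nonneg.2 (hα i).le) (sq_nonneg _)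

/-- A monotone function tends to each of its cluster points at infinity. -/
lemma tendsto_of_monotoneOn_of_mapClusterPt {h : ℝ → ℝ} {a L : ℝ} (hmono : MonotoneOn h (Ici a))
    (hL : MapClusterPt L atTop h) :
    Tendsto h atTop (𝓝 L) ∧ ∀ t, a ≤ t → h t ≤ L := by
  have hle : ∀ t, a ≤ t → h t ≤ L := fun t ht => by
    by_contra! hlt
    obtain ⟨s, hs, hts⟩ := ((hL.frequently (Iio_mem_nhds hlt)).and_eventually
      (eventually_ge_atTop t)).exists
    exact absurd (hmono ht (ht.trans hts) hts) (not_le.2 hs)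
  refine ⟨tendsto_order.2 ⟨fun c hc => ?_, fun c hc => ?_⟩, hle⟩
  · obtain ⟨s, hs, has⟩ := ((hL.frequently (Ioi_mem_nhds hc)).and_eventually
      (eventually_ge_atTop a)).exists
    filter_upwards [eventually_ge_atTop s] with t hst
    exact lt_of_lt_of_le hs (hmono has (has.trans hst) hst)
  · filter_upwards [eventually_ge_atTop a] with t ht
    exact (hle t ht).trans_lt hc

/-- If `h` converges along a curve, its derivative is not bounded away from zero while the curve is
near a cluster point. -/
lemma not_le_deriv_near_mapClusterPt {E : Type*} [NormedAddCommGroup E] [NormedSpace ℝ E]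
    {q u : ℝ → E} {h g : ℝ → ℝ} {x : E} {L K η r : ℝ}
    (hq : ∀ t, 0 ≤ t → HasDerivWithinAt q (u t) (Ici 0) t)
    (hh : ∀ t, 0 ≤ t → HasDerivWithinAt h (g t) (Ici 0) t)
    (hx : MapClusterPt x atTop q) (hL : Tendsto h atTop (𝓝 L)) (hK : 0 ≤ K) (hη : 0 < η)
    (hr : 0 < r) (hu : ∀ t, 0 ≤ t → q t ∈ Metric.ball x r → ‖u t‖ ≤ K) :
    ¬ ∀ t, 0 ≤ t → q t ∈ Metric.ball x r → η ≤ g t := by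
  intro hg
  -- At speed at most `K`, a curve starting within `r / 2` of `x` stays in the ball of radius `r`
  -- for time `τ`. Meanwhile `h` gains at least `η τ`, but late values of `h` are within `η τ / 2`
  -- of `L`. Using `K + 1` makes the speed comparison strict.
  set τ := r / (2 * (K + 1)) with hτ
  have hτ0 : 0 < τ := by positivity
  have hKτ : (K + 1) * τ = r / 2 := by rw [hτ]; field_simp
  have hητ : 0 < η * τ / 2 := by positivity
  obtain ⟨T, hT⟩ := (Metric.tendsto_atTop.1 hL) (η * τ / 2) hητ
  obtain ⟨t, hqt, htT⟩ := ((hx.frequently (Metric.ball_mem_nhds x (half_pos hr))).and_eventually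
    (eventually_ge_atTop (max T 0))).exists
  have hT1 : T ≤ t := (le_max_left _ _).trans htT
  have ht0 : 0 ≤ t := (le_max_right _ _).trans htT
  have hin : ∀ s, ‖q s - q t‖ ≤ r / 2 → q s ∈ Metric.ball x r := fun s hs => by
    rw [Metric.mem_ball]
    calc dist (q s) x ≤ dist (q s) (q t) + dist (q t) x := dist_triangle _ _ _
      _ < r / 2 + r / 2 := add_lt_add_of_le_of_lt (by rwa [dist_eq_norm]) hqt
      _ = r := add_halves r
  have hstay : ∀ s ∈ Icc t (t + τ), ‖q s - q t‖ ≤ (K + 1) * (s - t) := by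
    refine image_norm_le_of_norm_deriv_right_lt_deriv_boundary' (f := fun s => q s - q t)
      (f' := u) (B := fun s => (K + 1) * (s - t)) (B' := fun _ => K + 1) ?_ ?_ ?_ ?_ ?_ ?_
    · exact fun s hs => (((hq s (ht0.trans hs.1)).continuousWithinAt).mono
        fun y hy => ht0.trans hy.1).sub continuousWithinAt_const
    · exact fun s hs => ((hq s (ht0.trans hs.1)).mono
        (Ici_subset_Ici.2 (ht0.trans hs.1))).sub_const _
    · simp
    · fun_prop
    · intro s _
      have := (((hasDerivAt_id s).sub_const t).const_mul (K + 1)).hasDerivWithinAt (s := Ici s)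
      simpa using this
    · intro s hs he
      refine (hu s (ht0.trans hs.1) (hin s ?_)).trans_lt (lt_add_one K)
      rw [he, ← hKτ]
      exact mul_le_mul_of_nonneg_left (by linarith [hs.2]) (by positivity)
  have hgs : ∀ s ∈ Icc t (t + τ), η ≤ g s := fun s hs =>
    hg s (ht0.trans hs.1) (hin s ((hstay s hs).trans (by
      rw [← hKτ]
      exact mul_le_mul_of_nonneg_left (by linarith [hs.2]) (by positivity))))
  have hder : ∀ s ∈ Icc t (t + τ),
      HasDerivWithinAt (fun s => h s - η * s) (g s - η) (Icc t (t + τ)) s := fun s hs => by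
    have hsub : Icc t (t + τ) ⊆ Ici 0 := Icc_subset_Ici_self.trans (Ici_subset_Ici.2 ht0)
    have h1 := (hh s (ht0.trans hs.1)).mono hsub
    have h2 : HasDerivAt (fun s : ℝ => η * s) η s := by
      simpa using (hasDerivAt_id s).const_mul η
    exact h1.fun_sub h2.hasDerivWithinAt
  have hmono : MonotoneOn (fun s => h s - η * s) (Icc t (t + τ)) :=
    monotoneOn_of_hasDerivWithinAt_nonneg (convex_Icc _ _)
      (fun s hs => (hder s hs).continuousWithinAt)
      (fun s hs => (hder s (interior_subset hs)).mono interior_subset)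
      fun s hs => sub_nonneg.2 (hgs s (interior_subset hs))
  have h1 := hmono (left_mem_Icc.2 (by linarith)) (right_mem_Icc.2 (by linarith))
    (by linarith : t ≤ t + τ)
  simp only at h1
  have h2 := hT t hT1
  have h3 := hT (t + τ) (by linarith)
  rw [Real.dist_eq, abs_lt] at h2 h3
  nlinarith [h2.1, h3.2]

lemma coverageGrad_eq_zero_of_mapClusterPt {P : Network n} (hru : ∀ i, 0 ≤ P.ru i)
    (hΩ : IsCompact P.Ω) (hconv : Convex ℝ P.Ω) (hφ0 : ∀ p, 0 ≤ P.φ p)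
    (hφ : ContinuousOn P.φ P.Ω) {α : Fin n → ℝ} (hα : ∀ i, 0 < α i)
    {q : ℝ → Config n} (hq : IsTrajectory P α (Ici 0) q) {q' : Config n}
    (hcl : MapClusterPt q' atTop q) (hq' : Admissible P q') {L : ℝ}
    (hL : Tendsto (fun t => coverage P (q t)) atTop (𝓝 L)) (i : Fin n) :
    coverageGrad P q' i = 0 := by
  by_contra hne
  have hα0 := fun k => (hα k).le
  have hgrad := continuousAt_coverageGrad hru hΩ hconv hφ0 hφ hq'
  set U : Config n → Config n := fun x k => α k • coverageGrad P x k
  set G : Config n → ℝ := fun x => ∑ k, (α k)⁻¹ * ‖U x k‖ ^ 2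
  have hUk : ∀ k, ContinuousAt (fun x => U x k) q' := fun k => (hgrad k).const_smul (α k)
  have hU : ContinuousAt U q' := continuousAt_pi.2 hUk
  have hG : ContinuousAt G q' :=
    tendsto_finsetSum _ fun k _ => (((hUk k).norm.pow 2).const_mul ((α k)⁻¹))
  have hGpos : 0 < G q' := by
    refine Finset.sum_pos' (fun k _ => mul_nonneg (inv_nonneg.2 (hα0 k)) (sq_nonneg _))
      ⟨i, Finset.mem_univ i, mul_pos (inv_pos.2 (hα i)) (pow_pos (norm_pos_iff.2 ?_) 2)⟩
    exact smul_ne_zero (hα i).ne' hne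
  have hev := (hU.norm.eventually_lt_const (lt_add_one ‖U q'‖)).and
    (hG.eventually_const_lt (half_lt_self hGpos))
  obtain ⟨r, hr, hball⟩ := Metric.eventually_nhds_iff_ball.1 hev
  -- The control is identified with the gradient only at admissible configurations, hence on the
  -- trajectory. Continuity at the limit point is applied to `U`, which makes sense on the whole
  -- ball.
  have hctrl : ∀ t, 0 ≤ t → control P α (q t) = U (q t) := fun t ht => by
    ext1 k
    exact control_eq hru hΩ hconv α (hq t ht).1 k
  refine not_le_deriv_near_mapClusterPt (K := ‖U q'‖ + 1)
    (fun t ht => hasDerivWithinAt_pi.2 (hq t ht).2)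
    (fun t ht => hasDerivWithinAt_coverage hru hΩ hconv hφ0 hφ hα hq ht) hcl hL
    (by positivity) (half_pos hGpos) hr (fun t ht h => ?_) fun t ht h => ?_
  · rw [hctrl t ht]
    exact (hball _ h).1.le
  · rw [hctrl t ht]
    exact (hball _ h).2.le

end GuaranteedVoronoi

end

open GuaranteedVoronoi in
theorem theorem1 (n : ℕ) (P : Network n)
    (hΩ_compact : IsCompact P.Ω) (hΩ_convex : Convex ℝ P.Ω)
    (hru : ∀ i, 0 ≤ P.ru i)
    (hφ_nonneg : ∀ p, 0 ≤ P.φ p) (hφ_cont : ContinuousOn P.φ P.Ω)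
    (α : Fin n → ℝ) (hα : ∀ i, 0 < α i) :
    -- the control law is the gradient of the coverage criterion, scaled by the gains
    (∀ q : Config n, Admissible P q → ∀ i,
      DifferentiableAt ℝ (fun x : Plane => coverage P (Function.update q i x)) (q i) ∧
      control P α q i =
        α i • gradient (fun x : Plane => coverage P (Function.update q i x)) (q i)) ∧
    -- the coverage criterion increases along every trajectory
    (∀ (I : Set ℝ) (q : ℝ → Config n), I.OrdConnected → IsTrajectory P α I q →
      (∀ t ∈ I, HasDerivWithinAt (fun s => coverage P (q s))
        (∑ i, (α i)⁻¹ * ‖control P α (q t) i‖ ^ 2) I t) ∧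
      MonotoneOn (fun s => coverage P (q s)) I) ∧
    -- limit configurations are critical points, and have the largest coverage on the trajectory
    (∀ q : ℝ → Config n, IsTrajectory P α (Set.Ici 0) q →
      ∀ q' : Config n, MapClusterPt q' Filter.atTop q → Admissible P q' →
        (∀ i, HasGradientAt (fun x : Plane => coverage P (Function.update q' i x)) 0 (q' i)) ∧
        (∀ i, control P α q' i = 0) ∧
        Filter.Tendsto (fun t => coverage P (q t)) Filter.atTop (nhds (coverage P q')) ∧
        ∀ t, 0 ≤ t → coverage P (q t) ≤ coverage P q') := by
  refine ⟨fun q hq i => ?_, fun I q hI hq => ⟨fun t ht =>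
    hasDerivWithinAt_coverage hru hΩ_compact hΩ_convex hφ_nonneg hφ_cont hα hq ht,
    monotoneOn_coverage hru hΩ_compact hΩ_convex hφ_nonneg hφ_cont hα hI hq⟩,
    fun q hq q' hcl hq' => ?_⟩
  · have h := hasGradientAt_coverage_update hru hΩ_compact hΩ_convex hφ_nonneg hφ_cont hq i
    refine ⟨h.differentiableAt, ?_⟩
    rw [h.gradient]
    exact control_eq hru hΩ_compact hΩ_convex α hq i
  · have hmono := monotoneOn_coverage hru hΩ_compact hΩ_convex hφ_nonneg hφ_cont hα
      Set.ordConnected_Ici hq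
    have hc := (hasFDerivAt_coverage hru hΩ_compact hΩ_convex hφ_nonneg hφ_cont hq').continuousAt
    -- By continuity at `q'`, the value of the criterion there is a cluster point of its values
    -- along the trajectory, and a monotone function converges to any cluster point.
    obtain ⟨hlim, hle⟩ := tendsto_of_monotoneOn_of_mapClusterPt hmono
      (hcl.continuousAt_comp hc)
    have hzero := coverageGrad_eq_zero_of_mapClusterPt hru hΩ_compact hΩ_convex hφ_nonneg hφ_cont
      hα hq hcl hq' hlim
    refine ⟨fun i => ?_, fun i => ?_, hlim, hle⟩
    · have h := hasGradientAt_coverage_update hru hΩ_compact hΩ_convex hφ_nonneg hφ_cont hq' i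
      rwa [hzero i] at h
    · rw [control_eq hru hΩ_compact hΩ_convex α hq' i, hzero i, smul_zero]
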